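/- Let $k$ be a field that is complete with respect to a non-trivial discrete non-archimedean absolute value, let $R$ be its valuation ring and $\pi$ a uniformizer of $R$. Let $R\langle T_1,\dots,T_m\rangle$ be the ring of power series over $R$ whose coefficients tend to $0$. A *semi-affinoid* $k$-algebra is a $k$-algebra $\mathcal{A}$ which admits, for some integers $m,n\ge 0$, a surjective homomorphism of $k$-algebras $$R\langle T_1,\dots,T_m\rangle[[S_1,\dots,S_n]]\otimes_R k\longrightarrow \mathcal{A}.$$ Its associated $k$-analytic space $X$ is the Zariski closed subspace, defined by the kernel of this homomorphism, of the product of the $m$-dimensional closed unit polydisc and the $n$-dimensional open unit polydisc. The points $x$ of $X$ are the multiplicative seminorms $f\mapsto|f(x)|$ on $\mathcal{A}$ which extend the absolute value of $k$, are $\le 1$ on the image of $R\langle T_1,\dots,T_m\rangle[[S_1,\dots,S_n]]$, and are $<1$ on the images of $S_1,\dots,S_n$. For $f\in\mathcal{A}$ put $|f|_{\sup}:=\sup_{x\in X}|f(x)|$, and let $$\mathcal{A}^\circ:=\{f\in\mathcal{A} : |f|_{\sup}\le 1\}.$$ **Proposition 6.1.** Let $\varphi:\mathcal{B}\to\mathcal{A}$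 be a homomorphism of semi-affinoid $k$-algebras which is finite (i.e. $\mathcal{A}$ is a finitely generated $\mathcal{B}$-module), and assume that $\mathcal{A}$ is reduced. Then, for every choice of presentations of $\mathcal{A}$ and $\mathcal{B}$ as above, $\varphi(\mathcal{B}^\circ)\subseteq\mathcal{A}^\circ$, and the induced homomorphism $\varphi^\circ:\mathcal{B}^\circ\to\mathcal{A}^\circ$ is finite, i.e. $\mathcal{A}^\circ$ is a finitely generated $\mathcal{B}^\circ$-module. -/

import Mathlib

open scoped TensorProduct

namespace SemiAffinoid

/-- The valuation ring `R = {c ∈ k : ‖c‖ ≤ 1}` of a non-archimedean field `k`. -/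
noncomputable abbrev ValRing (k : Type*) [NormedField k] [IsUltrametricDist k] : Subring k :=
  (NormedField.valuation (K := k)).integer

/-- The Tate algebra `R⟨T₁, …, Tₘ⟩` over the valuation ring `R` of `k`: the power series in `m`
variables with coefficients in `R` whose coefficients tend to `0`. -/
noncomputable def tate (k : Type*) [NormedField k] [IsUltrametricDist k] (m : ℕ) :
    Subalgebra (ValRing k) (MvPowerSeries (Fin m) (ValRing k)) where
  carrier := {f | Filter.Tendsto (fun ν : Fin m →₀ ℕ => ‖((MvPowerSeries.coeff ν f : ValRing k) : k)‖)
    Filter.cofinite (nhds 0)}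
  mul_mem' {f g} hf hg := by
    have := MvPowerSeries.isRestricted.mul (R := ValRing k) (fun _ => (1 : ℝ)) (f := f) (g := g)
      (by simpa [MvPowerSeries.IsRestricted] using hf)
      (by simpa [MvPowerSeries.IsRestricted] using hg)
    simpa [MvPowerSeries.IsRestricted] using this
  add_mem' {f g} hf hg := by
    have := MvPowerSeries.isRestricted.add (R := ValRing k) (fun _ => (1 : ℝ)) (f := f) (g := g)
      (by simpa [MvPowerSeries.IsRestricted] using hf)
      (by simpa [MvPowerSeries.IsRestricted] using hg)
    simpa [MvPowerSeries.IsRestricted] using this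
  algebraMap_mem' a := by
    have := MvPowerSeries.isRestricted_C (R := ValRing k) (σ := Fin m) (fun _ => (1 : ℝ)) a
    simpa [MvPowerSeries.IsRestricted, MvPowerSeries.algebraMap_apply] using this

/-- The ring `R⟨T₁, …, Tₘ⟩⟦S₁, …, Sₙ⟧`. A special `R`-algebra is a quotient of such a ring. -/
abbrev MixedSeries (k : Type*) [NormedField k] [IsUltrametricDist k] (m n : ℕ) : Type _ :=
  MvPowerSeries (Fin n) (tate k m)

/-- A presentation of a semi-affinoid `k`-algebra: a surjective homomorphism of `k`-algebras
`k ⊗_R R⟨T₁, …, Tₘ⟩⟦S₁, …, Sₙ⟧ → 𝒜`. A `k`-algebra is semi-affinoid iff it has a presentation. -/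
structure Presentation (k : Type*) [NormedField k] [IsUltrametricDist k]
    (𝒜 : Type*) [CommRing 𝒜] [Algebra k 𝒜] where
  /-- the number of variables `T` -/
  m : ℕ
  /-- the number of variables `S` -/
  n : ℕ
  /-- the projection -/
  proj : k ⊗[ValRing k] MixedSeries k m n →ₐ[k] 𝒜
  surjective : Function.Surjective proj

variable {k : Type*} [NormedField k] [IsUltrametricDist k]
  {𝒜 : Type*} [CommRing 𝒜] [Algebra k 𝒜]

/-- The image in `𝒜` of a series of `R⟨T₁, …, Tₘ⟩⟦S₁, …, Sₙ⟧`. These images form the special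
`R`-model of `𝒜` given by the presentation. -/
noncomputable def Presentation.ofSeries (P : Presentation k 𝒜) (f : MixedSeries k P.m P.n) : 𝒜 :=
  P.proj (1 ⊗ₜ[ValRing k] f)

/-- The points of the `k`-analytic space `X` (in the sense of Berkovich) associated with `𝒜`, i.e.
of the Zariski closed subspace, cut out by the kernel of the presentation, of the product of the
closed unit polydisc with coordinates `T₁, …, Tₘ` and the open unit polydisc with coordinates
`S₁, …, Sₙ`. A point is a multiplicative seminorm on `𝒜` which extends the absolute value of `k`,
is at most `1` on `R⟨T₁, …, Tₘ⟩⟦S₁, …, Sₙ⟧`, and is smaller than `1` on `S₁, …, Sₙ`.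

Such a seminorm is at most `max (|π|, ε) ^ N` on the `N`-th power of the ideal `(π, S₁, …, Sₙ)`,
where `ε = max |Sⱼ| < 1`, so it is determined by its values on polynomials in `T` and `S`, and
there it is bounded by the Gauss norm of the affinoid domain `{|Tᵢ| ≤ 1, |Sⱼ| ≤ ε}` of the
product of polydiscs: it is a point of that affinoid domain. -/
structure Presentation.Point (P : Presentation k 𝒜) extends MulRingSeminorm 𝒜 where
  apply_algebraMap' : ∀ c : k, toFun (algebraMap k 𝒜 c) = ‖c‖
  apply_ofSeries_le' : ∀ f : MixedSeries k P.m P.n, toFun (P.ofSeries f) ≤ 1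
  apply_ofSeries_X_lt' : ∀ j : Fin P.n, toFun (P.ofSeries (MvPowerSeries.X j)) < 1

/-- `|f|_sup`, the supremum of the values `|f(x)|` over all points `x` of the analytic space
associated with `𝒜`. -/
noncomputable def Presentation.supNorm (P : Presentation k 𝒜) (f : 𝒜) : ENNReal :=
  ⨆ x : P.Point, ENNReal.ofReal (x.toMulRingSeminorm f)

theorem Presentation.supNorm_le_one_iff (P : Presentation k 𝒜) (f : 𝒜) :
    P.supNorm f ≤ 1 ↔ ∀ x : P.Point, x.toMulRingSeminorm f ≤ 1 := by
  simp [Presentation.supNorm, iSup_le_iff]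

/-- The closed unit ball of a point is stable under addition. -/
theorem Presentation.Point.add_le_one {P : Presentation k 𝒜} (x : P.Point) {f g : 𝒜}
    (hf : x.toMulRingSeminorm f ≤ 1) (hg : x.toMulRingSeminorm g ≤ 1) :
    x.toMulRingSeminorm (f + g) ≤ 1 := by
  have hnat : ∀ N : ℕ, x.toMulRingSeminorm (N : 𝒜) ≤ 1 := fun N => by
    have h := x.apply_algebraMap' (N : k)
    rw [map_natCast] at h
    exact (le_of_eq h).trans (IsUltrametricDist.norm_natCast_le_one k N)
  have hpow : ∀ N : ℕ, x.toMulRingSeminorm (f + g) ^ N ≤ N + 1 := fun N => by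
    rw [← map_pow, add_pow]
    refine (Finset.le_sum_of_subadditive _ (map_zero _).le (map_add_le_add _) _ _).trans ?_
    refine (Finset.sum_le_card_nsmul _ _ 1 fun i _ => ?_).trans (by simp)
    rw [map_mul, map_mul, map_pow, map_pow]
    exact mul_le_one₀ (mul_le_one₀ (pow_le_one₀ (apply_nonneg _ _) hf)
      (pow_nonneg (apply_nonneg _ _) _) (pow_le_one₀ (apply_nonneg _ _) hg))
      (apply_nonneg _ _) (hnat _)
  by_contra! h
  have h1 := (tendsto_pow_const_div_const_pow_of_one_lt 1 h).add
    (tendsto_pow_const_div_const_pow_of_one_lt 0 h)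
  obtain ⟨N, hN⟩ := (h1.eventually_lt_const (u := 1) (by norm_num)).exists
  have hpos : 0 < x.toMulRingSeminorm (f + g) ^ N := by positivity
  rw [← add_div, div_lt_one hpos] at hN
  have := hpow N
  simp only [pow_one, pow_zero] at hN
  linarith

/-- The ring `𝒜° = {f ∈ 𝒜 : |f|_sup ≤ 1}` of power-bounded functions. -/
noncomputable def Presentation.powerBounded (P : Presentation k 𝒜) : Subring 𝒜 where
  carrier := {f | P.supNorm f ≤ 1}
  mul_mem' {f g} hf hg := by
    simp only [Set.mem_ofPred_eq, P.supNorm_le_one_iff] at hf hg ⊢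
    intro x
    rw [map_mul]
    exact mul_le_one₀ (hf x) (apply_nonneg _ _) (hg x)
  one_mem' := by
    simp [P.supNorm_le_one_iff]
  add_mem' {f g} hf hg := by
    simp only [Set.mem_ofPred_eq, P.supNorm_le_one_iff] at hf hg ⊢
    exact fun x => x.add_le_one (hf x) (hg x)
  zero_mem' := by
    simp [P.supNorm_le_one_iff]
  neg_mem' {f} hf := by
    simp only [Set.mem_ofPred_eq, P.supNorm_le_one_iff] at hf ⊢
    intro x
    rw [map_neg_eq_map]
    exact hf x

end SemiAffinoid

/-! Write `D` and `D'` for the series rings `R⟨T⟩⟦S⟧` presenting `ℬ` and `𝒜`. The three facts below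
put `𝒜°` inside a finite `D`-module. As `D` is Noetherian and maps into `ℬ°`, this makes `𝒜°` finite
over `ℬ°`.

(1) `𝒜°` is the integral closure of `D'` in `𝒜` (`Presentation.mem_powerBounded_iff`). An integral
element is bounded by `1` at every point because its powers stay in a finite module. If `f` is not
integral, then `1/f` is a nonunit of the ring generated by `1/f` over `D'` in `𝒜_f`. A discrete
valuation centred at a maximal ideal containing `1/f` (`exists_dvr_notMem_of_not_isIntegral`)
becomes, after rescaling, a point with `|f(x)| > 1`.

(2) The image of `D'` in `𝒜` is integral over `D`. Otherwise the same separation yields a discrete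
valuation that is bounded on `D` but not on `D'`. This is impossible: in the `π`-adically complete
ring `D'` every `1 + πc` has roots of all orders `q ^ n`, for an integer `q > 1` that is a unit,
whereas a discrete value group has no infinitely divisible elements besides the trivial one
(`mem_of_isAdicComplete`). The same argument with the roles exchanged gives `φ(ℬ°) ⊆ 𝒜°`.

(3) The integral closure of `D` in `𝒜` is finite over `D`. Since `𝒜` is reduced, it embeds into the
product of its residue fields at the minimal primes, so it suffices to treat fields `L` that are
fraction fields of finite `D`-algebras (`MixedSeries.integralClosure_fg`). The proof is Noetherian
induction on the kernel of `D → L`. If the kernel contains `π` and all `Sⱼ`, the image of `D` is of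
finite type over the residue field of `R`, and Noether normalization applies. Otherwise some `x`
among `π, Sⱼ` survives in `L`, and `D` is `x`-adically complete. Finitely many discrete valuation
rings detect divisibility by `x` in the integral closure (`exists_finite_isEssentialDVR`). Filtering
by their valuations gives graded pieces that embed into integral closures of `D` in residue fields
where `x` vanishes; these are finite by induction. Hence the integral closure is finite modulo `x`,
and so finite, by completeness of `D` (`eq_top_of_fg_of_adic`).

The valuation rings come from localizing at the associated primes of `x` and adjoining the integral
elements that a power of the maximal ideal multiplies into the ring. This transform is Noetherian,
and it is a discrete valuation ring at each maximal ideal associated to `x`. -/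

namespace SemiAffinoid

/-! ### Adically complete rings: lifting finiteness and the Noetherian property from the quotient.
-/

section Complete

variable {R : Type*} [CommRing R]

theorem exists_adic_sum (x : R) [IsPrecomplete (Ideal.span {x}) R] (a : ℕ → R) :
    ∃ s, ∀ n, x ^ n ∣ s - ∑ i ∈ Finset.range n, x ^ i * a i := by
  obtain ⟨s, hs⟩ := IsPrecomplete.prec' (I := Ideal.span {x}) (M := R)
    (fun n => ∑ i ∈ Finset.range n, x ^ i * a i) (by
      intro m n hmn
      rw [SModEq.comm, SModEq.sub_mem, ← Finset.sum_range_add_sum_Ico _ hmn, add_sub_cancel_left]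
      simp only [smul_eq_mul, Ideal.mul_top, Ideal.span_singleton_pow]
      refine Ideal.sum_mem _ fun i hi => Ideal.mem_span_singleton.2 ?_
      exact Dvd.dvd.mul_right (pow_dvd_pow x (Finset.mem_Ico.1 hi).1) _)
  refine ⟨s, fun n => ?_⟩
  have h := (hs n).symm
  rw [SModEq.sub_mem] at h
  simpa only [smul_eq_mul, Ideal.mul_top, Ideal.span_singleton_pow,
    Ideal.mem_span_singleton] using h

/-- Over an `x`-adically complete ring, an `x`-adically separated module which is finite modulo `x`
is finite. -/
theorem eq_top_of_fg_of_adic {M : Type*} [AddCommGroup M] [Module R M] (x : R)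
    [IsPrecomplete (Ideal.span {x}) R]
    (hsep : ∀ m : M, (∀ n : ℕ, ∃ m', m = x ^ n • m') → m = 0) (N : Submodule R M) (hN : N.FG)
    (h : ∀ m : M, ∃ n ∈ N, ∃ m', m = n + x • m') : N = ⊤ := by
  obtain ⟨r, g, rfl⟩ := Submodule.fg_iff_exists_fin_generating_family.1 hN
  have h' : ∀ m : M, ∃ (c : Fin r → R) (m' : M), m = ∑ j, c j • g j + x • m' := fun m => by
    obtain ⟨n, hn, m', hm'⟩ := h m
    obtain ⟨c, rfl⟩ := (Submodule.mem_span_range_iff_exists_fun R).1 hn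
    exact ⟨c, m', hm'⟩
  choose c next hc using h'
  refine eq_top_iff.2 fun m _ => ?_
  let s : ℕ → M := fun n => next^[n] m
  -- Successive approximation: iterating `m ↦ m'` expands the coefficients of `m` as power series in
  -- `x`.
  have hs : ∀ n, m = ∑ j, (∑ i ∈ Finset.range n, x ^ i * c (s i) j) • g j + x ^ n • s n := by
    intro n
    induction n with
    | zero => simp [s]
    | succ n ih =>
      have e : s (n + 1) = next (s n) := Function.iterate_succ_apply' next n m
      have h1 : x ^ n • s n = ∑ j, (x ^ n * c (s n) j) • g j + x ^ (n + 1) • s (n + 1) := by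
        conv_lhs => rw [hc (s n)]
        rw [smul_add, Finset.smul_sum, e, pow_succ, mul_smul]
        simp only [mul_smul]
      conv_lhs => rw [ih, h1, ← add_assoc, ← Finset.sum_add_distrib]
      simp only [Finset.sum_range_succ, add_smul]
  choose t ht using fun j => exists_adic_sum x (fun i => c (s i) j)
  have : m = ∑ j, t j • g j := by
    rw [← sub_eq_zero]
    refine hsep _ fun n => ?_
    choose d hd using fun j => ht j n
    refine ⟨s n - ∑ j, d j • g j, ?_⟩
    have h2 : ∑ j, t j • g j = ∑ j, (∑ i ∈ Finset.range n, x ^ i * c (s i) j) • g j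
        + x ^ n • ∑ j, d j • g j := by
      rw [Finset.smul_sum, ← Finset.sum_add_distrib]
      refine Finset.sum_congr rfl fun j _ => ?_
      rw [← mul_smul, ← hd j, ← add_smul, add_sub_cancel]
    rw [h2]
    conv_lhs => rw [hs n]
    rw [smul_sub]
    abel
  rw [this]
  exact Submodule.sum_mem _ fun j _ => Submodule.smul_mem _ _ (Submodule.subset_span ⟨j, rfl⟩)

/-- By Cohen's criterion only primes `P` matter. Lift generators of the image of `P` modulo `x`. If
`x ∈ P`, they generate `P` together with `x`. If not, primality turns `x r ∈ P` into `r ∈ P`, so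
they generate `P` modulo `x P` and completeness finishes. -/
theorem isNoetherianRing_of_adic (x : R) [IsAdicComplete (Ideal.span {x}) R]
    [IsNoetherianRing (R ⧸ Ideal.span {x})] : IsNoetherianRing R := by
  refine IsNoetherianRing.of_prime fun P hP => ?_
  obtain ⟨S, hS⟩ : (P.map (Ideal.Quotient.mk (Ideal.span {x}))).FG := IsNoetherian.noetherian _
  have hlift : ∀ s : S, ∃ p ∈ P, Ideal.Quotient.mk (Ideal.span {x}) p = s := fun s =>
    (Ideal.mem_map_iff_of_surjective _ Ideal.Quotient.mk_surjective).1
      (hS ▸ Ideal.subset_span s.2)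
  choose p hp hps using hlift
  have key : ∀ a ∈ P, ∃ n ∈ Ideal.span (Set.range p), ∃ r, a = n + x * r := by
    intro a ha
    have h1 : Ideal.Quotient.mk (Ideal.span {x}) a ∈
        (Ideal.span (Set.range p)).map (Ideal.Quotient.mk (Ideal.span {x})) := by
      rw [Ideal.map_span]
      have h2 := Ideal.mem_map_of_mem (Ideal.Quotient.mk (Ideal.span {x})) ha
      rw [← hS] at h2
      refine Ideal.span_mono ?_ h2
      intro s hs
      exact ⟨p ⟨s, hs⟩, ⟨_, rfl⟩, hps _⟩
    obtain ⟨n, hn, hna⟩ := (Ideal.mem_map_iff_of_surjective _ Ideal.Quotient.mk_surjective).1 h1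
    rw [eq_comm, Ideal.Quotient.eq, Ideal.mem_span_singleton] at hna
    obtain ⟨r, hr⟩ := hna
    exact ⟨n, hn, r, by rw [← hr]; ring⟩
  have hfg : (Ideal.span (Set.range p)).FG := Submodule.fg_span (Set.finite_range p)
  have hle : Ideal.span (Set.range p) ≤ P := Ideal.span_le.2 (by rintro _ ⟨s, rfl⟩; exact hp s)
  by_cases hx : x ∈ P
  · have : P = Ideal.span (Set.range p) ⊔ Ideal.span {x} := by
      refine le_antisymm (fun a ha => ?_) (sup_le hle ((Ideal.span_singleton_le_iff_mem _).2 hx))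
      obtain ⟨n, hn, r, rfl⟩ := key a ha
      exact Submodule.add_mem_sup hn (Ideal.mem_span_singleton.2 (Dvd.intro _ rfl))
    rw [this]
    exact Submodule.FG.sup hfg (Submodule.fg_span_singleton x)
  · have hN : (Submodule.comap P.subtype (Ideal.span (Set.range p))).FG := by
      refine Submodule.fg_of_fg_map_injective P.subtype P.injective_subtype ?_
      rwa [Submodule.map_comap_subtype, inf_eq_right.2 hle]
    have htop := eq_top_of_fg_of_adic (M := P) x (fun m hm => ?_) _ hN (fun m => ?_)
    · have h3 := hN
      rw [htop] at h3
      exact (Submodule.fg_top P).1 h3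
    · refine Subtype.ext (IsHausdorff.haus' (I := Ideal.span {x}) (m : R) fun n => ?_)
      obtain ⟨m', hm'⟩ := hm n
      rw [SModEq.zero, smul_eq_mul, Ideal.mul_top, Ideal.span_singleton_pow,
        Ideal.mem_span_singleton]
      exact ⟨m', by simpa using congrArg Subtype.val hm'⟩
    · obtain ⟨n, hn, r, hr⟩ := key m m.2
      have hxr : x * r ∈ P := by
        have := sub_mem m.2 (hle hn)
        rwa [hr, add_sub_cancel_left] at this
      exact ⟨⟨n, hle hn⟩, hn, ⟨r, (hP.mem_or_mem hxr).resolve_left hx⟩, Subtype.ext hr⟩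

end Complete

/-! ### Associated primes of principal ideals and conductors into the integral closure. -/

section Noetherian

variable {A : Type*} [CommRing A]

/-- An associated prime of `A ⧸ J`. It is used to replace an element `f` by a multiple `b f` whose
conductor into the integral closure is prime. -/
theorem exists_mul_mem_iff_mem_prime [IsNoetherianRing A] {J : Ideal A} (hJ : J ≠ ⊤) :
    ∃ (b : A) (P : Ideal A), P.IsPrime ∧ ∀ a, a * b ∈ J ↔ a ∈ P := by
  have : Nontrivial (A ⧸ J) := Ideal.Quotient.nontrivial_iff.2 hJ
  obtain ⟨P, hP⟩ := associatedPrimes.nonempty A (A ⧸ J)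
  obtain ⟨h1, y, hy⟩ := isAssociatedPrime_iff.1 hP
  obtain ⟨b, rfl⟩ := Ideal.Quotient.mk_surjective y
  refine ⟨b, P, h1, fun a => ?_⟩
  rw [hy, Submodule.mem_colon_singleton, Submodule.mem_bot, ← Ideal.Quotient.eq_zero_iff_mem,
    map_mul]
  rfl

theorem mem_associatedPrimes_span_singleton_iff [IsNoetherianRing A] {x : A} {P : Ideal A} :
    P ∈ associatedPrimes A (A ⧸ Ideal.span {x}) ↔ P.IsPrime ∧ ∃ y, ∀ a, x ∣ a * y ↔ a ∈ P := by
  rw [AssociatedPrimes.mem_iff, isAssociatedPrime_iff]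
  refine and_congr_right fun _ => ?_
  rw [Ideal.Quotient.mk_surjective.exists]
  refine exists_congr fun y => ?_
  rw [SetLike.ext_iff]
  refine forall_congr' fun a => ?_
  rw [Submodule.mem_colon_singleton, Submodule.mem_bot, ← Ideal.mem_span_singleton,
    ← Ideal.Quotient.eq_zero_iff_mem (I := Ideal.span {x}), map_mul]
  exact Iff.comm

/-- A maximal ideal which is not associated to `(x)` contains a nonzerodivisor modulo `x`. -/
theorem exists_mem_regular_mod_of_notMem_associatedPrimes [IsNoetherianRing A] {x : A}
    {P : Ideal A} (hPm : P.IsMaximal) (hP : P ∉ associatedPrimes A (A ⧸ Ideal.span {x})) :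
    ∃ s ∈ P, ∀ b, x ∣ s * b → x ∣ b := by
  by_contra! H
  have hsub : (P : Set A) ⊆ ⋃ p ∈ associatedPrimes A (A ⧸ Ideal.span {x}), (p : Set A) := by
    rw [biUnion_associatedPrimes_eq_zero_divisors]
    intro s hs
    obtain ⟨b, hb, hb'⟩ := H s hs
    refine ⟨Ideal.Quotient.mk _ b, ?_, ?_⟩
    · rwa [Ne, Ideal.Quotient.eq_zero_iff_mem, Ideal.mem_span_singleton]
    · rw [← Ideal.mem_span_singleton, ← Ideal.Quotient.eq_zero_iff_mem, map_mul] at hb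
      exact hb
  obtain ⟨q, hq, hle⟩ := (Ideal.subset_union_prime_finite
    (associatedPrimes.finite A (A ⧸ Ideal.span {x})) (f := id) ⊥ ⊥
    (fun i hi _ _ => hi.1)).1 hsub
  have : P = q := hPm.eq_of_le hq.1.ne_top hle
  exact hP (this ▸ hq)

theorem dvd_of_pow_dvd_mul [IsDomain A] {x s : A} (hx : x ≠ 0) (hs : ∀ b, x ∣ s * b → x ∣ b)
    (n k : ℕ) (b : A) (h : x ^ n ∣ s ^ k * b) : x ^ n ∣ b := by
  have hs' : ∀ k b, x ∣ s ^ k * b → x ∣ b := by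
    intro k
    induction k with
    | zero => simp
    | succ k ih => intro b hb; exact ih _ (hs _ (by rwa [pow_succ', mul_assoc] at hb))
  induction n generalizing b with
  | zero => simp
  | succ n ih =>
    obtain ⟨c, rfl⟩ := hs' k b ((dvd_pow_self x n.succ_ne_zero).trans h)
    rw [pow_succ'] at h ⊢
    refine mul_dvd_mul_left x (ih c ?_)
    rw [show s ^ k * (x * c) = x * (s ^ k * c) by ring] at h
    exact (mul_dvd_mul_iff_left hx).1 h

variable {K : Type*} [Field K] [Algebra A K] [IsFractionRing A K]

/-- An element of the fraction field is integral if its multiples by `x` and `s` are, for a regular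
sequence `x, s`. -/
theorem isIntegral_of_smul_of_smul [IsDomain A] [IsNoetherianRing A] {x s : A} (hx : x ≠ 0)
    (hs : ∀ b, x ∣ s * b → x ∣ b) {f : K} (hxf : IsIntegral A (x • f))
    (hsf : IsIntegral A (s • f)) : IsIntegral A f := by
  obtain ⟨d, hd, hd'⟩ := hsf.isAlmostIntegral
  obtain ⟨e, he, he'⟩ := hxf.isAlmostIntegral
  -- Over a Noetherian domain it is enough to find one common denominator for all powers of `f`.
  -- With `d` for `s f` and `e` for `x f`, the product `e d` works, because regularity of `s` modulo
  -- `x` lets `x ^ n` be cancelled.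
  refine (isAlmostIntegral_iff_isIntegral (R := A) (S := K)).1 ⟨e * d, mul_mem he hd, fun n => ?_⟩
  obtain ⟨b, hb⟩ := hd' n
  obtain ⟨c, hc⟩ := he' n
  simp only [Algebra.smul_def, mul_pow] at hb hc
  have hinj := IsFractionRing.injective A K
  have h1 : x ^ n * (e * b) = s ^ n * (d * c) := by
    apply hinj
    simp only [map_mul, map_pow, hb, hc]
    ring
  obtain ⟨t, ht⟩ := dvd_of_pow_dvd_mul hx hs n n (d * c) (Dvd.intro _ h1)
  refine ⟨t, ?_⟩
  have hxn : algebraMap A K x ^ n ≠ 0 := pow_ne_zero _ (by simpa using hx)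
  apply mul_left_cancel₀ hxn
  rw [← map_pow, ← map_mul, ← ht, map_mul, hc, Algebra.smul_def, map_mul, map_pow]
  ring

/-- A maximal ideal which is a conductor into the integral closure is associated to `(x)`. -/
theorem mem_associatedPrimes_of_isIntegral_smul_iff [IsDomain A] [IsNoetherianRing A] {x : A}
    (hx : x ≠ 0) {P : Ideal A} (hPm : P.IsMaximal) (hxP : x ∈ P) {f : K}
    (hf : ∀ a : A, IsIntegral A (a • f) ↔ a ∈ P) :
    P ∈ associatedPrimes A (A ⧸ Ideal.span {x}) := by
  by_contra H
  obtain ⟨s, hs, hreg⟩ := exists_mem_regular_mod_of_notMem_associatedPrimes hPm H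
  have := isIntegral_of_smul_of_smul hx hreg ((hf x).2 hxP) ((hf s).2 hs)
  refine hPm.ne_top ((Ideal.eq_top_iff_one _).2 ((hf 1).1 (by rwa [one_smul])))

end Noetherian

/-! ### The integral ideal transform of a Noetherian local domain: finiteness modulo an element. -/

section IdealTransform

variable (A : Type*) [CommRing A] [IsLocalRing A] (K : Type*) [Field K] [Algebra A K]

open IsLocalRing

/-- The elements of `K` which are integral over the local ring `A` and are multiplied into `A` by
a power of its maximal ideal. -/
def integralTransform : Subalgebra A K where
  carrier := {g | IsIntegral A g ∧ ∃ k : ℕ, ∀ a ∈ maximalIdeal A ^ k, ∃ c, algebraMap A K c = a • g}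
  mul_mem' := by
    rintro g h ⟨hg, k, hk⟩ ⟨hh, l, hl⟩
    refine ⟨hg.mul hh, k + l, fun a ha => ?_⟩
    rw [pow_add] at ha
    refine Submodule.mul_induction_on ha (fun a ha b hb => ?_) (fun a b ha hb => ?_)
    · obtain ⟨c, hc⟩ := hk a ha
      obtain ⟨d, hd⟩ := hl b hb
      exact ⟨c * d, by rw [map_mul, hc, hd, smul_mul_smul_comm]⟩
    · obtain ⟨c, hc⟩ := ha
      obtain ⟨d, hd⟩ := hb
      exact ⟨c + d, by rw [map_add, hc, hd, add_smul]⟩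
  add_mem' := by
    rintro g h ⟨hg, k, hk⟩ ⟨hh, l, hl⟩
    refine ⟨hg.add hh, k + l, fun a ha => ?_⟩
    obtain ⟨c, hc⟩ := hk a (Ideal.pow_le_pow_right (Nat.le_add_right k l) ha)
    obtain ⟨d, hd⟩ := hl a (Ideal.pow_le_pow_right (Nat.le_add_left l k) ha)
    exact ⟨c + d, by rw [map_add, hc, hd, smul_add]⟩
  algebraMap_mem' r := ⟨isIntegral_algebraMap, 0, fun a _ => ⟨a * r, by
    rw [map_mul, Algebra.smul_def]⟩⟩

variable {A K}

/-- The descending chain condition for submodules consisting of elements killed by powers of the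
maximal ideal. -/
theorem antitone_stabilizes_of_torsion [IsNoetherianRing A] {M : Type*} [AddCommGroup M]
    [Module A M] [Module.Finite A M] (N : ℕ → Submodule A M) (hN : Antitone N)
    (h0 : ∀ m ∈ N 0, ∃ k : ℕ, ∀ a ∈ maximalIdeal A ^ k, a • m = 0) :
    ∃ n, ∀ j, n ≤ j → N n = N j := by
  obtain ⟨k, hk⟩ : ∃ k : ℕ, ∀ m ∈ N 0, ∀ a ∈ maximalIdeal A ^ k, a • m = 0 := by
    obtain ⟨S, hS⟩ : (N 0).FG := IsNoetherian.noetherian _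
    have : ∀ s : S, ∃ k : ℕ, ∀ a ∈ maximalIdeal A ^ k, a • (s : M) = 0 := fun s =>
      h0 s (hS ▸ Submodule.subset_span s.2)
    choose k hk using this
    refine ⟨∑ s, k s, fun m hm a ha => ?_⟩
    rw [← hS] at hm
    induction hm using Submodule.span_induction with
    | mem s hs =>
      exact hk ⟨s, hs⟩ a (Ideal.pow_le_pow_right
        (Finset.single_le_sum (f := k) (fun _ _ => Nat.zero_le _) (Finset.mem_univ _)) ha)
    | zero => simp
    | add x y _ _ hx hy => rw [smul_add, hx, hy, add_zero]
    | smul r x _ hx => rw [smul_comm, hx, smul_zero]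
  -- The zero quotient (for instance `k = 0`) is treated apart, since it is not a local ring.
  -- Otherwise the quotient is Artinian and the chain consists of submodules of a finite module over
  -- it.
  rcases subsingleton_or_nontrivial (A ⧸ maximalIdeal A ^ k) with hs | hs
  · have : maximalIdeal A ^ k = ⊤ := Ideal.Quotient.subsingleton_iff.1 hs
    have h00 : N 0 = ⊥ := (Submodule.eq_bot_iff _).2 fun m hm => by
      simpa using hk m hm 1 (this ▸ Submodule.mem_top)
    refine ⟨0, fun j hj => le_antisymm (h00.le.trans bot_le) (hN hj)⟩
  have : IsLocalRing (A ⧸ maximalIdeal A ^ k) :=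
    .of_surjective' (Ideal.Quotient.mk _) Ideal.Quotient.mk_surjective
  have : IsArtinianRing (A ⧸ maximalIdeal A ^ k) := by
    rw [isArtinianRing_iff_isNilpotent_maximalIdeal]
    refine ⟨k, ?_⟩
    rw [← map_maximalIdeal_of_surjective (Ideal.Quotient.mk (maximalIdeal A ^ k))
      Ideal.Quotient.mk_surjective, ← Ideal.map_pow, Ideal.map_quotient_self, Ideal.zero_eq_bot]
  have htor : Module.IsTorsionBySet A (N 0) (maximalIdeal A ^ k : Ideal A) := fun m a =>
    Subtype.ext (hk m m.2 a a.2)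
  let := htor.module
  have : Module.Finite (A ⧸ maximalIdeal A ^ k) (N 0) := .of_restrictScalars_finite A _ _
  have : IsArtinian A (N 0) := isArtinian_of_surjective_algebraMap
    (R := A ⧸ maximalIdeal A ^ k) Ideal.Quotient.mk_surjective
  let f : ℕ →o (Submodule A (N 0))ᵒᵈ :=
    ⟨fun j => OrderDual.toDual ((N j).comap (N 0).subtype), fun i j hij =>
      OrderDual.toDual_le_toDual.2 (Submodule.comap_mono (hN hij))⟩
  obtain ⟨n, hn⟩ := IsArtinian.monotone_stabilizes f
  refine ⟨n, fun j hj => ?_⟩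
  have h : ((N n).comap (N 0).subtype).map (N 0).subtype =
      ((N j).comap (N 0).subtype).map (N 0).subtype :=
    congrArg (fun P => Submodule.map (N 0).subtype (OrderDual.ofDual P)) (hn j hj)
  simpa only [Submodule.map_comap_subtype, inf_eq_right.2 (hN (Nat.zero_le _))] using h

/-- The ideals `I j` of elements of `A` of the form `a ^ j z + a c` decrease. Modulo `a` they are
torsion for the maximal ideal once `j ≥ 1`, so they stabilize. The stable value gives an exponent
`n` that serves all `z` at once, which is what makes the transform finite modulo `a`. -/
theorem exists_pow_smul_eq_of_mem_integralTransform [IsDomain A] [IsNoetherianRing A]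
    [IsFractionRing A K] {a : A} (ha : a ∈ maximalIdeal A) :
    ∃ n, ∀ z ∈ integralTransform A K, ∃ b : A, ∃ z' ∈ integralTransform A K,
      a ^ n • z = algebraMap A K b + a ^ (n + 1) • z' := by
  let I : ℕ → Ideal A := fun j =>
    { carrier := {b | ∃ z ∈ integralTransform A K, ∃ c,
        algebraMap A K b = a ^ j • z + algebraMap A K (a * c)}
      zero_mem' := ⟨0, zero_mem _, 0, by simp⟩
      add_mem' := by
        rintro b b' ⟨z, hz, c, h⟩ ⟨z', hz', c', h'⟩
        exact ⟨z + z', add_mem hz hz', c + c', by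
          rw [map_add, h, h', smul_add, mul_add, map_add]; abel⟩
      smul_mem' := by
        rintro r b ⟨z, hz, c, h⟩
        exact ⟨r • z, Subalgebra.smul_mem _ hz r, r * c, by
          rw [smul_eq_mul, map_mul, h, Algebra.smul_def, Algebra.smul_def, Algebra.smul_def]
          simp only [map_mul]; ring⟩ }
  have hI : ∀ j b, b ∈ I j ↔ ∃ z ∈ integralTransform A K, ∃ c,
        algebraMap A K b = a ^ j • z + algebraMap A K (a * c) := fun _ _ => Iff.rfl
  have hanti : Antitone I := antitone_nat_of_succ_le fun j b hb => by
    obtain ⟨z, hz, c, h⟩ := (hI _ _).1 hb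
    exact (hI _ _).2 ⟨a • z, Subalgebra.smul_mem _ hz a, c, by rw [h, pow_succ, mul_smul]⟩
  have hspan : ∀ j, Ideal.span {a} ≤ I j := fun j => by
    rw [Ideal.span_singleton_le_iff_mem]
    exact (hI _ _).2 ⟨0, zero_mem _, 1, by simp⟩
  -- The shift to `j + 1` is needed: if `e z = d` lies in `A`, then `e (a z + a c)` is divisible by
  -- `a`, while `I 0` is all of `A`.
  obtain ⟨n, hn⟩ := antitone_stabilizes_of_torsion
    (fun j => Submodule.map (Ideal.span {a}).mkQ (I (j + 1)))
    (fun i j hij => Submodule.map_mono (hanti (Nat.add_le_add_right hij 1))) (by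
      rintro _ ⟨b, hb, rfl⟩
      obtain ⟨z, hz, c, h⟩ := (hI _ _).1 hb
      obtain ⟨-, k, hk⟩ := hz
      refine ⟨k, fun e he => ?_⟩
      obtain ⟨d, hd⟩ := hk e he
      rw [← map_smul, Submodule.mkQ_apply, Submodule.Quotient.mk_eq_zero,
        Ideal.mem_span_singleton]
      refine ⟨d + e * c, IsFractionRing.injective A K ?_⟩
      simp only [smul_eq_mul, map_mul, map_add, h, hd, Algebra.smul_def, map_pow]
      ring)
  have hstab : ∀ j, n + 1 ≤ j → I j = I (j + 1) := by
    have h1 : ∀ j, n ≤ j → I (n + 1) = I (j + 1) := fun j hj => by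
      have h := congrArg (Submodule.comap (Ideal.span {a}).mkQ) (hn j hj)
      simpa only [Submodule.comap_map_mkQ, sup_eq_right.2 (hspan _)] using h
    intro j hj
    obtain ⟨i, rfl⟩ : ∃ i, j = i + 1 := ⟨j - 1, by lia⟩
    rw [← h1 i (by lia), ← h1 (i + 1) (by lia)]
  refine ⟨n + 1, fun z hz => ?_⟩
  obtain ⟨N, hN⟩ : ∃ (N : ℕ), ∃ c, algebraMap A K c = a ^ N • z := by
    obtain ⟨-, k, hk⟩ := hz
    exact ⟨k, hk _ (Ideal.pow_mem_pow ha k)⟩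
  by_cases ha0 : a = 0
  · exact ⟨0, 0, zero_mem _, by simp [ha0]⟩
  have haK : algebraMap A K a ≠ 0 := by simpa using ha0
  -- Induction on the exponent clearing the denominator of `z`: stability allows `z` to be replaced
  -- by `z - a z'`, whose denominator is cleared by one power of `a` less.
  induction N generalizing z with
  | zero =>
    obtain ⟨c, hc⟩ := hN
    exact ⟨a ^ (n + 1) * c, 0, zero_mem _, by
      rw [map_mul, hc]; simp [Algebra.smul_def]⟩
  | succ N ih =>
    obtain ⟨c, hc⟩ := hN
    rcases le_or_gt (n + 1) (N + 1) with hle | hlt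
    · have hcI : c ∈ I (N + 1) := (hI _ _).2 ⟨z, hz, 0, by simp [hc]⟩
      rw [hstab _ hle] at hcI
      obtain ⟨z', hz', d, hd⟩ := (hI _ _).1 hcI
      obtain ⟨b, z'', hz'', hb⟩ := ih (z - a • z') (sub_mem hz (Subalgebra.smul_mem _ hz' a))
        ⟨d, by
          apply mul_left_cancel₀ haK
          rw [hc] at hd
          simp only [Algebra.smul_def, map_mul, map_pow] at hd ⊢
          linear_combination -hd⟩
      refine ⟨b, z' + z'', add_mem hz' hz'', ?_⟩
      simp only [Algebra.smul_def, map_pow] at hb ⊢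
      linear_combination hb
    · exact ⟨a ^ (n - N) * c, 0, zero_mem _, by
        have e : a ^ (n + 1) = a ^ (n - N) * a ^ (N + 1) := by rw [← pow_add]; congr 1; lia
        rw [map_mul, hc, e]; simp [Algebra.smul_def, mul_assoc]⟩

end IdealTransform

/-- A discrete valuation ring `V` of `K` which is a localization of the integral closure of `A` in
`K`, with residue field finite over that of `A`. -/
structure IsEssentialDVR (A : Type*) [CommRing A] {K : Type*} [Field K] [Algebra A K]
    (V : ValuationSubring K) : Prop where
  dvr : IsDiscreteValuationRing V
  integral_mem : ∀ g, IsIntegral A g → g ∈ V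
  loc : ∀ g ∈ V, ∃ s, IsIntegral A s ∧ V.valuation s = 1 ∧ IsIntegral A (s * g)
  residue : ∃ T : Set K, T.Finite ∧ (∀ t ∈ T, IsIntegral A t) ∧ ∀ g ∈ V,
    ∃ s : A, V.valuation (algebraMap A K s) = 1 ∧
      ∃ h ∈ Submodule.span A T, V.valuation (s • g - h) < 1

/-! ### The ideal transform is a Noetherian ring. -/

section IdealTransform

variable {A : Type*} [CommRing A] [IsLocalRing A] {K : Type*} [Field K] [Algebra A K]

open IsLocalRing

theorem mem_integralTransform_of_smul_mem [IsNoetherianRing A] {g : K} (hg : IsIntegral A g)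
    (h : ∀ a ∈ maximalIdeal A, a • g ∈ integralTransform A K) : g ∈ integralTransform A K := by
  refine ⟨hg, ?_⟩
  obtain ⟨S, hS⟩ : (maximalIdeal A).FG := IsNoetherian.noetherian _
  have : ∀ s : S, ∃ k : ℕ, ∀ a ∈ maximalIdeal A ^ k, ∃ c, algebraMap A K c = a • (s : A) • g :=
    fun s => (h s (hS ▸ Ideal.subset_span s.2)).2
  choose k hk using this
  refine ⟨(∑ s, k s) + 1, fun a ha => ?_⟩
  rw [pow_succ'] at ha
  refine Submodule.mul_induction_on ha (fun e he a ha => ?_) (fun a b ha hb => ?_)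
  · rw [← hS] at he
    induction he using Submodule.span_induction with
    | mem s hs =>
      obtain ⟨c, hc⟩ := hk ⟨s, hs⟩ a (Ideal.pow_le_pow_right
        (Finset.single_le_sum (f := k) (fun _ _ => Nat.zero_le _) (Finset.mem_univ _)) ha)
      exact ⟨c, by rw [hc, smul_smul, mul_comm]⟩
    | zero => exact ⟨0, by simp⟩
    | add x y _ _ hx hy =>
      obtain ⟨c, hc⟩ := hx
      obtain ⟨d, hd⟩ := hy
      exact ⟨c + d, by rw [map_add, hc, hd, add_mul, add_smul]⟩
    | smul r x _ hx =>
      obtain ⟨c, hc⟩ := hx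
      exact ⟨r * c, by rw [map_mul, hc, smul_eq_mul, mul_assoc, mul_smul r, Algebra.smul_def r]⟩
  · obtain ⟨c, hc⟩ := ha
    obtain ⟨d, hd⟩ := hb
    exact ⟨c + d, by rw [map_add, hc, hd, add_smul]⟩

/-- Take for `W` the elements that `a ^ n` multiplies into `A`, with `n` the uniform exponent.
Multiplication by `a ^ n` embeds `W` into the Noetherian module `A`. -/
theorem exists_fg_integralTransform [IsDomain A] [IsNoetherianRing A] [IsFractionRing A K]
    {a : A} (ha : a ∈ maximalIdeal A) (ha0 : a ≠ 0) :
    ∃ W : Submodule A (integralTransform A K), W.FG ∧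
      ∀ z, ∃ w ∈ W, ∃ z', z = w + algebraMap A (integralTransform A K) a * z' := by
  obtain ⟨n, hn⟩ := exists_pow_smul_eq_of_mem_integralTransform (K := K) ha
  let μ : integralTransform A K →ₗ[A] K := a ^ n • (integralTransform A K).toSubmodule.subtype
  have hμ : ∀ z, μ z = a ^ n • (z : K) := fun z => rfl
  have haK : algebraMap A K a ≠ 0 := by simpa using ha0
  have hinj : Function.Injective μ := fun z w h => by
    rw [hμ, hμ, Algebra.smul_def, Algebra.smul_def, map_pow] at h
    exact Subtype.ext (mul_left_cancel₀ (pow_ne_zero n haK) h)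
  refine ⟨(LinearMap.range (Algebra.linearMap A K)).comap μ, ?_, fun z => ?_⟩
  · refine Submodule.fg_of_fg_map_injective μ hinj ?_
    have : IsNoetherian A (LinearMap.range (Algebra.linearMap A K)) := inferInstance
    exact isNoetherian_submodule.1 this _ (Submodule.map_comap_le _ _)
  · obtain ⟨b, z', hz', h⟩ := hn z z.2
    refine ⟨z - algebraMap A (integralTransform A K) a * ⟨z', hz'⟩, ⟨b, ?_⟩, ⟨z', hz'⟩, by ring⟩
    rw [hμ]
    simp only [Algebra.linearMap_apply, Algebra.smul_def, map_pow, AddSubgroupClass.coe_sub,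
      MulMemClass.coe_mul, Subalgebra.coe_algebraMap] at h ⊢
    linear_combination -h

theorem finite_integralTransform_quotient [IsDomain A] [IsNoetherianRing A] [IsFractionRing A K]
    {a : A} (ha : a ∈ maximalIdeal A) (ha0 : a ≠ 0) :
    Module.Finite A (integralTransform A K ⧸
      Ideal.span {algebraMap A (integralTransform A K) a}) := by
  obtain ⟨W, hW, h⟩ := exists_fg_integralTransform (K := K) ha ha0
  let f : integralTransform A K →ₗ[A] (integralTransform A K ⧸
      Ideal.span {algebraMap A (integralTransform A K) a}) :=
    (Ideal.Quotient.mkₐ A _).toLinearMap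
  refine ⟨?_⟩
  have : (⊤ : Submodule A (integralTransform A K ⧸
      Ideal.span {algebraMap A (integralTransform A K) a})) = W.map f := by
    refine eq_comm.1 (eq_top_iff.2 fun y _ => ?_)
    obtain ⟨z, rfl⟩ := Ideal.Quotient.mk_surjective y
    obtain ⟨w, hw, z', rfl⟩ := h z
    refine ⟨w, hw, ?_⟩
    refine Ideal.Quotient.eq.2 ?_
    rw [sub_add_cancel_left, neg_mem_iff, Ideal.mem_span_singleton]
    exact Dvd.intro _ rfl
  rw [this]
  exact hW.map f

/-- A nonzero ideal contains a nonzero `x c` with `c ∈ A`, obtained by clearing the denominator of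
one of its elements. The quotient by `x c` is finite over `A`. The factor `x` places the element in
the maximal ideal, as the finiteness result requires. -/
theorem isNoetherianRing_integralTransform [IsDomain A] [IsNoetherianRing A] [IsFractionRing A K]
    {x : A} (hx : x ∈ maximalIdeal A) (hx0 : x ≠ 0) : IsNoetherianRing (integralTransform A K) := by
  refine IsNoetherianRing.of_prime_ne_bot fun I _ hI => ?_
  obtain ⟨z, hz, hz0⟩ := Submodule.exists_mem_ne_zero_of_ne_bot hI
  obtain ⟨⟨b, hb⟩, c, hc⟩ := IsLocalization.exists_integer_multiple (nonZeroDivisors A) (z : K)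
  have hb0 : b ≠ 0 := nonZeroDivisors.ne_zero hb
  have hcz : algebraMap A (integralTransform A K) c = algebraMap A _ b * z :=
    Subtype.ext (by simpa [Algebra.smul_def] using hc)
  have hc0 : c ≠ 0 := by
    rintro rfl
    rw [map_zero, eq_comm, mul_eq_zero] at hcz
    refine hcz.elim (fun h => hb0 ?_) hz0
    apply IsFractionRing.injective A K
    simpa using congrArg Subtype.val h
  have hxc : algebraMap A (integralTransform A K) (x * c) ∈ I := by
    rw [map_mul, hcz]
    exact I.mul_mem_left _ (I.mul_mem_left _ hz)
  have := finite_integralTransform_quotient (K := K) (Ideal.mul_mem_right c _ hx)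
    (mul_ne_zero hx0 hc0)
  have : IsNoetherian (integralTransform A K) (integralTransform A K ⧸
      Ideal.span {algebraMap A (integralTransform A K) (x * c)}) :=
    isNoetherian_of_tower A inferInstance
  refine Submodule.fg_of_fg_map_of_fg_inf_ker (Ideal.span
    {algebraMap A (integralTransform A K) (x * c)}).mkQ (IsNoetherian.noetherian _) ?_
  rw [Submodule.ker_mkQ, inf_eq_right.2 ((Ideal.span_singleton_le_iff_mem _).2 hxc)]
  exact Submodule.fg_span_singleton _

end IdealTransform

theorem finite_setOf_isMaximal_mem_associatedPrimes {R : Type*} [CommRing R] [IsNoetherianRing R]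
    (x : R) : {n : Ideal R | n.IsMaximal ∧
      n ∈ associatedPrimes R (R ⧸ Ideal.span {x})}.Finite :=
  (associatedPrimes.finite R (R ⧸ Ideal.span {x})).subset fun _ hn => hn.2

/-! ### Discrete valuation rings as localizations. -/

section AtPrime

variable {R : Type*} [CommRing R] [IsDomain R] [IsNoetherianRing R] {K : Type*} [Field K]
  [Algebra R K] [IsFractionRing R K]

/-- A Noetherian domain is a discrete valuation ring at a prime `n = (x : y)` such that `y / x`
does not multiply `n` into itself. -/
theorem exists_valuationSubring_of_mul_eq {n : Ideal R} (hn : n.IsPrime) (hn0 : n ≠ ⊥) {x y t u : R}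
    (hy : ∀ r, x ∣ r * y ↔ r ∈ n) (hx : x ≠ 0) (ht : t ∈ n) (hu : u ∉ n) (h : t * y = x * u) :
    ∃ V : ValuationSubring K, IsDiscreteValuationRing V ∧
      (∀ g, g ∈ V ↔ ∃ r s : R, s ∉ n ∧ g = algebraMap R K r / algebraMap R K s) ∧
      (∀ r : R, V.valuation (algebraMap R K r) < 1 ↔ r ∈ n) := by
  have hS : n.primeCompl ≤ nonZeroDivisors R := n.primeCompl_le_nonZeroDivisors
  let L := Localization.subalgebra.ofField K n.primeCompl hS
  have hmem : ∀ g, g ∈ L ↔ ∃ r s : R, s ∉ n ∧ g = algebraMap R K r / algebraMap R K s := by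
    intro g
    simp only [div_eq_mul_inv]
    exact ⟨fun ⟨a, s, hs, e⟩ => ⟨a, s, hs, e⟩, fun ⟨a, s, hs, e⟩ => ⟨a, s, hs, e⟩⟩
  have : IsLocalization.AtPrime L n := Localization.subalgebra.isLocalization_ofField K _ hS
  have : IsLocalRing L := IsLocalization.AtPrime.isLocalRing L n
  have : IsNoetherianRing L := IsLocalization.isNoetherianRing n.primeCompl L inferInstance
  have hmax : ∀ r, algebraMap R L r ∈ IsLocalRing.maximalIdeal L ↔ r ∈ n := fun r =>
    IsLocalization.AtPrime.to_map_mem_maximal_iff L n r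
  have hinj : Function.Injective (algebraMap R L) := IsLocalization.injective L hS
  -- The generator is `t`: for `r ∈ n` with `r y = x c`, the relation `t y = x u` gives `r u = t c`,
  -- and `u` is a unit in the localization.
  have hprin : (IsLocalRing.maximalIdeal L).IsPrincipal := by
    refine ⟨⟨algebraMap R L t, le_antisymm (fun z hz => ?_) ?_⟩⟩
    · obtain ⟨⟨r, s⟩, hrs⟩ := IsLocalization.surj n.primeCompl z
      have hr : r ∈ n := (hmax r).1 (hrs ▸ Ideal.mul_mem_right _ _ hz)
      obtain ⟨c, hc⟩ := (hy r).2 hr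
      have h1 : r * u = t * c := by
        apply mul_left_cancel₀ hx
        linear_combination (-r) * h + t * hc
      have hus : IsUnit (algebraMap R L (s * u)) :=
        IsLocalization.map_units L (s * ⟨u, hu⟩ : n.primeCompl)
      obtain ⟨w, hw⟩ := hus.exists_right_inv
      refine Submodule.mem_span_singleton.2 ⟨algebraMap R L c * w, ?_⟩
      have h2 := congrArg (algebraMap R L) h1
      simp only [map_mul] at h2 hw hrs
      rw [smul_eq_mul]
      linear_combination (-w) * h2 - w * (algebraMap R L u) * hrs + z * hw
    · rw [Submodule.span_singleton_le_iff_mem]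
      exact (hmax t).2 ht
  have hfield : ¬ IsField L := by
    rw [IsLocalRing.isField_iff_maximalIdeal_eq]
    intro h0
    refine hn0 ((Submodule.eq_bot_iff _).2 fun r hr => hinj ?_)
    rw [map_zero]
    exact (Submodule.eq_bot_iff _).1 h0 _ ((hmax r).2 hr)
  have hdvr : IsDiscreteValuationRing L :=
    ((IsDiscreteValuationRing.TFAE L hfield).out 0 4).2 hprin
  let V : ValuationSubring K := ValuationSubring.ofSubring L.toSubring fun g => by
    rcases (ValuationRing.isInteger_or_isInteger L g) with ⟨z, hz⟩ | ⟨z, hz⟩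
    · exact Or.inl (hz ▸ z.2)
    · exact Or.inr (hz ▸ z.2)
  have hVdvr : IsDiscreteValuationRing V := hdvr
  have hV : ∀ g, g ∈ V ↔ g ∈ L := fun g => Iff.rfl
  refine ⟨V, hVdvr, fun g => (hV g).trans (hmem g), fun r => ?_⟩
  have hr : algebraMap R K r ∈ V := (algebraMap R L r).2
  have h1 := V.valuation_lt_one_iff ⟨algebraMap R K r, hr⟩
  rw [← h1, ← hmax]
  exact Iff.rfl

end AtPrime

/-! ### Essential discrete valuation rings of a Noetherian local domain. -/

section IdealTransform

variable {A : Type*} [CommRing A] [IsLocalRing A] {K : Type*} [Field K] [Algebra A K]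

open IsLocalRing

theorem integralTransform_isIntegral : Algebra.IsIntegral A (integralTransform A K) :=
  ⟨fun z => (isIntegral_algebraMap_iff (Subtype.val_injective :
    Function.Injective (algebraMap (integralTransform A K) K))).1 z.2.1⟩

theorem isIntegral_integralTransform_iff {g : K} :
    IsIntegral (integralTransform A K) g ↔ IsIntegral A g := by
  have := integralTransform_isIntegral (A := A) (K := K)
  exact ⟨fun h => isIntegral_trans g h, fun h => h.tower_top⟩

variable [IsDomain A] [IsNoetherianRing A] [IsFractionRing A K]

/-- Maximal ideals of the ideal transform associated to `(x)` give discrete valuation rings. -/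
theorem exists_isEssentialDVR_of_mem_associatedPrimes {x : A} (hx : x ∈ maximalIdeal A)
    (hx0 : x ≠ 0) {n : Ideal (integralTransform A K)} (hm : n.IsMaximal)
    (hn : n ∈ associatedPrimes (integralTransform A K) (integralTransform A K ⧸
      Ideal.span {algebraMap A (integralTransform A K) x})) :
    ∃ V : ValuationSubring K, IsEssentialDVR A V ∧
      (∀ a ∈ maximalIdeal A, V.valuation (algebraMap A K a) < 1) ∧
      (∀ g, g ∈ V ↔ ∃ r s : integralTransform A K, s ∉ n ∧ g = r / s) := by
  have hnoeth := isNoetherianRing_integralTransform (K := K) hx hx0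
  have hint := integralTransform_isIntegral (A := A) (K := K)
  have hmax : n.comap (algebraMap A (integralTransform A K)) = maximalIdeal A :=
    IsLocalRing.eq_maximalIdeal (Ideal.isMaximal_comap_of_isIntegral_of_isMaximal n)
  have hmn : ∀ a ∈ maximalIdeal A, algebraMap A (integralTransform A K) a ∈ n := fun a ha => by
    rwa [← hmax] at ha
  obtain ⟨hnp, y, hy⟩ := mem_associatedPrimes_span_singleton_iff.1 hn
  have hinjA : Function.Injective (algebraMap A (integralTransform A K)) := fun a b h =>
    IsFractionRing.injective A K (congrArg Subtype.val h)
  have hx1 : algebraMap A (integralTransform A K) x ≠ 0 := fun h =>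
    hx0 (hinjA (by rw [h, map_zero]))
  have hn0 : n ≠ ⊥ := fun h => hx1 (by
    have := hmn x hx
    rwa [h] at this)
  have hxK : algebraMap A K x ≠ 0 := by simpa using hx0
  -- If there were none, `y / x` would map `n` into itself and be integral by the determinant trick.
  -- It would also multiply the maximal ideal of `A` into the transform, hence lie in the transform,
  -- so that `x ∣ y` and `1 ∈ n`.
  obtain ⟨t, ht, u, hu, htu⟩ : ∃ t ∈ n, ∃ u ∉ n,
      t * y = algebraMap A (integralTransform A K) x * u := by
    by_contra! H
    have hg : ∀ t ∈ n, ∃ c ∈ n, ((y : K) / algebraMap A K x) * t = c := fun t ht => by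
      obtain ⟨c, hc⟩ := (hy t).2 ht
      refine ⟨c, by_contra fun hcn => H t ht c hcn hc, ?_⟩
      have := congrArg Subtype.val hc
      simp only [MulMemClass.coe_mul, Subalgebra.coe_algebraMap] at this
      rw [div_mul_eq_mul_div, div_eq_iff hxK, mul_comm, this, mul_comm]
    have hgint : IsIntegral (integralTransform A K) ((y : K) / algebraMap A K x) := by
      refine isIntegral_of_smul_mem_submodule
        (Submodule.map (Algebra.linearMap (integralTransform A K) K) n) ?_ ?_ _ ?_
      · exact (Submodule.ne_bot_iff _).2 ⟨_, ⟨_, hmn x hx, rfl⟩, hxK⟩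
      · exact Submodule.FG.map _ (IsNoetherian.noetherian n)
      · rintro _ ⟨t, ht, rfl⟩
        obtain ⟨c, hc, h⟩ := hg t ht
        exact ⟨c, hc, h.symm⟩
    have hmem := mem_integralTransform_of_smul_mem (isIntegral_integralTransform_iff.1 hgint)
      fun a ha => by
        obtain ⟨c, hc, h⟩ := hg _ (hmn a ha)
        rw [Algebra.smul_def, mul_comm]
        exact h ▸ c.2
    refine hm.ne_top ((Ideal.eq_top_iff_one n).2 ((hy 1).1 ⟨⟨_, hmem⟩, Subtype.ext ?_⟩))
    simp [mul_div_cancel₀ _ hxK]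
  obtain ⟨V, hV1, hV2', hV3⟩ := exists_valuationSubring_of_mul_eq (K := K) hnp hn0 hy hx1 ht hu htu
  have hV2 : ∀ g, g ∈ V ↔ ∃ r s : integralTransform A K, s ∉ n ∧ g = r / s := hV2'
  have hVA : ∀ a ∈ maximalIdeal A, V.valuation (algebraMap A K a) < 1 := fun a ha =>
    (hV3 _).2 (hmn a ha)
  have hVR : ∀ r : integralTransform A K, (r : K) ∈ V := fun r =>
    (hV2 _).2 ⟨r, 1, fun h => hm.ne_top ((Ideal.eq_top_iff_one n).2 h), by simp⟩
  have hV1' : ∀ r : integralTransform A K, r ∉ n → V.valuation (r : K) = 1 := fun r hr =>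
    le_antisymm ((V.valuation_le_one_iff _).2 (hVR r)) (not_lt.1 fun h => hr ((hV3 r).1 h))
  refine ⟨V, ⟨hV1, fun g hg => ?_, fun g hg => ?_, ?_⟩, hVA, hV2⟩
  · have : IsIntegral V g := by
      let φ : A →+* V := (algebraMap A K).codRestrict V.toSubring fun a =>
        hVR (algebraMap A _ a)
      obtain ⟨p, hp, hpe⟩ := hg
      refine ⟨p.map φ, hp.map φ, ?_⟩
      rw [Polynomial.eval₂_map]
      exact hpe
    obtain ⟨z, hz⟩ := IsIntegrallyClosed.isIntegral_iff.1 this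
    exact hz ▸ z.2
  · obtain ⟨r, s, hs, rfl⟩ := (hV2 g).1 hg
    refine ⟨s, s.2.1, hV1' s hs, ?_⟩
    have hs0 : (s : K) ≠ 0 := fun h => hs (by
      have : s = 0 := Subtype.ext h
      exact this ▸ n.zero_mem)
    rw [show (s : K) * (r / s) = r from mul_div_cancel₀ _ hs0]
    exact r.2.1
  · obtain ⟨W, hW, hWx⟩ := exists_fg_integralTransform (K := K) hx hx0
    obtain ⟨S, rfl⟩ := hW
    refine ⟨Subtype.val '' (S : Set (integralTransform A K)), S.finite_toSet.image _, ?_, ?_⟩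
    · rintro _ ⟨t, -, rfl⟩
      exact t.2.1
    intro g hg
    refine ⟨1, by simp, ?_⟩
    obtain ⟨r, s, hs, rfl⟩ := (hV2 g).1 hg
    -- The ideal `n` being maximal, the class of `r / s` in the residue field is that of `r s'` with
    -- `s'` an inverse of `s` modulo `n`. The generators of the transform modulo `x` therefore span
    -- the residue field over `A`.
    obtain ⟨s', hs'⟩ := hm.exists_inv hs
    obtain ⟨e, he, hse⟩ := hs'
    obtain ⟨w, hw, z', hz'⟩ := hWx (r * s')
    have hs0 : (s : K) ≠ 0 := fun h => hs (by
      have : s = 0 := Subtype.ext h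
      exact this ▸ n.zero_mem)
    refine ⟨w, ?_, ?_⟩
    · have : (w : K) ∈ (Submodule.span A (S : Set (integralTransform A K))).map
          (integralTransform A K).toSubmodule.subtype := ⟨w, hw, rfl⟩
      rw [Submodule.map_span] at this
      exact this
    · have h1 := congrArg Subtype.val hz'
      have h2 := congrArg Subtype.val hse
      simp only [MulMemClass.coe_mul, AddMemClass.coe_add, OneMemClass.coe_one,
        Subalgebra.coe_algebraMap] at h1 h2
      have e1 : (1 : A) • ((r : K) / s) - w =
          (r : K) * e * (s : K)⁻¹ + algebraMap A K x * z' := by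
        rw [one_smul, div_eq_mul_inv]
        have h3 : (s : K) * (s : K)⁻¹ = 1 := mul_inv_cancel₀ hs0
        linear_combination (-(r : K) * (s : K)⁻¹) * h2 + h1 + (r : K) * s' * h3
      rw [e1]
      refine V.valuation.map_add_lt ?_ ?_
      · rw [map_mul, map_mul, map_inv₀, hV1' s hs, inv_one, mul_one]
        exact mul_lt_one_of_nonneg_of_lt_one_right ((V.valuation_le_one_iff _).2 (hVR r))
          zero_le ((hV3 e).2 he)
      · rw [map_mul]
        exact mul_lt_one_of_nonneg_of_lt_one_left zero_le (hVA x hx) ((V.valuation_le_one_iff _).2 (hVR z'))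

/-- Over a Noetherian local domain, finitely many discrete valuation rings detect integrality of
the elements whose conductor is the maximal ideal. -/
theorem exists_finite_isEssentialDVR_of_isLocalRing {x : A} (hx : x ∈ maximalIdeal A)
    (hx0 : x ≠ 0) : ∃ 𝒱 : Set (ValuationSubring K), 𝒱.Finite ∧
      (∀ V ∈ 𝒱, IsEssentialDVR A V ∧ ∀ a ∈ maximalIdeal A, V.valuation (algebraMap A K a) < 1) ∧
      ∀ f : K, (∀ a : A, IsIntegral A (a • f) ↔ a ∈ maximalIdeal A) → ∃ V ∈ 𝒱, f ∉ V := by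
  have hnoeth := isNoetherianRing_integralTransform (K := K) hx hx0
  have hint := integralTransform_isIntegral (A := A) (K := K)
  let S : Set (Ideal (integralTransform A K)) := {n | n.IsMaximal ∧
    n ∈ associatedPrimes (integralTransform A K) (integralTransform A K ⧸
      Ideal.span {algebraMap A (integralTransform A K) x})}
  have hS : S.Finite := finite_setOf_isMaximal_mem_associatedPrimes _
  choose V hV1 hV2 hV3 using fun n : S =>
    exists_isEssentialDVR_of_mem_associatedPrimes (K := K) hx hx0 n.2.1 n.2.2
  have := hS.to_subtype
  refine ⟨Set.range V, Set.finite_range V, ?_, fun f hf => ?_⟩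
  · rintro _ ⟨n, rfl⟩
    exact ⟨hV1 n, hV2 n⟩
  let J : Ideal (integralTransform A K) :=
    { carrier := {r | IsIntegral A (r • f)}
      zero_mem' := by simp [isIntegral_zero]
      add_mem' := fun {a b} ha hb => by
        simp only [Set.mem_ofPred_eq, add_smul] at *
        exact ha.add hb
      smul_mem' := fun c r hr => by
        simp only [Set.mem_ofPred_eq, smul_eq_mul, mul_smul] at *
        rw [Subalgebra.smul_def c]
        exact c.2.1.mul hr }
  have hJ : ∀ r, r ∈ J ↔ IsIntegral A (r • f) := fun r => Iff.rfl
  have hJtop : J ≠ ⊤ := fun h => by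
    have h1 : (1 : integralTransform A K) ∈ J := h ▸ Submodule.mem_top
    rw [hJ, one_smul, ← one_smul A f, hf] at h1
    exact (Ideal.ne_top_iff_one _).1 (maximalIdeal.isMaximal A).ne_top h1
  -- The conductor of `f` in the transform is enlarged to a prime `P`. It lies over the maximal
  -- ideal of `A`, so it is maximal, and being the conductor of `b f` it is associated to `x`. Its
  -- valuation ring excludes `f`.
  obtain ⟨b, P, hP, hbP⟩ := exists_mul_mem_iff_mem_prime hJtop
  have hcomap : P.comap (algebraMap A (integralTransform A K)) = maximalIdeal A := by
    refine ((maximalIdeal.isMaximal A).eq_of_le (Ideal.IsPrime.ne_top inferInstance)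
      fun a ha => ?_).symm
    rw [Ideal.mem_comap, ← hbP, mul_comm]
    refine J.mul_mem_left _ ?_
    rw [hJ, algebraMap_smul]
    exact (hf a).2 ha
  have hPmax : P.IsMaximal := Ideal.isMaximal_of_isIntegral_of_isMaximal_comap P
    (hcomap ▸ maximalIdeal.isMaximal A)
  have hxP : algebraMap A (integralTransform A K) x ∈ P := by
    rw [← Ideal.mem_comap, hcomap]; exact hx
  have hx1 : algebraMap A (integralTransform A K) x ≠ 0 := fun h =>
    hx0 (IsFractionRing.injective A K (by simpa using congrArg Subtype.val h))
  have hPass := mem_associatedPrimes_of_isIntegral_smul_iff (K := K) hx1 hPmax hxP (f := b • f)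
    fun a => by rw [isIntegral_integralTransform_iff, ← hbP, hJ, mul_smul]
  refine ⟨V ⟨P, hPmax, hPass⟩, ⟨_, rfl⟩, fun hfV => ?_⟩
  obtain ⟨r, s, hs, hrs⟩ := (hV3 ⟨P, hPmax, hPass⟩ f).1 hfV
  refine hs ((hbP s).1 ?_)
  rw [mul_comm]
  refine J.mul_mem_left b ?_
  have hs0 : (s : K) ≠ 0 := fun h => hs (by
    have : s = 0 := Subtype.ext h
    exact this ▸ P.zero_mem)
  rw [hJ, hrs, Subalgebra.smul_def, smul_eq_mul, mul_div_cancel₀ _ hs0]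
  exact r.2.1

end IdealTransform

/-! ### Finitely many valuation rings detecting integrality over a Noetherian domain. -/

section NoetherianDomain

variable {B : Type*} [CommRing B] {K : Type*} [Field K] [Algebra B K]

/-- A numerator `y0` of the annihilated class works after multiplication by a common denominator for
the finitely many generators of `q`. -/
theorem mem_associatedPrimes_of_isLocalization [IsDomain B] [IsNoetherianRing B] {A : Type*} [CommRing A] [Algebra B A]
    {q : Ideal B} [hq : q.IsPrime] [IsLocalization.AtPrime A q] [IsLocalRing A] {x : B}
    (h : IsLocalRing.maximalIdeal A ∈
      associatedPrimes A (A ⧸ Ideal.span {algebraMap B A x})) [IsNoetherianRing A] :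
    q ∈ associatedPrimes B (B ⧸ Ideal.span {x}) := by
  rw [mem_associatedPrimes_span_singleton_iff] at h ⊢
  obtain ⟨-, y, hy⟩ := h
  obtain ⟨⟨y0, s0⟩, hs0⟩ := IsLocalization.surj q.primeCompl y
  have hunit : ∀ s : q.primeCompl, IsUnit (algebraMap B A s) := IsLocalization.map_units A
  have hmax : ∀ b, algebraMap B A b ∈ IsLocalRing.maximalIdeal A ↔ b ∈ q := fun r =>
    IsLocalization.AtPrime.to_map_mem_maximal_iff A q r
  have hinj : Function.Injective (algebraMap B A) :=
    IsLocalization.injective A q.primeCompl_le_nonZeroDivisors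
  have hloc : ∀ b ∈ q, ∃ s : q.primeCompl, x ∣ s * (b * y0) := fun b hb => by
    obtain ⟨c, hc⟩ := (hy _).2 ((hmax b).2 hb)
    obtain ⟨⟨c0, s⟩, hs⟩ := IsLocalization.surj q.primeCompl c
    refine ⟨s, c0 * s0, hinj ?_⟩
    simp only [map_mul] at hs hs0 ⊢
    linear_combination (-algebraMap B A s * algebraMap B A b) * hs0 +
      algebraMap B A s * algebraMap B A s0 * hc + algebraMap B A x * algebraMap B A s0 * hs
  obtain ⟨S, hS⟩ : q.FG := IsNoetherian.noetherian _
  choose s hs using fun b : S => hloc b (hS ▸ Ideal.subset_span b.2)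
  refine ⟨hq, (∏ b, s b : q.primeCompl) * y0, fun b => ⟨fun hb => ?_, fun hb => ?_⟩⟩
  · have h1 : algebraMap B A (b * (∏ b, s b : q.primeCompl) * s0) * y =
        algebraMap B A (b * ((∏ b, s b : q.primeCompl) * y0)) := by
      simp only [map_mul] at hs0 ⊢
      linear_combination
        (algebraMap B A b * algebraMap B A ((∏ b, s b : q.primeCompl) : B)) * hs0
    have h2 := (hmax _).1 ((hy _).1 (h1 ▸ map_dvd (algebraMap B A) hb))
    exact (hq.mem_or_mem ((hq.mem_or_mem h2).resolve_right s0.2)).resolve_right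
      (∏ b, s b : q.primeCompl).2
  · rw [← hS] at hb
    induction hb using Submodule.span_induction with
    | mem c hc =>
      have h1 : s ⟨c, hc⟩ ∣ ∏ b, s b := Finset.dvd_prod_of_mem s (Finset.mem_univ _)
      obtain ⟨d, hd⟩ := h1
      rw [hd]
      refine (hs ⟨c, hc⟩).trans ⟨d, ?_⟩
      push_cast
      ring
    | zero => simp
    | add a b _ _ ha hb => rw [add_mul]; exact dvd_add ha hb
    | smul r a _ ha => rw [smul_eq_mul, mul_assoc]; exact ha.mul_left r

/-- Being an essential discrete valuation ring descends from a localization. -/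
theorem IsEssentialDVR.of_isLocalization [IsDomain B] {A : Type*} [CommRing A] [Algebra B A] [Algebra A K]
    [IsScalarTower B A K] {q : Ideal B} [q.IsPrime] [IsLocalization.AtPrime A q]
    {V : ValuationSubring K} (hV : IsEssentialDVR A V)
    (hq : ∀ s, s ∉ q → V.valuation (algebraMap B K s) = 1) : IsEssentialDVR B V := by
  have hclear : ∀ g : K, IsIntegral A g → ∃ s : B, s ∉ q ∧ IsIntegral B (s • g) := fun g hg => by
    obtain ⟨s, hs⟩ := IsIntegral.exists_multiple_integral_of_isLocalization q.primeCompl g hg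
    exact ⟨s, s.2, hs⟩
  refine ⟨hV.dvr, fun g hg => hV.integral_mem g (hg.tower_top (A := A)), fun g hg => ?_, ?_⟩
  · obtain ⟨s, h1, h2, h3⟩ := hV.loc g hg
    obtain ⟨a, ha, ha'⟩ := hclear s h1
    obtain ⟨b, hb, hb'⟩ := hclear _ h3
    refine ⟨b • a • s, ha'.smul b, ?_, ?_⟩
    · rw [Algebra.smul_def, Algebra.smul_def, map_mul, map_mul, hq a ha, hq b hb, h2]; simp
    · rw [smul_comm b a, smul_mul_assoc, smul_mul_assoc]
      exact hb'.smul a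
  · obtain ⟨T, hT, hTi, hg⟩ := hV.residue
    choose! σ hσ hσ' using fun t ht => hclear t (hTi t ht)
    refine ⟨(fun t => σ t • t) '' T, hT.image _, ?_, fun g hgV => ?_⟩
    · rintro _ ⟨t, ht, rfl⟩
      exact hσ' t ht
    have hspan : ∀ h ∈ Submodule.span A T, ∃ s, s ∉ q ∧
        s • h ∈ Submodule.span B ((fun t => σ t • t) '' T) := fun h hh => by
      induction hh using Submodule.span_induction with
      | mem t ht => exact ⟨σ t, hσ t ht, Submodule.subset_span ⟨t, ht, rfl⟩⟩
      | zero => exact ⟨1, fun h => (Ideal.ne_top_iff_one q).1 Ideal.IsPrime.ne_top' h, by simp⟩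
      | add a b _ _ ha hb =>
        obtain ⟨s, hs, hs'⟩ := ha
        obtain ⟨t, ht, ht'⟩ := hb
        refine ⟨s * t, fun h => (Ideal.IsPrime.mem_or_mem ‹_› h).elim hs ht, ?_⟩
        rw [smul_add]
        refine Submodule.add_mem _ ?_ ?_
        · rw [mul_comm, mul_smul]; exact Submodule.smul_mem _ _ hs'
        · rw [mul_smul]; exact Submodule.smul_mem _ _ ht'
      | smul r a _ ha =>
        obtain ⟨s, hs, hs'⟩ := ha
        obtain ⟨⟨c, t⟩, hct⟩ := IsLocalization.surj q.primeCompl r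
        refine ⟨t * s, fun h => (Ideal.IsPrime.mem_or_mem ‹_› h).elim t.2 hs, ?_⟩
        have : (t * s : B) • r • a = c • s • a := by
          have h1 : algebraMap A K r * algebraMap B K t = algebraMap B K c := by
            rw [IsScalarTower.algebraMap_apply B A K, IsScalarTower.algebraMap_apply B A K,
              ← map_mul, hct]
          simp only [Algebra.smul_def, map_mul]
          linear_combination (algebraMap B K s * a) * h1
        rw [this]
        exact Submodule.smul_mem _ _ hs'
    obtain ⟨s, hs, h, hh, hlt⟩ := hg g hgV
    obtain ⟨t, ht, ht'⟩ := hspan h hh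
    obtain ⟨⟨c, u⟩, hcu⟩ := IsLocalization.surj q.primeCompl s
    have h1 : algebraMap A K s * algebraMap B K u = algebraMap B K c := by
      rw [IsScalarTower.algebraMap_apply B A K, IsScalarTower.algebraMap_apply B A K,
        ← map_mul, hcu]
    have hc : V.valuation (algebraMap B K c) = 1 := by
      rw [← h1, map_mul, hs, hq _ u.2, one_mul]
    refine ⟨t * c, by rw [map_mul, map_mul, hc, hq t ht, one_mul], (u : B) • t • h,
      Submodule.smul_mem _ _ ht', ?_⟩
    have h2 : (t * c) • g - (u : B) • t • h =
        algebraMap B K t * algebraMap B K u * (s • g - h) := by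
      simp only [Algebra.smul_def, map_mul]
      linear_combination (-algebraMap B K t * g) * h1
    rw [h2, map_mul, map_mul, hq t ht, hq _ u.2, one_mul, one_mul]
    exact hlt

/-- The conductor-type ideal `{b | b f is integral}`. -/
def integralConductor (B : Type*) [CommRing B] {K : Type*} [Field K] [Algebra B K] (f : K) :
    Ideal B where
  carrier := {b | IsIntegral B (b • f)}
  zero_mem' := by simp [isIntegral_zero]
  add_mem' {a b} ha hb := by
    simp only [Set.mem_ofPred_eq, add_smul] at *
    exact ha.add hb
  smul_mem' c r hr := by
    simp only [Set.mem_ofPred_eq, smul_eq_mul, mul_smul] at *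
    exact hr.smul c

theorem mem_integralConductor {f : K} {b : B} :
    b ∈ integralConductor B f ↔ IsIntegral B (b • f) := Iff.rfl

theorem integralConductor_ne_top {f : K} (hf : ¬ IsIntegral B f) : integralConductor B f ≠ ⊤ := by
  rw [Ne, Ideal.eq_top_iff_one, mem_integralConductor, one_smul]
  exact hf

/-- The integral closure of a Noetherian domain is cut out, among fractions with denominator `x`,
by finitely many essential discrete valuation rings. -/
theorem exists_finite_isEssentialDVR [IsDomain B] [IsNoetherianRing B] [IsFractionRing B K] {x : B} (hx0 : x ≠ 0) :
    ∃ 𝒱 : Set (ValuationSubring K), 𝒱.Finite ∧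
      (∀ V ∈ 𝒱, IsEssentialDVR B V ∧ V.valuation (algebraMap B K x) < 1) ∧
      ∀ f : K, IsIntegral B (x • f) → (∀ V ∈ 𝒱, f ∈ V) → IsIntegral B f := by
  let S := associatedPrimes B (B ⧸ Ideal.span {x})
  have hS : S.Finite := associatedPrimes.finite _ _
  have hxS : ∀ q ∈ S, x ∈ q := fun q hq => by
    obtain ⟨-, y, hy⟩ := mem_associatedPrimes_span_singleton_iff.1 hq
    exact (hy x).1 (Dvd.intro _ rfl)
  let A : (q : Ideal B) → [q.IsPrime] → Subalgebra B K := fun q _ =>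
    Localization.subalgebra.ofField K q.primeCompl q.primeCompl_le_nonZeroDivisors
  have hA : ∀ (q : Ideal B) [q.IsPrime], IsLocalization.AtPrime (A q) q := fun q _ =>
    Localization.subalgebra.isLocalization_ofField K _ _
  have hAloc : ∀ (q : Ideal B) [q.IsPrime], IsLocalRing (A q) := fun q _ =>
    IsLocalization.AtPrime.isLocalRing (A q) q
  have hAnoeth : ∀ (q : Ideal B) [q.IsPrime], IsNoetherianRing (A q) := fun q _ =>
    IsLocalization.isNoetherianRing q.primeCompl (A q) inferInstance
  have hinj : ∀ (q : Ideal B) [q.IsPrime], Function.Injective (algebraMap B (A q)) := fun q _ =>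
    IsLocalization.injective (A q) q.primeCompl_le_nonZeroDivisors
  have hmax : ∀ (q : Ideal B) [q.IsPrime] b,
      algebraMap B (A q) b ∈ IsLocalRing.maximalIdeal (A q) ↔ b ∈ q := fun q _ r =>
    IsLocalization.AtPrime.to_map_mem_maximal_iff (A q) q r
  have key : ∀ q : S, ∃ 𝒱 : Set (ValuationSubring K), 𝒱.Finite ∧
      (∀ V ∈ 𝒱, IsEssentialDVR B V ∧ V.valuation (algebraMap B K x) < 1) ∧
      ∀ f : K, (∀ a : A q, IsIntegral (A q) (a • f) ↔ a ∈ IsLocalRing.maximalIdeal (A q)) →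
        ∃ V ∈ 𝒱, f ∉ V := fun q => by
    obtain ⟨𝒱, h1, h2, h3⟩ := exists_finite_isEssentialDVR_of_isLocalRing (A := A q) (K := K)
      ((hmax q x).2 (hxS q q.2)) (fun h => hx0 (hinj q (by rw [h, map_zero])))
    refine ⟨𝒱, h1, fun V hV => ⟨?_, ?_⟩, h3⟩
    · refine (h2 V hV).1.of_isLocalization (q := (q : Ideal B)) fun s hs => ?_
      have hu : IsUnit (algebraMap B (A q) s) := IsLocalization.map_units (A q) (⟨s, hs⟩ :
        (q : Ideal B).primeCompl)
      obtain ⟨w, hw⟩ := hu.exists_right_inv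
      have hw' : algebraMap B K s * w = 1 := congrArg Subtype.val hw
      have i1 : V.valuation (algebraMap B K s) ≤ 1 := (V.valuation_le_one_iff _).2
        ((h2 V hV).1.integral_mem _ (isIntegral_algebraMap (R := A q)
          (x := algebraMap B (A q) s)))
      have i2 : V.valuation (w : K) ≤ 1 := (V.valuation_le_one_iff _).2
        ((h2 V hV).1.integral_mem _ (isIntegral_algebraMap (R := A q) (x := w)))
      have i3 := congrArg V.valuation hw'
      rw [map_mul, map_one] at i3
      refine le_antisymm i1 (i3 ▸ mul_le_of_le_one_right' i2)
    · exact (h2 V hV).2 _ ((hmax q x).2 (hxS q q.2))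
  choose 𝒱 h1 h2 h3 using key
  have := hS.to_subtype
  refine ⟨⋃ q, 𝒱 q, Set.finite_iUnion h1, fun V hV => ?_, fun f hxf hf => ?_⟩
  · obtain ⟨q, hq⟩ := Set.mem_iUnion.1 hV
    exact h2 q V hq
  by_contra hnot
  -- After localizing at `q`, the element `b0 f` has the maximal ideal as its exact conductor. So
  -- `q` is associated to `x`, and the local result supplies a valuation ring missing `b0 f`, hence
  -- missing `f`.
  obtain ⟨b0, q, hq, hb0⟩ := exists_mul_mem_iff_mem_prime (integralConductor_ne_top (B := B) hnot)
  have hf1 : ∀ a : A q, IsIntegral (A q) (a • b0 • f) ↔ a ∈ IsLocalRing.maximalIdeal (A q) := by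
    intro a
    obtain ⟨⟨b, s⟩, hs⟩ := IsLocalization.surj q.primeCompl a
    have hu : IsUnit (algebraMap B (A q) s) := IsLocalization.map_units (A q) s
    have e1 : a ∈ IsLocalRing.maximalIdeal (A q) ↔ b ∈ q := by
      rw [← hmax, ← hs]
      exact (Ideal.mul_unit_mem_iff_mem _ hu).symm
    have e2 : algebraMap B K b * f = algebraMap B K s * (a * f) := by
      have := congrArg Subtype.val hs
      change (a : K) * algebraMap B K s = algebraMap B K b at this
      linear_combination (-f) * this
    rw [e1]
    constructor
    · intro h
      obtain ⟨t, ht⟩ := IsIntegral.exists_multiple_integral_of_isLocalization q.primeCompl _ h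
      have : (t : B) * b ∈ q := by
        rw [← hb0, mem_integralConductor]
        have e3 : ((t : B) * b * b0) • f = (s : B) • t • a • b0 • f := by
          simp only [Algebra.smul_def, map_mul, Submonoid.smul_def]
          change _ = _ * (_ * ((a : K) * _))
          linear_combination (algebraMap B K t * algebraMap B K b0) * e2
        rw [e3]
        exact ht.smul (s : B)
      exact (hq.mem_or_mem this).resolve_left t.2
    · intro h
      rw [← hb0, mem_integralConductor] at h
      obtain ⟨w, hw⟩ := hu.exists_right_inv
      have hw' : algebraMap B K s * w = 1 := congrArg Subtype.val hw
      have e3 : a • b0 • f = w • (b * b0) • f := by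
        simp only [Algebra.smul_def, map_mul]
        change (a : K) * _ = (w : K) * _
        linear_combination (-(w : K) * algebraMap B K b0) * e2 - (a * algebraMap B K b0 * f) * hw'
      rw [e3]
      exact (h.tower_top (A := A q)).smul w
  have hxq : x ∈ q := by
    rw [← hb0, mem_integralConductor, mul_comm, mul_smul]
    exact hxf.smul b0
  have hm := mem_associatedPrimes_of_isIntegral_smul_iff (K := K) (x := algebraMap B (A q) x)
    (fun h => hx0 (hinj q (by rw [h, map_zero]))) (IsLocalRing.maximalIdeal.isMaximal (A q))
    ((hmax q x).2 hxq) hf1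
  have hqS : q ∈ S := mem_associatedPrimes_of_isLocalization (A := A q) hm
  obtain ⟨V, hV, hfV⟩ := h3 ⟨q, hqS⟩ (b0 • f) hf1
  refine hfV ?_
  rw [Algebra.smul_def]
  exact V.mul_mem _ _ ((h2 _ V hV).1.integral_mem _ isIntegral_algebraMap)
    (hf V (Set.mem_iUnion.2 ⟨_, hV⟩))

end NoetherianDomain

/-! ### Uniformizers and incomparability of discrete valuation rings in a field. -/

section DiscreteValuationSubring

variable {K : Type*} [Field K] (V : ValuationSubring K) [IsDiscreteValuationRing V]

theorem exists_uniformizer : ∃ ϖ : K, ϖ ≠ 0 ∧ V.valuation ϖ < 1 ∧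
    (∀ g, V.valuation g < 1 → V.valuation g ≤ V.valuation ϖ) ∧
    ∀ g, g ≠ 0 → g ∈ V → ∃ e : ℕ, V.valuation g = V.valuation ϖ ^ e := by
  obtain ⟨ϖ, hϖ⟩ := IsDiscreteValuationRing.exists_irreducible V
  refine ⟨ϖ, fun h => hϖ.ne_zero (Subtype.ext h), ?_, fun g hg => ?_, fun g hg hgV => ?_⟩
  · rw [← V.valuation_lt_one_iff, hϖ.maximalIdeal_eq]
    exact Ideal.mem_span_singleton_self _
  · have hgV : g ∈ V := (V.valuation_le_one_iff g).1 hg.le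
    have h := (V.valuation_lt_one_iff ⟨g, hgV⟩).2 hg
    rw [hϖ.maximalIdeal_eq, Ideal.mem_span_singleton] at h
    obtain ⟨c, hc⟩ := h
    have h1 : g = ϖ * c := congrArg Subtype.val hc
    rw [h1, map_mul]
    exact mul_le_of_le_one_right' (V.valuation_le_one c)
  · obtain ⟨n, u, hu⟩ := IsDiscreteValuationRing.eq_unit_mul_pow_irreducible
      (x := (⟨g, hgV⟩ : V)) (fun h => hg (congrArg Subtype.val h)) hϖ
    refine ⟨n, ?_⟩
    have h1 : g = (u : V) * (ϖ : K) ^ n := congrArg Subtype.val hu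
    rw [h1, map_mul, map_pow, V.valuation_unit, one_mul]

theorem eq_zero_of_forall_valuation_le_pow {x : K} (hx : V.valuation x < 1) {z : K}
    (h : ∀ n : ℕ, V.valuation z ≤ V.valuation x ^ n) : z = 0 := by
  by_contra hz
  obtain ⟨ϖ, hϖ0, hϖ1, hmax, hpow⟩ := exists_uniformizer V
  have hzV : z ∈ V := (V.valuation_le_one_iff z).1 (by simpa using h 0)
  obtain ⟨e, he⟩ := hpow z hz hzV
  have h1 := (h (e + 1)).trans (pow_le_pow_left₀ zero_le (hmax x hx) (e + 1))
  rw [he] at h1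
  exact absurd h1 (not_le.2 (pow_lt_pow_right_of_lt_one₀
    (zero_lt_iff.2 ((Valuation.ne_zero_iff _).2 hϖ0)) hϖ1 e.lt_succ_self))

/-- Two distinct discrete valuation rings dominating a common nonzero element are incomparable. -/
theorem not_le_of_ne {W : ValuationSubring K} (hVW : V ≠ W) {x : K} (hx0 : x ≠ 0)
    (hx : V.valuation x < 1) (hxW : W.valuation x < 1) : ∃ g ∈ V, g ∉ W := by
  by_contra! hle
  refine hVW (le_antisymm hle fun g hg => ?_)
  by_contra hgV
  obtain ⟨ϖ, hϖ0, hϖ1, hmax, hpow⟩ := exists_uniformizer V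
  have hg1 : 1 < V.valuation g := not_le.1 fun h => hgV ((V.valuation_le_one_iff g).1 h)
  have hg0 : g ≠ 0 := fun h => by simp [h] at hg1
  have hinv := hmax g⁻¹ (by rw [map_inv₀]; exact inv_lt_one_of_one_lt₀ hg1)
  obtain ⟨e, he⟩ := hpow x hx0 ((V.valuation_le_one_iff x).1 hx.le)
  -- An element `g` outside `V` has value at least that of an inverse uniformizer, so `g ^ e`
  -- absorbs the pole of `x⁻¹`. Multiplying back by `g ^ e ∈ W` puts `x⁻¹` in `W`, a contradiction.
  have h1 : x⁻¹ * (g⁻¹) ^ e ∈ V := by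
    rw [← V.valuation_le_one_iff, map_mul, map_inv₀, he, map_pow]
    have : V.valuation ϖ ^ e ≠ 0 := pow_ne_zero _ ((Valuation.ne_zero_iff _).2 hϖ0)
    calc (V.valuation ϖ ^ e)⁻¹ * V.valuation g⁻¹ ^ e
        ≤ (V.valuation ϖ ^ e)⁻¹ * V.valuation ϖ ^ e :=
          mul_le_mul_right (pow_le_pow_left₀ zero_le hinv e) _
      _ = 1 := inv_mul_cancel₀ this
  have h2 : x⁻¹ ∈ W := by
    have h3 := W.mul_mem _ _ (hle _ h1) (pow_mem hg e)
    rwa [mul_assoc, ← mul_pow, inv_mul_cancel₀ hg0, one_pow, mul_one] at h3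
  rw [← W.valuation_le_one_iff, map_inv₀] at h2
  exact absurd h2 (not_le.2 ((one_lt_inv₀
    (zero_lt_iff.2 ((Valuation.ne_zero_iff _).2 hx0))).2 hxW))

end DiscreteValuationSubring

section FG

theorem exists_fg_le_sup_ker {D N Q : Type*} [CommRing D] [AddCommGroup N] [Module D N]
    [AddCommGroup Q] [Module D Q] (ψ : N →ₗ[D] Q) (h : (LinearMap.range ψ).FG) :
    ∃ F : Submodule D N, F.FG ∧ ⊤ ≤ F ⊔ LinearMap.ker ψ := by
  obtain ⟨S, hS⟩ := h
  have : ∀ s : S, ∃ n, ψ n = s := fun s => by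
    have : (s : Q) ∈ LinearMap.range ψ := hS ▸ Submodule.subset_span s.2
    exact this
  choose p hp using this
  refine ⟨Submodule.span D (Set.range p), Submodule.fg_span (Set.finite_range p), ?_⟩
  rw [← Submodule.comap_map_eq, ← Submodule.map_le_iff_le_comap, Submodule.map_top, ← hS,
    Submodule.map_span]
  refine Submodule.span_mono fun s hs => ?_
  exact ⟨p ⟨s, hs⟩, ⟨_, rfl⟩, hp _⟩

end FG

/-- The field `L` is the fraction field of the image of `D` in a finite `D`-subalgebra. -/
def IsFiniteFractionField (D L : Type*) [CommRing D] [Field L] [Algebra D L] : Prop :=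
  ∃ E : Subalgebra D L, E.toSubmodule.FG ∧ ∀ l : L, ∃ a ∈ E, ∃ b ∈ E, b ≠ 0 ∧ l * b = a

/-! ### Residue fields of essential valuation rings and approximation at finitely many places. -/

section Closure

variable {D : Type*} [CommRing D] {L : Type*} [Field L] [Algebra D L]

/-- A subalgebra of a valuation ring as an algebra. -/
abbrev valuationSubringAlgebra (V : ValuationSubring L) (h : ∀ d, algebraMap D L d ∈ V) :
    Algebra D V :=
  ((algebraMap D L).codRestrict V.toSubring h).toAlgebra

theorem isIntegral_subalgebra_iff {E : Subalgebra D L} (hE : E.toSubmodule.FG) {g : L} :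
    IsIntegral E g ↔ IsIntegral D g := by
  have : Module.Finite D E := Module.Finite.iff_fg.2 hE
  exact ⟨fun h => isIntegral_trans g h, fun h => h.tower_top⟩

/-- This keeps the Noetherian induction going: the residue field again satisfies the hypothesis made
on `L`. The finite algebra is the image of `D[T ∪ G]`, with `T` the residue generators and `G`
generators of `E`, and each residue class is a quotient `h / s` of elements of it. -/
theorem isFiniteFractionField_residueField {E : Subalgebra D L} (hEfg : E.toSubmodule.FG)
    {V : ValuationSubring L} (hV : IsEssentialDVR E V) [Algebra D V]
    (halg : ∀ d, (algebraMap D V d : L) = algebraMap D L d) :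
    IsFiniteFractionField D (IsLocalRing.ResidueField V) := by
  obtain ⟨T, hT, hTi, hres⟩ := hV.residue
  have hE := hEfg
  obtain ⟨G, hG⟩ := hEfg
  have hEint : ∀ e ∈ E, IsIntegral D e := fun e he =>
    (isIntegral_subalgebra_iff hE).1 (isIntegral_algebraMap (R := E) (x := ⟨e, he⟩))
  have hGE : (G : Set L) ⊆ E := fun g hg => by
    change g ∈ E.toSubmodule
    rw [← hG]
    exact Submodule.subset_span hg
  let E1 : Subalgebra D L := Algebra.adjoin D (T ∪ G)
  have hE1int : ∀ s ∈ T ∪ (G : Set L), IsIntegral D s := by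
    rintro s (hs | hs)
    · exact (isIntegral_subalgebra_iff hE).1 (hTi s hs)
    · exact hEint s (hGE hs)
  have hE1 : E1.toSubmodule.FG :=
    fg_adjoin_of_finite (hT.union G.finite_toSet) hE1int
  have hEE1 : E ≤ E1 := by
    intro e he
    have h1 : e ∈ E.toSubmodule := he
    rw [← hG] at h1
    exact (Submodule.span_le (p := E1.toSubmodule)).2
      (fun g hg => Algebra.subset_adjoin (Or.inr hg)) h1
  have hE1V : ∀ e ∈ E1, e ∈ V := fun e he => hV.integral_mem e (by
    rw [isIntegral_subalgebra_iff hE]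
    exact IsIntegral.of_mem_of_fg E1 hE1 e he)
  let μ : E1 →ₐ[D] IsLocalRing.ResidueField V :=
    { toFun := fun e => IsLocalRing.residue V ⟨e, hE1V e e.2⟩
      map_one' := by rw [← map_one (IsLocalRing.residue V)]; rfl
      map_mul' := fun a b => by rw [← map_mul]; rfl
      map_zero' := by rw [← map_zero (IsLocalRing.residue V)]; rfl
      map_add' := fun a b => by rw [← map_add]; rfl
      commutes' := fun d => by
        rw [IsScalarTower.algebraMap_apply D V (IsLocalRing.ResidueField V)]
        exact congrArg (IsLocalRing.residue V) (Subtype.ext (halg d).symm) }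
  have hμ : ∀ e, μ e = IsLocalRing.residue V ⟨e, hE1V e e.2⟩ := fun _ => rfl
  have hres0 : ∀ g : V, IsLocalRing.residue V g = 0 ↔ V.valuation (g : L) < 1 := fun g => by
    rw [IsLocalRing.residue_eq_zero_iff, V.valuation_lt_one_iff]
  refine ⟨μ.range, ?_, fun l => ?_⟩
  · have : Module.Finite D E1 := Module.Finite.iff_fg.2 hE1
    have h1 := (Module.Finite.fg_top (R := D) (M := E1)).map μ.toLinearMap
    rw [Submodule.map_top] at h1
    exact h1
  · obtain ⟨g, rfl⟩ := IsLocalRing.residue_surjective l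
    obtain ⟨s, hs, h, hh, hlt⟩ := hres g g.2
    have hhE1 : h ∈ E1 := by
      clear hlt
      induction hh using Submodule.span_induction with
      | mem t ht => exact Algebra.subset_adjoin (Or.inl ht)
      | zero => exact zero_mem _
      | add a b _ _ ha hb => exact add_mem ha hb
      | smul r a _ ha =>
        rw [Algebra.smul_def]
        exact mul_mem (hEE1 r.2) ha
    refine ⟨_, ⟨⟨h, hhE1⟩, rfl⟩, _, ⟨⟨s, hEE1 s.2⟩, rfl⟩, ?_, ?_⟩
    · change μ _ ≠ 0
      rw [hμ, Ne, hres0]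
      exact not_lt.2 hs.ge
    · change _ * μ _ = μ _
      rw [hμ, hμ, ← map_mul, ← sub_eq_zero, ← map_sub, hres0]
      rw [Algebra.smul_def, mul_comm] at hlt
      exact hlt

/-- The elements of the integral closure with prescribed lower bounds on valuations. -/
def valuationFilter (D : Type*) [CommRing D] {L : Type*} [Field L] [Algebra D L]
    (𝒱 : Set (ValuationSubring L)) (ϖ : 𝒱 → L)
    (hD : ∀ V ∈ 𝒱, ∀ g, IsIntegral D g → g ∈ V) (a : 𝒱 → ℕ) : Submodule D L where
  carrier := {z | IsIntegral D z ∧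
    ∀ V : 𝒱, (V : ValuationSubring L).valuation z ≤ (V : ValuationSubring L).valuation (ϖ V) ^ a V}
  zero_mem' := ⟨isIntegral_zero, fun V => by simp⟩
  add_mem' := fun {y z} hy hz => ⟨hy.1.add hz.1, fun V =>
    (Valuation.map_add _ _ _).trans (max_le (hy.2 V) (hz.2 V))⟩
  smul_mem' := fun d z hz => ⟨hz.1.smul d, fun V => by
    rw [Algebra.smul_def, map_mul]
    exact (mul_le_of_le_one_left' (((V : ValuationSubring L).valuation_le_one_iff _).2
      (hD V V.2 _ isIntegral_algebraMap))).trans (hz.2 V)⟩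

/-- An element `c` of the integral closure such that multiplication by `c / x ^ N` maps the
filtration step `a` onto integral elements, with valuation `-a` at one given place. -/
theorem exists_isIntegral_valuation_eq {𝒱 : Set (ValuationSubring L)} (h𝒱 : 𝒱.Finite)
    {E : Subalgebra D L} (hE : E.toSubmodule.FG) (hV : ∀ V ∈ 𝒱, IsEssentialDVR E V) {x : L}
    (hx0 : x ≠ 0) (hx : ∀ V ∈ 𝒱, V.valuation x < 1) (ϖ : L) (V : ValuationSubring L) (hV𝒱 : V ∈ 𝒱)
    (hϖ0 : ϖ ≠ 0) (hϖ : V.valuation x ≤ V.valuation ϖ) (N : ℕ) :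
    ∃ c, IsIntegral D c ∧ V.valuation (c * ϖ ^ N) = V.valuation (x ^ N) ∧
      ∀ W ∈ 𝒱, W ≠ V → W.valuation c ≤ W.valuation (x ^ N) := by
  have hE' : ∀ {g : L}, IsIntegral E g ↔ IsIntegral D g := isIntegral_subalgebra_iff hE
  have hdvr : ∀ W ∈ 𝒱, IsDiscreteValuationRing W := fun W hW => (hV W hW).dvr
  have hdvrV := hdvr V hV𝒱
  -- elements which are units at `V` and nonunits at the other places
  have hs : ∀ W : 𝒱, ∃ s, IsIntegral D s ∧ V.valuation s = 1 ∧ ((W : ValuationSubring L) ≠ V →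
      (W : ValuationSubring L).valuation s < 1) := fun W => by
    by_cases hWV : (W : ValuationSubring L) = V
    · exact ⟨1, isIntegral_one, map_one _, fun h => (h hWV).elim⟩
    obtain ⟨g, hg, hgW⟩ := not_le_of_ne V (Ne.symm hWV) hx0 (hx V hV𝒱) (hx W W.2)
    obtain ⟨s, h1, h2, h3⟩ := (hV V hV𝒱).loc g hg
    refine ⟨s, hE'.1 h1, h2, fun _ => ?_⟩
    have h4 := ((W : ValuationSubring L).valuation_le_one_iff _).2 ((hV W W.2).integral_mem _ h3)
    have h5 : 1 < (W : ValuationSubring L).valuation g :=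
      not_le.1 fun h => hgW (((W : ValuationSubring L).valuation_le_one_iff g).1 h)
    rw [map_mul] at h4
    by_contra hcon
    exact absurd h4 (not_le.2 (one_lt_mul_of_le_of_lt (not_lt.1 hcon) h5))
  choose s hs1 hs2 hs3 using hs
  classical
  have : Fintype 𝒱 := h𝒱.fintype
  have hle1 : ∀ W ∈ 𝒱, ∀ g, IsIntegral D g → W.valuation g ≤ 1 := fun W hW g hg =>
    (W.valuation_le_one_iff g).2 ((hV W hW).integral_mem g (hE'.2 hg))
  obtain ⟨M, hM⟩ : ∃ M : ℕ, ∀ W : 𝒱, (W : ValuationSubring L) ≠ V →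
      (W : ValuationSubring L).valuation (s W) ^ M ≤
        (W : ValuationSubring L).valuation (x ^ N) := by
    have h1 : ∀ W : 𝒱, ∃ M : ℕ, (W : ValuationSubring L) ≠ V →
      (W : ValuationSubring L).valuation (s W) ^ M ≤
        (W : ValuationSubring L).valuation (x ^ N) := fun W => by
      have := hdvr W W.2
      obtain ⟨ϖW, h0, h1, hmax, hpow⟩ := exists_uniformizer (W : ValuationSubring L)
      obtain ⟨e, he⟩ := hpow (x ^ N) (pow_ne_zero _ hx0) ((ValuationSubring.valuation_le_one_iff _ _).1
        (by rw [map_pow]; exact pow_le_one₀ zero_le (hx W W.2).le))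
      exact ⟨e, fun hWV => he ▸ pow_le_pow_left₀ zero_le (hmax _ (hs3 W hWV)) e⟩
    choose m hm using h1
    refine ⟨∑ W, m W, fun W hWV => (pow_le_pow_right_of_le_one' (hs3 W hWV).le ?_).trans
      (hm W hWV)⟩
    exact Finset.single_le_sum (f := m) (fun _ _ => Nat.zero_le _) (Finset.mem_univ _)
  obtain ⟨t0, ht0, ht1⟩ : ∃ t, IsIntegral D t ∧
      V.valuation (t * ϖ ^ N) = V.valuation (x ^ N) := by
    -- Multiplied by a `V`-unit, `(x / ϖ) ^ N` becomes integral and has the prescribed value at `V`.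
    -- High powers of the `s W` then provide the vanishing at the other places.
    have hmem : (x / ϖ) ^ N ∈ V := by
      refine pow_mem ((V.valuation_le_one_iff _).1 ?_) N
      rw [map_div₀]
      exact div_le_one_of_le₀ hϖ zero_le
    obtain ⟨u, h1, h2, h3⟩ := (hV V hV𝒱).loc _ hmem
    refine ⟨_, hE'.1 h3, ?_⟩
    rw [div_pow, mul_assoc, div_mul_cancel₀ _ (pow_ne_zero _ hϖ0), map_mul, h2, one_mul]
  refine ⟨t0 * ∏ W, s W ^ M, ht0.mul (IsIntegral.prod _ fun W _ => (hs1 W).pow M), ?_,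
    fun W hW hWV => ?_⟩
  · rw [mul_right_comm, map_mul, ht1, map_prod, Finset.prod_eq_one, mul_one]
    intro W _
    rw [map_pow, hs2, one_pow]
  · rw [map_mul, map_prod, ← Finset.mul_prod_erase Finset.univ _ (Finset.mem_univ ⟨W, hW⟩)]
    have hprod : ∏ U ∈ Finset.univ.erase ⟨W, hW⟩, W.valuation (s U ^ M) ≤ 1 :=
      Finset.prod_le_one' fun U _ => hle1 W hW _ ((hs1 U).pow M)
    refine (mul_le_of_le_one_left' (hle1 W hW _ ht0)).trans
      ((mul_le_of_le_one_right' hprod).trans ?_)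
    rw [map_pow]
    exact hM ⟨W, hW⟩ hWV

end Closure

/-! ### The valuation filtration and finiteness over an adically complete ring. -/

section Closure

variable {D : Type*} [CommRing D] {L : Type*} [Field L] [Algebra D L]

/-- If `x⁻¹` were integral, the finite module `D[x⁻¹]` would equal `x` times itself and vanish by
Nakayama. -/
theorem not_isIntegral_inv_of_mem_jacobson {x : D} (hx : x ∈ Ideal.jacobson (⊥ : Ideal D))
    (hx0 : algebraMap D L x ≠ 0) : ¬ IsIntegral D (algebraMap D L x)⁻¹ := by
  intro h
  have hbot := Submodule.eq_bot_of_le_smul_of_le_jacobson_bot (Ideal.span {x})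
    (Algebra.adjoin D {(algebraMap D L x)⁻¹}).toSubmodule h.fg_adjoin_singleton (fun z hz => ?_)
    ((Ideal.span_singleton_le_iff_mem _).2 hx)
  · have h1 : (1 : L) ∈ (Algebra.adjoin D {(algebraMap D L x)⁻¹}).toSubmodule :=
      one_mem (Algebra.adjoin D {(algebraMap D L x)⁻¹})
    rw [hbot, Submodule.mem_bot] at h1
    exact one_ne_zero h1
  · have h2 : z = x • ((algebraMap D L x)⁻¹ * z) := by
      rw [Algebra.smul_def, mul_inv_cancel_left₀ hx0]
    rw [h2]
    exact Submodule.smul_mem_smul (Ideal.mem_span_singleton_self x)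
      (show _ ∈ Algebra.adjoin D {(algebraMap D L x)⁻¹} from
        mul_mem (Algebra.self_mem_adjoin_singleton D _) hz)

open Classical in
-- One step of the filtration at the place `V`. Multiplication by `c / x ^ N`, which has the value
-- of `ϖ ^ (-N)` at `V` and no pole at the other places, carries the step into integral elements.
-- Reduction modulo `V` lands in the integral closure of `D` in the residue field, and the kernel is
-- the next step.
theorem exists_fg_valuationFilter_succ [IsNoetherianRing D] {𝒱 : Set (ValuationSubring L)}
    (h𝒱 : 𝒱.Finite) {E : Subalgebra D L} (hE : E.toSubmodule.FG)
    (hV : ∀ V ∈ 𝒱, IsEssentialDVR E V) {x : L} (hx0 : x ≠ 0) (hx : ∀ V ∈ 𝒱, V.valuation x < 1)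
    (hint : ∀ f : L, IsIntegral D (x * f) → (∀ V ∈ 𝒱, f ∈ V) → IsIntegral D f)
    {ϖ : 𝒱 → L} (hD : ∀ V ∈ 𝒱, ∀ g, IsIntegral D g → g ∈ V)
    (hϖ0 : ∀ V, ϖ V ≠ 0)
    (hϖ : ∀ (V : 𝒱) g, (V : ValuationSubring L).valuation g < 1 →
      (V : ValuationSubring L).valuation g ≤ (V : ValuationSubring L).valuation (ϖ V))
    (V : 𝒱) [Algebra D V] (halg : ∀ d, (algebraMap D V d : L) = algebraMap D L d)
    (hres : (integralClosure D (IsLocalRing.ResidueField V)).toSubmodule.FG) (a : 𝒱 → ℕ) :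
    ∃ F : Submodule D L, F.FG ∧ F ≤ valuationFilter D 𝒱 ϖ hD a ∧
      valuationFilter D 𝒱 ϖ hD a ≤ F ⊔ valuationFilter D 𝒱 ϖ hD (a + Pi.single V 1) := by
  let N := a V
  obtain ⟨c, hc, hcV, hcW⟩ := exists_isIntegral_valuation_eq h𝒱 hE hV hx0 hx (ϖ V) V V.2 (hϖ0 V)
    (hϖ V x (hx V V.2)) N
  have hintN : ∀ n : ℕ, ∀ f : L, IsIntegral D (x ^ n * f) → (∀ V ∈ 𝒱, f ∈ V) → IsIntegral D f := by
    intro n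
    induction n with
    | zero => intro f hf _; simpa using hf
    | succ n ih =>
      intro f hf hfV
      refine hint f (ih _ (by rwa [← mul_assoc, ← pow_succ]) fun W hW => ?_) hfV
      exact mul_mem ((W.valuation_le_one_iff x).1 (hx W hW).le) (hfV W hW)
  have hxN : x ^ N ≠ 0 := pow_ne_zero _ hx0
  have hvx : ∀ W : ValuationSubring L, W.valuation (x ^ N) ≠ 0 := fun W =>
    (Valuation.ne_zero_iff _).2 hxN
  have hcz : ∀ z ∈ valuationFilter D 𝒱 ϖ hD a, IsIntegral D (c * z / x ^ N) := fun z hz => by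
    refine hintN N _ ?_ fun W hW => ?_
    · rw [mul_div_cancel₀ _ hxN]
      exact hc.mul hz.1
    · rw [← W.valuation_le_one_iff, map_div₀]
      refine div_le_one_of_le₀ ?_ zero_le
      by_cases hWV : W = V
      · subst hWV
        rw [← hcV, map_mul, map_mul, map_pow]
        exact mul_le_mul_right (hz.2 V) _
      · rw [map_mul]
        exact (mul_le_of_le_one_right' ((W.valuation_le_one_iff z).2 (hD W hW z hz.1))).trans
          (hcW W hW hWV)
  let ψ : valuationFilter D 𝒱 ϖ hD a →ₗ[D] IsLocalRing.ResidueField V :=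
    { toFun := fun z => IsLocalRing.residue V ⟨c * z / x ^ N, hD V V.2 _ (hcz z z.2)⟩
      map_add' := fun y z => by
        rw [← map_add]
        congr 1
        refine Subtype.ext ?_
        change c * (y + z : L) / x ^ N = c * y / x ^ N + c * z / x ^ N
        ring
      map_smul' := fun d z => by
        rw [Algebra.smul_def, IsScalarTower.algebraMap_apply D V (IsLocalRing.ResidueField V),
          RingHom.id_apply]
        change _ = IsLocalRing.residue V _ * IsLocalRing.residue V _
        rw [← map_mul]
        congr 1
        refine Subtype.ext ?_
        change c * (d • (z : L)) / x ^ N = (algebraMap D V d : L) * (c * z / x ^ N)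
        rw [halg, Algebra.smul_def]
        ring }
  have hψ : ∀ z, ψ z = IsLocalRing.residue V ⟨c * z / x ^ N, hD V V.2 _ (hcz z z.2)⟩ :=
    fun _ => rfl
  have hrange : (LinearMap.range ψ).FG := by
    have : IsNoetherian D (integralClosure D (IsLocalRing.ResidueField V)).toSubmodule :=
      isNoetherian_of_fg_of_noetherian _ hres
    refine isNoetherian_submodule.1 this _ ?_
    rintro _ ⟨z, rfl⟩
    have h1 : IsIntegral D (⟨c * z / x ^ N, hD V V.2 _ (hcz z z.2)⟩ :
        (V : ValuationSubring L)) := by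
      obtain ⟨p, hp, hpe⟩ := hcz z z.2
      refine ⟨p, hp, Subtype.ext ?_⟩
      have h2 := Polynomial.hom_eval₂ p (algebraMap D V) (V : ValuationSubring L).subtype
        ⟨c * z / x ^ N, hD V V.2 _ (hcz z z.2)⟩
      refine h2.trans ?_
      have h3 : ((V : ValuationSubring L).subtype).comp (algebraMap D V) = algebraMap D L :=
        RingHom.ext halg
      rw [h3]
      exact hpe
    exact h1.map (IsScalarTower.toAlgHom D V (IsLocalRing.ResidueField V))
  obtain ⟨F, hF, hFk⟩ := exists_fg_le_sup_ker ψ hrange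
  refine ⟨F.map (Submodule.subtype _), hF.map _, ?_, ?_⟩
  · rintro _ ⟨z, -, rfl⟩
    exact z.2
  · intro z hz
    obtain ⟨f, hf, k, hk, hfk⟩ := Submodule.mem_sup.1
      (hFk (Submodule.mem_top : (⟨z, hz⟩ : valuationFilter D 𝒱 ϖ hD a) ∈ _))
    refine Submodule.mem_sup.2 ⟨f, ⟨f, hf, rfl⟩, k, ⟨k.2.1, fun W => ?_⟩,
      congrArg Subtype.val hfk⟩
    by_cases hWV : W = V
    · subst hWV
      rw [LinearMap.mem_ker, hψ, IsLocalRing.residue_eq_zero_iff,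
        ValuationSubring.valuation_lt_one_iff] at hk
      have h1 : (W : ValuationSubring L).valuation (k / ϖ W ^ N) < 1 := by
        have hc0 : c ≠ 0 := by
          rintro rfl
          rw [zero_mul, map_zero] at hcV
          exact hvx _ hcV.symm
        have hv : (W : ValuationSubring L).valuation (c * ϖ W ^ N) ≠ 0 :=
          (Valuation.ne_zero_iff _).2 (mul_ne_zero hc0 (pow_ne_zero _ (hϖ0 W)))
        have h2 : (W : ValuationSubring L).valuation (c * k / x ^ N) =
            (W : ValuationSubring L).valuation (k / ϖ W ^ N) := by
          rw [map_div₀, ← hcV, ← map_div₀, mul_div_mul_left _ _ hc0]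
        rw [← h2]
        exact hk
      have h3 := hϖ W _ h1
      rw [map_div₀, div_le_iff₀ (zero_lt_iff.2 ((Valuation.ne_zero_iff _).2
        (pow_ne_zero _ (hϖ0 W)))), map_pow, ← pow_succ'] at h3
      simpa [N] using h3
    · rw [Pi.add_apply, Pi.single_eq_of_ne hWV, add_zero]
      exact k.2.2 W

open Classical in
/-- Over a ring complete for the powers of `x`, finiteness of integral closures for the residue
fields of primes containing `x` implies finiteness of integral closures. -/
theorem integralClosure_fg_of_adic {D : Type*} [CommRing D] [IsNoetherianRing D] {L : Type*}
    [Field L] [Algebra D L] {x : D} [IsAdicComplete (Ideal.span {x}) D]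
    (hx : algebraMap D L x ≠ 0) (hL : IsFiniteFractionField D L)
    (IH : ∀ (V : ValuationSubring L) [Algebra D V], IsFiniteFractionField D
      (IsLocalRing.ResidueField V) → RingHom.ker (algebraMap D L) ≤ RingHom.ker (algebraMap D
      (IsLocalRing.ResidueField V)) → algebraMap D (IsLocalRing.ResidueField V) x = 0 →
      (integralClosure D (IsLocalRing.ResidueField V)).toSubmodule.FG) :
    (integralClosure D L).toSubmodule.FG := by
  obtain ⟨E, hE, hfrac⟩ := hL
  have hfin : Module.Finite D E := Module.Finite.iff_fg.2 hE
  have hnoeth : IsNoetherianRing E := IsNoetherianRing.of_finite D E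
  have hfr : IsFractionRing E L := IsFractionRing.of_field E L fun z => by
    obtain ⟨a, ha, b, hb, hb0, h⟩ := hfrac z
    exact ⟨⟨a, ha⟩, ⟨b, hb⟩, (div_eq_iff hb0).2 h.symm |>.symm⟩
  have hxE : algebraMap D E x ≠ 0 := fun h => hx (congrArg Subtype.val h)
  have hE' : ∀ {g : L}, IsIntegral E g ↔ IsIntegral D g := isIntegral_subalgebra_iff hE
  obtain ⟨𝒱, h𝒱, hV, hint⟩ := exists_finite_isEssentialDVR (K := L) hxE
  have hVE : ∀ V ∈ 𝒱, IsEssentialDVR E V := fun V h => (hV V h).1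
  have hVx : ∀ V ∈ 𝒱, V.valuation (algebraMap D L x) < 1 := fun V h => (hV V h).2
  have hD : ∀ V ∈ 𝒱, ∀ g, IsIntegral D g → g ∈ V := fun V h g hg =>
    (hVE V h).integral_mem g (hE'.2 hg)
  have hint' : ∀ f : L, IsIntegral D (algebraMap D L x * f) → (∀ V ∈ 𝒱, f ∈ V) →
      IsIntegral D f := fun f hf hfV => hE'.1 (hint f (by
        rw [Algebra.smul_def]; exact hE'.2 hf) hfV)
  have hdvr : ∀ V : 𝒱, IsDiscreteValuationRing (V : ValuationSubring L) :=
    fun V => (hVE V V.2).dvr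
  choose ϖ hϖ0 hϖ1 hϖ hpow using fun V : 𝒱 => exists_uniformizer (V : ValuationSubring L)
  -- The exponents `e V` of `x` mark the end of the filtration: an integral element lying in that
  -- step is `x` times an integral element.
  choose e he using fun V : 𝒱 => hpow V _ hx (((V : ValuationSubring L).valuation_le_one_iff _).1
    (hVx V V.2).le)
  have hfilter : ∀ n (a : 𝒱 → ℕ), (have := h𝒱.fintype; ∑ V, a V = n) → ∃ F : Submodule D L, F.FG ∧
      F ≤ (integralClosure D L).toSubmodule ∧
      (integralClosure D L).toSubmodule ≤ F ⊔ valuationFilter D 𝒱 ϖ hD a := by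
    have := h𝒱.fintype
    intro n
    induction n with
    | zero =>
      intro a ha
      have ha0 : ∀ V, a V = 0 := by simpa using ha
      refine ⟨⊥, Submodule.fg_bot, bot_le, fun z hz => ?_⟩
      rw [bot_sup_eq]
      refine ⟨hz, fun V => ?_⟩
      rw [ha0, pow_zero, ValuationSubring.valuation_le_one_iff]
      exact hD V V.2 z hz
    | succ n ih =>
      intro a ha
      obtain ⟨V, hV0⟩ : ∃ V, a V ≠ 0 := by
        by_contra! h
        simp [h] at ha
      obtain ⟨b, rfl⟩ : ∃ b : 𝒱 → ℕ, a = b + (Pi.single V 1 : 𝒱 → ℕ) := by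
        refine ⟨fun W => a W - (Pi.single V 1 : 𝒱 → ℕ) W, funext fun W => ?_⟩
        rw [Pi.add_apply]
        by_cases hWV : W = V
        · subst hWV
          rw [Pi.single_eq_same]
          lia
        · rw [Pi.single_eq_of_ne hWV]
          lia
      obtain ⟨F, hF, hF1, hF2⟩ := ih b (by
        simp only [Pi.add_apply, Finset.sum_add_distrib, Finset.sum_pi_single',
          Finset.mem_univ, if_true] at ha
        simpa using ha)
      let := valuationSubringAlgebra (V : ValuationSubring L) fun d =>
        hD V V.2 (algebraMap D L d) isIntegral_algebraMap
      have halg : ∀ d, (algebraMap D V d : L) = algebraMap D L d := fun d => rfl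
      have hres : (integralClosure D (IsLocalRing.ResidueField V)).toSubmodule.FG := by
        refine IH V (isFiniteFractionField_residueField hE (hVE V V.2) halg) (fun d hd => ?_) ?_
        · rw [RingHom.mem_ker] at hd ⊢
          rw [IsScalarTower.algebraMap_apply D V (IsLocalRing.ResidueField V),
            show algebraMap D V d = 0 from Subtype.ext hd, map_zero]
        · rw [IsScalarTower.algebraMap_apply D V (IsLocalRing.ResidueField V)]
          exact (IsLocalRing.residue_eq_zero_iff _).2
            ((ValuationSubring.valuation_lt_one_iff _ _).2 (hVx V V.2))
      obtain ⟨F', hF', hF1', hF2'⟩ := exists_fg_valuationFilter_succ h𝒱 hE hVE hx hVx hint' hD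
        hϖ0 hϖ V halg hres b
      refine ⟨F ⊔ F', hF.sup hF', sup_le hF1 (hF1'.trans fun z hz => hz.1), ?_⟩
      rw [sup_assoc]
      exact hF2.trans (sup_le_sup_left hF2' F)
  obtain ⟨F, hF, hF1, hF2⟩ := hfilter _ e rfl
  have hFfg : (Submodule.comap (integralClosure D L).toSubmodule.subtype F).FG := by
    refine Submodule.fg_of_fg_map_injective _ (Submodule.injective_subtype _) ?_
    rwa [Submodule.map_comap_subtype, inf_eq_right.2 hF1]
  have htop := eq_top_of_fg_of_adic (M := (integralClosure D L).toSubmodule) x (fun m hm => ?_) _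
    hFfg fun m => ?_
  · rw [htop] at hFfg
    exact (Submodule.fg_top _).1 hFfg
  -- Separatedness is read off at one place. If there were none, the detection property would make
  -- `x⁻¹` integral, although `x` is in the Jacobson radical.
  · obtain ⟨V, hV𝒱⟩ : 𝒱.Nonempty := by
      by_contra hemp
      rw [Set.not_nonempty_iff_eq_empty] at hemp
      refine not_isIntegral_inv_of_mem_jacobson ((IsAdicComplete.le_jacobson_bot
        (Ideal.span {x})) (Ideal.mem_span_singleton_self x)) hx (hint' _ ?_ (by simp [hemp]))
      rw [mul_inv_cancel₀ hx]
      exact isIntegral_one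
    have := hdvr ⟨V, hV𝒱⟩
    refine Subtype.ext (eq_zero_of_forall_valuation_le_pow V (hVx V hV𝒱) fun n => ?_)
    obtain ⟨m', hm'⟩ := hm n
    have h1 : (m : L) = algebraMap D L x ^ n * m' := by
      have := congrArg Subtype.val hm'
      rw [← map_pow, ← Algebra.smul_def]
      exact this
    rw [h1, map_mul, map_pow]
    exact mul_le_of_le_one_right' ((V.valuation_le_one_iff _).2 (hD V hV𝒱 _ m'.2))
  · obtain ⟨f, hf, z, hz, hfz⟩ := Submodule.mem_sup.1 (hF2 m.2)
    have hzx : IsIntegral D (z / algebraMap D L x) := by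
      refine hint' _ ?_ fun V hV𝒱 => ?_
      · rw [mul_div_cancel₀ _ hx]
        exact hz.1
      · rw [← V.valuation_le_one_iff, map_div₀]
        exact div_le_one_of_le₀ ((hz.2 ⟨V, hV𝒱⟩).trans (he ⟨V, hV𝒱⟩).ge) zero_le
    refine ⟨⟨f, hF1 hf⟩, hf, ⟨_, hzx⟩, Subtype.ext ?_⟩
    change (m : L) = f + x • (z / algebraMap D L x)
    rw [Algebra.smul_def, mul_div_cancel₀ _ hx, hfz]

end Closure

/-! ### Finite integral closure for domains of finite type over a field of any characteristic. -/

section FiniteType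

open Polynomial in
-- Each element has its own exponent, from a separable contraction of its minimal polynomial. A
-- common exponent is reached by applying Frobenius powers to the coefficients.
theorem exists_separable_pow_expChar_pow (F : Type*) {Ω : Type*} [Field F] [Field Ω] [Algebra F Ω]
    (q : ℕ) [ExpChar F q] {G : Set Ω} (hG : G.Finite) (hint : ∀ l ∈ G, IsIntegral F l) :
    ∃ e : ℕ, ∀ l ∈ G, ∃ g : F[X], g.Separable ∧ aeval (l ^ q ^ e) g = 0 := by
  have h1 : ∀ l : G, ∃ (m : ℕ) (g : F[X]), g.Separable ∧ aeval ((l : Ω) ^ q ^ m) g = 0 := fun l => by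
    obtain ⟨g, hg, m, hm⟩ := (minpoly.irreducible (hint l l.2)).hasSeparableContraction q
    refine ⟨m, g, hg, ?_⟩
    rw [← expand_aeval, hm, minpoly.aeval]
  choose m g hg hm using h1
  have := hG.fintype
  refine ⟨∑ l, m l, fun l hl => ?_⟩
  obtain ⟨j, hj⟩ := Nat.exists_eq_add_of_le (Finset.single_le_sum (f := m)
    (fun _ _ => Nat.zero_le _) (Finset.mem_univ (⟨l, hl⟩ : G)))
  refine ⟨(g ⟨l, hl⟩).map (iterateFrobenius F q j), (separable_map _).2 (hg _), ?_⟩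
  have : ExpChar Ω q := expChar_of_injective_algebraMap (algebraMap F Ω).injective q
  have h2 := hom_eval₂ (g ⟨l, hl⟩) (algebraMap F Ω) (iterateFrobenius Ω q j)
    (l ^ q ^ m ⟨l, hl⟩)
  have h3 : (iterateFrobenius Ω q j).comp (algebraMap F Ω) =
      (algebraMap F Ω).comp (iterateFrobenius F q j) := by
    ext a
    simp [iterateFrobenius_def]
  rw [← aeval_def, hm ⟨l, hl⟩, map_zero, h3, iterateFrobenius_def, ← pow_mul, ← pow_add, ← hj,
    ← eval₂_map] at h2
  exact h2.symm

theorem isIntegrallyClosed_mvPolynomial (s : ℕ) (κ : Type*) [Field κ] :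
    IsIntegrallyClosed (MvPolynomial (Fin s) κ) := inferInstance

universe v in
/-- A finite extension of a polynomial ring, again integrally closed, over which finitely many given
elements acquire `N`-th roots. -/
theorem exists_finite_isIntegrallyClosed_root {κ : Type*} {Ω : Type v} [Field κ] [Field Ω] [Algebra κ Ω] {s : ℕ}
    [Algebra (MvPolynomial (Fin s) κ) Ω] [IsScalarTower κ (MvPolynomial (Fin s) κ) Ω]
    [FaithfulSMul (MvPolynomial (Fin s) κ) Ω] (rt : Ω →+* Ω) {N : ℕ} (hN : N ≠ 0)
    (hrt : ∀ z, rt z ^ N = z) {U : Set (MvPolynomial (Fin s) κ)} (hU : U.Finite) :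
    ∃ (P' : Type v) (_ : CommRing P') (_ : Algebra (MvPolynomial (Fin s) κ) P') (_ : Algebra P' Ω),
      IsScalarTower (MvPolynomial (Fin s) κ) P' Ω ∧ Module.Finite (MvPolynomial (Fin s) κ) P' ∧
      FaithfulSMul P' Ω ∧ IsDomain P' ∧ IsIntegrallyClosed P' ∧
      ∀ u ∈ U, rt (algebraMap _ Ω u) ∈ (algebraMap P' Ω).range := by
  classical
  let y : Fin s → Ω := fun i => algebraMap (MvPolynomial (Fin s) κ) Ω (MvPolynomial.X i)
  let K0 : Set κ := ⋃ u ∈ U, (u.coeffs : Set κ)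
  have hK0 : K0.Finite := hU.biUnion fun u _ => u.coeffs.finite_toSet
  let S : Set Ω := (fun a => rt (algebraMap κ Ω a)) '' K0
  have hS : S.Finite := hK0.image _
  have : Finite S := hS
  let κ' := IntermediateField.adjoin κ S
  have hfin : FiniteDimensional κ κ' := IntermediateField.finiteDimensional_adjoin fun x hx => by
    obtain ⟨a, -, rfl⟩ := hx
    refine IsIntegral.of_pow (Nat.pos_of_ne_zero hN) ?_
    rw [hrt]
    exact isIntegral_algebraMap
  have hclosed : IsIntegrallyClosed (MvPolynomial (Fin s) κ') :=
    isIntegrallyClosed_mvPolynomial s κ'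
  -- The larger ring is `κ'[X₁^(1/N), …]`, written as a polynomial ring over `κ'` whose structure
  -- map sends `Xᵢ` to `Xᵢ ^ N`. The field `κ'` contains the `N`-th roots of all coefficients in
  -- question.
  let ρ : MvPolynomial (Fin s) κ →+* MvPolynomial (Fin s) κ' :=
    MvPolynomial.eval₂Hom (MvPolynomial.C.comp (algebraMap κ κ')) fun i => MvPolynomial.X i ^ N
  let ev : MvPolynomial (Fin s) κ' →+* Ω :=
    MvPolynomial.eval₂Hom (algebraMap κ' Ω) fun i => rt (y i)
  let := ρ.toAlgebra
  let := ev.toAlgebra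
  have hρ : algebraMap (MvPolynomial (Fin s) κ) (MvPolynomial (Fin s) κ') = ρ := rfl
  have hev : algebraMap (MvPolynomial (Fin s) κ') Ω = ev := rfl
  have htower : IsScalarTower (MvPolynomial (Fin s) κ) (MvPolynomial (Fin s) κ') Ω := by
    refine IsScalarTower.of_algebraMap_eq' (MvPolynomial.ringHom_ext (fun a => ?_) fun i => ?_)
    · rw [← MvPolynomial.algebraMap_eq, ← IsScalarTower.algebraMap_apply, RingHom.comp_apply, hρ, hev]
      simp [ρ, ev, MvPolynomial.algebraMap_eq, ← IsScalarTower.algebraMap_apply]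
    · rw [RingHom.comp_apply, hρ, hev]
      simp [ρ, ev, hrt, y]
  have htower' : IsScalarTower κ (MvPolynomial (Fin s) κ) (MvPolynomial (Fin s) κ') := by
    refine IsScalarTower.of_algebraMap_eq fun a => ?_
    rw [hρ]
    simp [ρ, MvPolynomial.algebraMap_eq]
  have hint : Algebra.IsIntegral (MvPolynomial (Fin s) κ) (MvPolynomial (Fin s) κ') := by
    refine ⟨fun f => ?_⟩
    induction f using MvPolynomial.induction_on with
    | C a =>
      have h1 : IsIntegral κ a := Algebra.IsIntegral.isIntegral a
      exact (h1.map (IsScalarTower.toAlgHom κ κ' (MvPolynomial (Fin s) κ'))).tower_top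
    | add f g hf hg => exact hf.add hg
    | mul_X f i hf =>
      refine hf.mul (IsIntegral.of_pow (Nat.pos_of_ne_zero hN) ?_)
      have h1 : algebraMap (MvPolynomial (Fin s) κ) (MvPolynomial (Fin s) κ')
        (MvPolynomial.X i) = MvPolynomial.X i ^ N := by rw [hρ]; simp [ρ]
      rw [← h1]
      exact isIntegral_algebraMap
  have hft : Algebra.FiniteType κ (MvPolynomial (Fin s) κ') :=
    Algebra.FiniteType.trans (S := κ') inferInstance inferInstance
  have hft' : Algebra.FiniteType (MvPolynomial (Fin s) κ) (MvPolynomial (Fin s) κ') :=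
    Algebra.FiniteType.of_restrictScalars_finiteType κ _ _
  refine ⟨MvPolynomial (Fin s) κ', _, _, _, htower, Algebra.IsIntegral.finite, ?_, inferInstance,
    hclosed, fun u hu => ?_⟩
  · rw [faithfulSMul_iff_algebraMap_injective, RingHom.injective_iff_ker_eq_bot]
    refine Ideal.eq_bot_of_comap_eq_bot (R := MvPolynomial (Fin s) κ) ?_
    rw [RingHom.comap_ker, ← IsScalarTower.algebraMap_eq, ← RingHom.injective_iff_ker_eq_bot]
    exact FaithfulSMul.algebraMap_injective _ _
  · rw [u.as_sum, map_sum, map_sum]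
    refine sum_mem fun ν hν => ?_
    rw [MvPolynomial.monomial_eq, map_mul, map_mul]
    refine mul_mem ?_ ?_
    · have h1 : rt (algebraMap κ Ω (u.coeff ν)) ∈ κ' := IntermediateField.subset_adjoin κ S
        ⟨_, Set.mem_biUnion hu (MvPolynomial.coeff_mem_coeffs ν (MvPolynomial.mem_support_iff.1 hν)),
          rfl⟩
      refine ⟨MvPolynomial.C ⟨_, h1⟩, ?_⟩
      rw [← MvPolynomial.algebraMap_eq (R := κ), ← IsScalarTower.algebraMap_apply, hev]
      simp [ev]
    · rw [Finsupp.prod, map_prod, map_prod]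
      refine prod_mem fun i _ => ?_
      rw [map_pow, map_pow]
      refine pow_mem (show _ ∈ (algebraMap (MvPolynomial (Fin s) κ') Ω).range from
        ⟨MvPolynomial.X i, ?_⟩) _
      rw [hev]
      simp [ev, y]

theorem exists_fg_of_separable {A K Ω : Type*} [CommRing A] [IsDomain A] [IsNoetherianRing A]
    [IsIntegrallyClosed A] [Field K] [Field Ω] [Algebra A K] [IsFractionRing A K] [Algebra K Ω]
    [Algebra A Ω] [IsScalarTower A K Ω] {G : Set Ω} (hG : G.Finite) (hsep : ∀ l ∈ G, IsSeparable K l) :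
    ∃ Z : Submodule A Ω, Z.FG ∧ ∀ z ∈ IntermediateField.adjoin K G, IsIntegral A z → z ∈ Z := by
  let L' := IntermediateField.adjoin K G
  have : Finite G := hG
  have hfd : FiniteDimensional K L' := IntermediateField.finiteDimensional_adjoin fun l hl =>
    (hsep l hl).isIntegral
  have hse : Algebra.IsSeparable K L' :=
    (IntermediateField.isSeparable_adjoin_iff_isSeparable K Ω).2 hsep
  have : IsScalarTower A L' Ω := .to₁₃₄ A K L' Ω
  have hfin : Module.Finite A (integralClosure A L') := IsIntegralClosure.finite A K L' _
  refine ⟨(integralClosure A L').toSubmodule.map (IsScalarTower.toAlgHom A L' Ω).toLinearMap,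
    (Module.Finite.iff_fg.1 hfin).map _, fun z hz hzi => ⟨⟨z, hz⟩, ?_, rfl⟩⟩
  exact (isIntegral_algHom_iff (IsScalarTower.toAlgHom A L' Ω) (algebraMap L' Ω).injective).1 hzi

open Polynomial in
-- Applying `rt` to the coefficients of `f` turns the root `l ^ N` into the root `l` and preserves
-- separability.
theorem isSeparable_of_root {F F' Ω : Type*} [Field F] [Field F'] [Field Ω] [Algebra F Ω]
    [Algebra F' Ω] {rt : Ω →+* Ω} {N : ℕ} (hrt : ∀ z, rt (z ^ N) = z) {f : F[X]} (hf : f.Separable)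
    (hcoeff : ∀ c ∈ f.coeffs, rt (algebraMap F Ω c) ∈ (algebraMap F' Ω).fieldRange) {l : Ω}
    (hl : aeval (l ^ N) f = 0) : IsSeparable F' l := by
  have h1 : (f.map (algebraMap F Ω)).map rt ∈ lifts (algebraMap F' Ω) := by
    rw [lifts_iff_coeff_lifts]
    intro n
    rw [coeff_map, coeff_map]
    by_cases hn : f.coeff n = 0
    · exact ⟨0, by rw [hn, map_zero, map_zero, map_zero]⟩
    · exact hcoeff _ (coeff_mem_coeffs hn)
  obtain ⟨h, hh⟩ := (mem_lifts _).1 h1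
  have h2 : h.Separable := by
    rw [← separable_map (algebraMap F' Ω), hh, separable_map, separable_map]
    exact hf
  refine h2.of_dvd (minpoly.dvd F' l ?_)
  have h3 := eval₂_at_apply (p := f.map (algebraMap F Ω)) rt (l ^ N)
  rw [hrt, eval_map, ← aeval_def, hl, map_zero] at h3
  rw [aeval_def, ← eval_map, hh, eval_map, h3]

/-- Finiteness of the integral closure of a polynomial ring in a finite extension of its fraction
field. -/
theorem exists_fg_of_mvPolynomial {κ L : Type*} [Field κ] [Field L] [Algebra κ L] {s : ℕ}
    [Algebra (MvPolynomial (Fin s) κ) L] [IsScalarTower κ (MvPolynomial (Fin s) κ) L]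
    [FaithfulSMul (MvPolynomial (Fin s) κ) L] {G : Set L} (hG : G.Finite)
    (hint : ∀ l ∈ G, IsIntegral (MvPolynomial (Fin s) κ) l)
    (hfrac : ∀ z : L, ∃ a ∈ Algebra.adjoin (MvPolynomial (Fin s) κ) G,
      ∃ b ∈ Algebra.adjoin (MvPolynomial (Fin s) κ) G, a / b = z) :
    Module.Finite (MvPolynomial (Fin s) κ) (integralClosure (MvPolynomial (Fin s) κ) L) := by
  let P := MvPolynomial (Fin s) κ
  let Ω := AlgebraicClosure L
  have : IsScalarTower κ P Ω := .to₁₂₄ κ P L Ω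
  have : FaithfulSMul P Ω := FaithfulSMul.trans P L Ω
  let F := FractionRing P
  let := FractionRing.liftAlgebra P Ω
  have : IsScalarTower P F Ω := FractionRing.isScalarTower_liftAlgebra P Ω
  -- In characteristic zero `q = 1`, and `rt` below is the identity. In general the purely
  -- inseparable part is absorbed by replacing the polynomial ring by `P'`, over whose fraction
  -- field all generators are separable.
  obtain ⟨q, hq⟩ := ExpChar.exists F
  have : ExpChar Ω q := expChar_of_injective_algebraMap (algebraMap F Ω).injective q
  have : PerfectRing Ω q := PerfectField.toPerfectRing q
  let G' : Set Ω := algebraMap L Ω '' G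
  have hGfin : G'.Finite := hG.image _
  have hGint : ∀ l ∈ G', IsIntegral F l := by
    rintro _ ⟨b, hb, rfl⟩
    exact ((hint b hb).map (IsScalarTower.toAlgHom P L Ω)).tower_top
  obtain ⟨e, he⟩ := exists_separable_pow_expChar_pow F q hGfin hGint
  choose! f hfsep hf using he
  let rt : Ω →+* Ω := (iterateFrobeniusEquiv Ω q e).symm
  have hrt : ∀ z, rt z ^ q ^ e = z := fun z => by
    rw [← iterateFrobenius_def, ← iterateFrobeniusEquiv_apply]
    exact (iterateFrobeniusEquiv Ω q e).apply_symm_apply z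
  have hrt' : ∀ z, rt (z ^ q ^ e) = z := fun z => by
    rw [← iterateFrobenius_def, ← iterateFrobeniusEquiv_apply]
    exact (iterateFrobeniusEquiv Ω q e).symm_apply_apply z
  choose num den hden hnd using fun c : F => IsFractionRing.div_surjective P c
  let C : Set F := ⋃ l ∈ G', ((f l).coeffs : Set F)
  have hC : C.Finite := hGfin.biUnion fun l _ => (f l).coeffs.finite_toSet
  obtain ⟨P', i0, i1, i2, htower, hfin, hfaith, hdom, hclosed, hroot⟩ :=
    exists_finite_isIntegrallyClosed_root rt
    (pow_ne_zero e (expChar_pos F q).ne') hrt ((hC.image num).union (hC.image den))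
  have hnoeth : IsNoetherianRing P' := IsNoetherianRing.of_finite P P'
  let := FractionRing.liftAlgebra P' Ω
  have : IsScalarTower P' (FractionRing P') Ω := FractionRing.isScalarTower_liftAlgebra P' Ω
  have hrange : ∀ u : P, rt (algebraMap P Ω u) ∈ (algebraMap P' Ω).range →
      rt (algebraMap P Ω u) ∈ (algebraMap (FractionRing P') Ω).fieldRange := by
    rintro u ⟨v, hv⟩
    exact ⟨algebraMap P' _ v, by rw [← IsScalarTower.algebraMap_apply, hv]⟩
  have hCroot : ∀ c ∈ C, rt (algebraMap F Ω c) ∈ (algebraMap (FractionRing P') Ω).fieldRange :=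
    fun c hc => by
    rw [← hnd c, map_div₀, map_div₀, ← IsScalarTower.algebraMap_apply,
      ← IsScalarTower.algebraMap_apply]
    exact div_mem (hrange _ (hroot _ (Or.inl ⟨c, hc, rfl⟩)))
      (hrange _ (hroot _ (Or.inr ⟨c, hc, rfl⟩)))
  obtain ⟨Z, hZ, hZmem⟩ := exists_fg_of_separable (A := P') (K := FractionRing P') hGfin fun l hl =>
    isSeparable_of_root hrt' (hfsep l hl) (fun c hc => hCroot c (Set.mem_biUnion hl hc)) (hf l hl)
  have hadj : ∀ b ∈ Algebra.adjoin P G,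
      algebraMap L Ω b ∈ IntermediateField.adjoin (FractionRing P') G' := fun b hb => by
    induction hb using Algebra.adjoin_induction with
    | mem x hx => exact IntermediateField.subset_adjoin _ _ ⟨x, hx, rfl⟩
    | algebraMap a =>
      rw [← IsScalarTower.algebraMap_apply, IsScalarTower.algebraMap_apply P P' Ω,
        IsScalarTower.algebraMap_apply P' (FractionRing P') Ω]
      exact IntermediateField.algebraMap_mem _ _
    | add x y _ _ hx hy => rw [map_add]; exact add_mem hx hy
    | mul x y _ _ hx hy => rw [map_mul]; exact mul_mem hx hy
  have hZ' : (Z.restrictScalars P).FG := by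
    have h1 : Module.Finite P' Z := Module.Finite.iff_fg.2 hZ
    exact Module.Finite.iff_fg.1 (Module.Finite.trans (R := P) P' Z)
  have hZn : IsNoetherian P (Z.restrictScalars P) := isNoetherian_of_fg_of_noetherian _ hZ'
  let j : integralClosure P L →ₗ[P] Z.restrictScalars P :=
    ((IsScalarTower.toAlgHom P L Ω).toLinearMap ∘ₗ (integralClosure P L).val.toLinearMap).codRestrict
      _ fun z => by
        refine hZmem _ ?_ ((z.2.map (IsScalarTower.toAlgHom P L Ω)).tower_top)
        obtain ⟨a, ha, b, hb, hab⟩ := hfrac z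
        change algebraMap L Ω z ∈ _
        rw [← hab, map_div₀]
        exact div_mem (hadj a ha) (hadj b hb)
  refine Module.Finite.of_injective j fun x y hxy => Subtype.ext ((algebraMap L Ω).injective ?_)
  exact congrArg Subtype.val hxy

/-- Domains of finite type over a field have finite integral closure in their fraction field. -/
theorem integralClosure_finite_of_finiteType (κ B L : Type*) [Field κ] [CommRing B] [IsDomain B]
    [Algebra κ B] [Algebra.FiniteType κ B] [Field L] [Algebra B L] [IsFractionRing B L] :
    Module.Finite B (integralClosure B L) := by
  obtain ⟨s, g, hg, hgfin⟩ := exists_finite_inj_algHom_of_fg κ B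
  let P := MvPolynomial (Fin s) κ
  let := g.toAlgebra
  have hPB : Module.Finite P B := hgfin
  have : IsScalarTower κ P B := IsScalarTower.of_algebraMap_eq fun a => (g.commutes a).symm
  let := ((algebraMap B L).comp (algebraMap P B)).toAlgebra
  have : IsScalarTower P B L := IsScalarTower.of_algebraMap_eq fun _ => rfl
  let := ((algebraMap B L).comp (algebraMap κ B)).toAlgebra
  have : IsScalarTower κ B L := IsScalarTower.of_algebraMap_eq fun _ => rfl
  have : IsScalarTower κ P L := .to₁₂₄ κ P B L
  have : FaithfulSMul P L := by
    rw [faithfulSMul_iff_algebraMap_injective]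
    exact (IsFractionRing.injective B L).comp hg
  obtain ⟨G0, hG0⟩ := hPB.fg_top
  have hadj : ∀ b : B, algebraMap B L b ∈ Algebra.adjoin P (algebraMap B L '' G0) := fun b => by
    have hb : b ∈ Submodule.span P (G0 : Set B) := hG0 ▸ Submodule.mem_top
    induction hb using Submodule.span_induction with
    | mem x hx => exact Algebra.subset_adjoin ⟨x, hx, rfl⟩
    | zero => rw [map_zero]; exact zero_mem _
    | add x y _ _ hx hy => rw [map_add]; exact add_mem hx hy
    | smul a x _ hx => 
      rw [← IsScalarTower.coe_toAlgHom' P B L, map_smul]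
      exact Subalgebra.smul_mem _ hx a
  have hfin : Module.Finite P (integralClosure P L) := by
    refine exists_fg_of_mvPolynomial (G0.finite_toSet.image (algebraMap B L)) ?_ fun z => ?_
    · rintro _ ⟨b, -, rfl⟩
      exact (Algebra.IsIntegral.isIntegral (R := P) b).map (IsScalarTower.toAlgHom P B L)
    · obtain ⟨a, b, -, h⟩ := IsFractionRing.div_surjective B z
      exact ⟨_, hadj a, _, hadj b, h⟩
  have : IsNoetherianRing P := inferInstance
  have : IsNoetherian P (integralClosure P L) := isNoetherian_of_isNoetherianRing_of_finite P _
  let j : integralClosure B L →ₗ[P] integralClosure P L :=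
    { toFun := fun z => ⟨z, isIntegral_trans (R := P) (A := B) _ z.2⟩
      map_add' := fun _ _ => rfl
      map_smul' := fun _ _ => rfl }
  have : Module.Finite P (integralClosure B L) :=
    Module.Finite.of_injective j fun x y hxy => Subtype.ext (congrArg Subtype.val hxy :)
  exact Module.Finite.of_restrictScalars_finite P B _

end FiniteType

/-! ### Adic completeness of power series rings. -/

section AdicComplete

variable {A : Type*} [CommRing A]

theorem isAdicComplete_span_singleton {x : A} (hsep : ∀ a : A, (∀ n : ℕ, x ^ n ∣ a) → a = 0)
    (hsum : ∀ g : ℕ → A, ∃ s, ∀ n : ℕ, x ^ n ∣ s - ∑ i ∈ Finset.range n, x ^ i * g i) :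
    IsAdicComplete (Ideal.span {x}) A := by
  have hmod : ∀ (n : ℕ) (a b : A), a ≡ b [SMOD (Ideal.span {x} ^ n • ⊤ : Submodule A A)] ↔
      x ^ n ∣ a - b := fun n a b => by
    rw [SModEq.sub_mem, smul_eq_mul, Ideal.mul_top, Ideal.span_singleton_pow,
      Ideal.mem_span_singleton]
  refine { haus' := fun a ha => hsep a fun n => ?_, prec' := fun f hf => ?_ }
  · simpa using (hmod _ _ _).1 (ha n)
  · have h1 : ∀ n, ∃ c, f (n + 1) - f n = x ^ n * c := fun n => by
      obtain ⟨c, hc⟩ := (hmod _ _ _).1 (hf (Nat.le_succ n))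
      exact ⟨-c, by rw [mul_neg, ← hc, neg_sub]⟩
    choose g hg using h1
    obtain ⟨s, hs⟩ := hsum g
    refine ⟨s + f 0, fun n => (hmod _ _ _).2 ?_⟩
    have h2 := Finset.sum_range_sub f n
    simp only [hg] at h2
    have h3 := (dvd_neg (a := x ^ n)).2 (hs n)
    rw [h2] at h3
    convert h3 using 1
    ring

theorem pow_dvd_self_iff_eq_zero {x : A} [IsAdicComplete (Ideal.span {x}) A] {a : A}
    (ha : ∀ n : ℕ, x ^ n ∣ a) : a = 0 := by
  refine IsHausdorff.haus' (I := Ideal.span {x}) a fun n => ?_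
  rw [SModEq.sub_mem, smul_eq_mul, Ideal.mul_top, Ideal.span_singleton_pow,
    Ideal.mem_span_singleton, sub_zero]
  exact ha n

variable {σ : Type*}

theorem MvPowerSeries.exists_coeff_eq (g : (σ →₀ ℕ) → A) :
    ∃ f : MvPowerSeries σ A, ∀ ν, MvPowerSeries.coeff ν f = g ν :=
  ⟨fun ν => g ν, fun _ => rfl⟩

theorem MvPowerSeries.C_dvd_iff {x : A} {f : MvPowerSeries σ A} :
    MvPowerSeries.C x ∣ f ↔ ∀ ν, x ∣ MvPowerSeries.coeff ν f := by
  refine ⟨?_, fun h => ?_⟩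
  · rintro ⟨g, rfl⟩ ν
    rw [MvPowerSeries.coeff_C_mul]
    exact dvd_mul_right _ _
  · choose g hg using h
    obtain ⟨G, hG⟩ := MvPowerSeries.exists_coeff_eq g
    exact ⟨G, MvPowerSeries.ext fun ν => by rw [MvPowerSeries.coeff_C_mul, hg, hG]⟩

theorem MvPowerSeries.isAdicComplete_C (x : A) [IsAdicComplete (Ideal.span {x}) A] :
    IsAdicComplete (Ideal.span {(MvPowerSeries.C x : MvPowerSeries σ A)}) (MvPowerSeries σ A) := by
  refine isAdicComplete_span_singleton (fun f hf => ?_) fun g => ?_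
  · refine MvPowerSeries.ext fun ν => pow_dvd_self_iff_eq_zero (x := x) fun n => ?_
    have := hf n
    rw [← map_pow, MvPowerSeries.C_dvd_iff] at this
    exact this ν
  · choose s hs using fun ν => exists_adic_sum x fun i => MvPowerSeries.coeff ν (g i)
    obtain ⟨S, hS⟩ := MvPowerSeries.exists_coeff_eq s
    refine ⟨S, fun n => ?_⟩
    rw [← map_pow, MvPowerSeries.C_dvd_iff]
    intro ν
    rw [map_sub, map_sum, hS]
    simp only [← map_pow, MvPowerSeries.coeff_C_mul]
    exact hs ν n

theorem MvPowerSeries.isAdicComplete_X (j : σ) :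
    IsAdicComplete (Ideal.span {(MvPowerSeries.X j : MvPowerSeries σ A)}) (MvPowerSeries σ A) := by
  refine isAdicComplete_span_singleton (fun f hf => ?_) fun g => ?_
  · exact MvPowerSeries.ext fun ν => MvPowerSeries.X_pow_dvd_iff.1 (hf (ν j + 1)) ν (Nat.lt_succ_self _)
  -- Terms of index beyond `ν j` do not contribute to the coefficient at `ν`, so the infinite sum is
  -- finite in each degree.
  · obtain ⟨S, hS⟩ := MvPowerSeries.exists_coeff_eq fun ν : σ →₀ ℕ =>
      ∑ i ∈ Finset.range (ν j + 1), MvPowerSeries.coeff ν (MvPowerSeries.X j ^ i * g i)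
    refine ⟨S, fun n => ?_⟩
    rw [MvPowerSeries.X_pow_dvd_iff]
    intro ν hν
    rw [map_sub, map_sum, sub_eq_zero, hS]
    refine Finset.sum_subset (Finset.range_mono hν) fun i _ hi => ?_
    exact MvPowerSeries.X_pow_dvd_iff.1 (dvd_mul_right _ _) ν (by simpa using hi)

/-- No continuity of `ψ` is assumed. Assigning to every nonzero exponent one variable that occurs in
it writes `f` minus its constant term as a finite sum of multiples of the variables. -/
theorem MvPowerSeries.map_eq_of_map_X_eq_zero [Fintype σ] {B : Type*} [CommRing B]
    (ψ : MvPowerSeries σ A →+* B) (hψ : ∀ j, ψ (MvPowerSeries.X j) = 0) (f : MvPowerSeries σ A) :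
    ψ f = ψ (MvPowerSeries.C (MvPowerSeries.constantCoeff f)) := by
  classical
  have hne : ∀ ν : σ →₀ ℕ, ∃ j : Option σ, (ν = 0 → j = none) ∧ (ν ≠ 0 → ∃ i, j = some i ∧ ν i ≠ 0) :=
    fun ν => by
    by_cases hν : ν = 0
    · exact ⟨none, fun _ => rfl, fun h => (h hν).elim⟩
    · obtain ⟨i, hi⟩ := Finsupp.ne_iff.1 hν
      exact ⟨some i, fun h => (hν h).elim, fun _ => ⟨i, rfl, hi⟩⟩
  choose c hc0 hc using hne
  let h : σ → MvPowerSeries σ A := fun i ν => if c ν = some i then MvPowerSeries.coeff ν f else 0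
  have hh : ∀ i ν, MvPowerSeries.coeff ν (h i) = if c ν = some i then MvPowerSeries.coeff ν f else 0 :=
    fun _ _ => rfl
  have hsum : f = MvPowerSeries.C (MvPowerSeries.constantCoeff f) + ∑ i, h i := by
    refine MvPowerSeries.ext fun ν => ?_
    rw [map_add, map_sum, MvPowerSeries.coeff_C]
    simp only [hh]
    by_cases hν : ν = 0
    · simp [hν, hc0 0 rfl]
    · obtain ⟨i, hi, -⟩ := hc ν hν
      simp [hν, hi]
  have hzero : ∀ i, ψ (h i) = 0 := fun i => by
    have : MvPowerSeries.X i ∣ h i := by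
      rw [MvPowerSeries.X_dvd_iff]
      intro ν hν
      rw [hh, if_neg]
      intro hcν
      have hν0 : ν ≠ 0 := fun h0 => by simp [hc0 ν h0] at hcν
      obtain ⟨j, hj, hj'⟩ := hc ν hν0
      rw [hj, Option.some.injEq] at hcν
      exact hj' (hcν ▸ hν)
    obtain ⟨g, hg⟩ := this
    rw [hg, map_mul, hψ, zero_mul]
  conv_lhs => rw [hsum]
  rw [map_add, map_sum, Finset.sum_eq_zero fun i _ => hzero i, add_zero]

end AdicComplete

/-! ### The Tate algebra over `R`: adic completeness and the Noetherian property. -/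

section Tate

variable {k : Type*} [NormedField k] [IsUltrametricDist k]

theorem ValRing.norm_le_one (c : ValRing k) : ‖(c : k)‖ ≤ 1 := c.2

theorem ValRing.mem_iff {c : k} : c ∈ ValRing k ↔ ‖c‖ ≤ 1 := Iff.rfl

theorem ValRing.dvd_iff {c d : ValRing k} : c ∣ d ↔ ‖(d : k)‖ ≤ ‖(c : k)‖ := by
  refine ⟨?_, fun h => ?_⟩
  · rintro ⟨e, rfl⟩
    rw [Subring.coe_mul, norm_mul]
    exact mul_le_of_le_one_right (norm_nonneg _) (norm_le_one e)
  · by_cases hc : (c : k) = 0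
    · rw [hc, norm_zero] at h
      have hd : d = 0 := Subtype.ext (norm_le_zero_iff.1 h)
      rw [hd]
      exact dvd_zero _
    · refine ⟨⟨d / c, ?_⟩, Subtype.ext ?_⟩
      · rw [mem_iff, norm_div]
        exact div_le_one_of_le₀ h (norm_nonneg _)
      · exact (mul_div_cancel₀ _ hc).symm

theorem ValRing.isUnit_iff {c : ValRing k} : IsUnit c ↔ ‖(c : k)‖ = 1 := by
  rw [isUnit_iff_dvd_one, dvd_iff]
  simp only [OneMemClass.coe_one, norm_one]
  exact ⟨fun h => le_antisymm (norm_le_one c) h, fun h => h.ge⟩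

theorem mem_tate_iff {m : ℕ} {f : MvPowerSeries (Fin m) (ValRing k)} :
    f ∈ tate k m ↔ ∀ ε > 0, {ν | ε ≤ ‖((MvPowerSeries.coeff ν f : ValRing k) : k)‖}.Finite := by
  change Filter.Tendsto _ _ _ ↔ _
  rw [Metric.tendsto_nhds]
  simp only [Filter.eventually_cofinite, dist_zero_right, norm_norm, not_lt]

theorem tate.C_pow_dvd_iff {m : ℕ} {ϖ : ValRing k} (hϖ : ϖ ≠ 0) {f : tate k m} :
    algebraMap (ValRing k) (tate k m) ϖ ∣ f ↔
      ∀ ν, ϖ ∣ MvPowerSeries.coeff ν (f : MvPowerSeries (Fin m) (ValRing k)) := by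
  refine ⟨?_, fun h => ?_⟩
  · rintro ⟨g, rfl⟩ ν
    rw [← Algebra.smul_def]
    exact dvd_mul_right _ _
  · have hϖ' : 0 < ‖(ϖ : k)‖ := norm_pos_iff.2 fun h => hϖ (Subtype.ext h)
    choose g hg using h
    refine ⟨⟨fun ν => g ν, mem_tate_iff.2 fun ε hε => ?_⟩, Subtype.ext (MvPowerSeries.ext fun ν => ?_)⟩
    · refine (mem_tate_iff.1 f.2 (‖(ϖ : k)‖ * ε) (by positivity)).subset fun ν hν => ?_
      rw [Set.mem_ofPred_eq, hg, Subring.coe_mul, norm_mul]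
      exact mul_le_mul_of_nonneg_left hν (norm_nonneg _)
    · rw [← Algebra.smul_def]
      exact hg ν

theorem ValRing.exists_adic_sum [CompleteSpace k] {ϖ : ValRing k} (hϖ : ‖(ϖ : k)‖ < 1)
    (a : ℕ → ValRing k) : ∃ s, ∀ n : ℕ, ϖ ^ n ∣ s - ∑ i ∈ Finset.range n, ϖ ^ i * a i := by
  have hsum : ∀ b : ℕ → ValRing k, Summable fun i => ((ϖ ^ i * b i : ValRing k) : k) := fun b => by
    refine Summable.of_norm_bounded (summable_geometric_of_lt_one (norm_nonneg _) hϖ) fun i => ?_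
    rw [Subring.coe_mul, Subring.coe_pow, norm_mul, norm_pow]
    exact mul_le_of_le_one_right (by positivity) (norm_le_one _)
  have hle : ∀ b : ℕ → ValRing k, ‖∑' i, ((ϖ ^ i * b i : ValRing k) : k)‖ ≤ 1 := fun b =>
    IsUltrametricDist.norm_tsum_le_of_forall_le_of_nonneg zero_le_one fun i => norm_le_one _
  refine ⟨⟨_, hle a⟩, fun n => ⟨⟨_, hle fun i => a (i + n)⟩, Subtype.ext ?_⟩⟩
  have h1 := (hsum a).sum_add_tsum_nat_add n
  have h2 : ∑' i, ((ϖ ^ (i + n) * a (i + n) : ValRing k) : k) =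
      (ϖ : k) ^ n * ∑' i, ((ϖ ^ i * a (i + n) : ValRing k) : k) := by
    rw [← tsum_mul_left]
    refine tsum_congr fun i => ?_
    push_cast
    ring
  rw [h2] at h1
  push_cast at h1 ⊢
  rw [← h1, add_sub_cancel_left]

theorem tate.isAdicComplete [CompleteSpace k] (m : ℕ) {ϖ : ValRing k} (hϖ0 : ϖ ≠ 0)
    (hϖ : ‖(ϖ : k)‖ < 1) :
    IsAdicComplete (Ideal.span {algebraMap (ValRing k) (tate k m) ϖ}) (tate k m) := by
  have hlim : Filter.Tendsto (fun n : ℕ => ‖(ϖ : k)‖ ^ n) Filter.atTop (nhds 0) :=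
    tendsto_pow_atTop_nhds_zero_of_lt_one (norm_nonneg _) hϖ
  refine isAdicComplete_span_singleton (fun f hf => ?_) fun g => ?_
  · refine Subtype.ext (MvPowerSeries.ext fun ν => Subtype.ext ?_)
    refine norm_le_zero_iff.1 (ge_of_tendsto' hlim fun n => ?_)
    have h1 := hf n
    rw [← map_pow, tate.C_pow_dvd_iff (pow_ne_zero n hϖ0)] at h1
    simpa using ValRing.dvd_iff.1 (h1 ν)
  · choose s hs using fun ν => ValRing.exists_adic_sum hϖ fun i =>
      MvPowerSeries.coeff ν (g i : MvPowerSeries (Fin m) (ValRing k))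
    have hcoeff : ∀ n ν, MvPowerSeries.coeff ν ((∑ i ∈ Finset.range n,
        algebraMap (ValRing k) (tate k m) ϖ ^ i * g i : tate k m) :
          MvPowerSeries (Fin m) (ValRing k)) =
        ∑ i ∈ Finset.range n, ϖ ^ i * MvPowerSeries.coeff ν (g i : MvPowerSeries (Fin m) (ValRing k)) :=
      fun n ν => by
      rw [AddSubmonoidClass.coe_finsetSum, map_sum]
      refine Finset.sum_congr rfl fun i _ => ?_
      rw [← map_pow, ← Algebra.smul_def]
      rfl
    -- The coefficientwise limit is restricted: up to an error of norm at most `‖ϖ‖ ^ n < ε`, its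
    -- coefficients are those of a partial sum, which is restricted.
    refine ⟨⟨fun ν => s ν, mem_tate_iff.2 fun ε hε => ?_⟩, fun n => ?_⟩
    · obtain ⟨n, hn⟩ := (hlim.eventually_lt_const hε).exists
      refine (mem_tate_iff.1 (∑ i ∈ Finset.range n,
        algebraMap (ValRing k) (tate k m) ϖ ^ i * g i : tate k m).2 ε hε).subset fun ν hν => ?_
      by_contra hcon
      rw [Set.mem_ofPred_eq, not_le, hcoeff] at hcon
      have h1 := ValRing.dvd_iff.1 (hs ν n)
      rw [Subring.coe_pow, norm_pow] at h1
      have h2 : ‖(s ν : k)‖ < ε := by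
        rw [← sub_add_cancel (s ν) (∑ i ∈ Finset.range n,
          ϖ ^ i * MvPowerSeries.coeff ν (g i : MvPowerSeries (Fin m) (ValRing k))), Subring.coe_add]
        exact (IsUltrametricDist.norm_add_le_max _ _).trans_lt (max_lt (h1.trans_lt hn) hcon)
      exact absurd hν (not_le.2 h2)
    · rw [← map_pow, tate.C_pow_dvd_iff (pow_ne_zero n hϖ0)]
      intro ν
      have h1 := hs ν n
      rw [← hcoeff] at h1
      exact h1

/-- The coordinate functions of the Tate algebra. -/
noncomputable def tate.X {m : ℕ} (i : Fin m) : tate k m :=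
  ⟨MvPowerSeries.X i, mem_tate_iff.2 fun ε hε => by
    classical
    refine (Set.finite_singleton (Finsupp.single i 1)).subset fun ν hν => ?_
    by_contra hcon
    rw [Set.mem_ofPred_eq, MvPowerSeries.coeff_X, if_neg (by simpa using hcon)] at hν
    exact absurd hν (by simpa using hε)⟩

theorem tate.coe_aeval_X {m : ℕ} (p : MvPolynomial (Fin m) (ValRing k)) :
    ((MvPolynomial.aeval (R := ValRing k) tate.X p : tate k m) :
      MvPowerSeries (Fin m) (ValRing k)) = p := by
  have h : (tate k m).val.comp (MvPolynomial.aeval (R := ValRing k) tate.X) =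
      MvPolynomial.coeToMvPowerSeries.algHom (ValRing k) := by
    refine MvPolynomial.algHom_ext fun i => ?_
    simp [tate.X]
  have h2 := DFunLike.congr_fun h p
  simpa using h2

/-- Modulo a uniformizer, restricted power series are polynomials. -/
theorem tate.exists_eq_aeval_add_mul [IsDiscreteValuationRing (ValRing k)] {m : ℕ} {ϖ : ValRing k}
    (hϖ : Irreducible ϖ) (f : tate k m) : ∃ (p : MvPolynomial (Fin m) (ValRing k)) (g : tate k m),
      f = MvPolynomial.aeval tate.X p + algebraMap (ValRing k) (tate k m) ϖ * g := by
  classical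
  have hfin := mem_tate_iff.1 f.2 1 one_pos
  let p : MvPolynomial (Fin m) (ValRing k) := ∑ ν ∈ hfin.toFinset, MvPolynomial.monomial ν
    (MvPowerSeries.coeff ν (f : MvPowerSeries (Fin m) (ValRing k)))
  have hp : ∀ ν, p.coeff ν = if ν ∈ hfin.toFinset then
      MvPowerSeries.coeff ν (f : MvPowerSeries (Fin m) (ValRing k)) else 0 := fun ν => by
    simp only [p, MvPolynomial.coeff_sum, MvPolynomial.coeff_monomial, Finset.sum_ite_eq']
  have h : algebraMap (ValRing k) (tate k m) ϖ ∣ f - MvPolynomial.aeval tate.X p := by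
    rw [tate.C_pow_dvd_iff hϖ.ne_zero]
    intro ν
    rw [AddSubgroupClass.coe_sub, tate.coe_aeval_X, map_sub, MvPolynomial.coeff_coe, hp]
    split_ifs with hν
    · rw [sub_self]
      exact dvd_zero _
    · rw [sub_zero, ← Ideal.mem_span_singleton, ← hϖ.maximalIdeal_eq, IsLocalRing.mem_maximalIdeal,
        mem_nonunits_iff, ValRing.isUnit_iff]
      intro h1
      exact hν (hfin.mem_toFinset.2 h1.ge)
  obtain ⟨g, hg⟩ := h
  exact ⟨p, g, by rw [← hg, add_sub_cancel]⟩

/-- Modulo `ϖ` the ring is a quotient of a polynomial ring over `R`, and it is `ϖ`-adically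
complete. -/
theorem tate.isNoetherianRing [CompleteSpace k] [IsDiscreteValuationRing (ValRing k)] (m : ℕ) :
    IsNoetherianRing (tate k m) := by
  obtain ⟨ϖ, hϖ⟩ := IsDiscreteValuationRing.exists_irreducible (ValRing k)
  have := tate.isAdicComplete m hϖ.ne_zero (lt_of_le_of_ne (ValRing.norm_le_one ϖ)
    fun h => hϖ.not_isUnit (ValRing.isUnit_iff.2 h))
  have : IsNoetherianRing (tate k m ⧸ Ideal.span {algebraMap (ValRing k) (tate k m) ϖ}) := by
    refine isNoetherianRing_of_surjective (MvPolynomial (Fin m) (ValRing k)) _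
      ((Ideal.Quotient.mk _).comp (MvPolynomial.aeval tate.X).toRingHom) fun z => ?_
    obtain ⟨f, rfl⟩ := Ideal.Quotient.mk_surjective z
    obtain ⟨p, g, hf⟩ := tate.exists_eq_aeval_add_mul hϖ f
    refine ⟨p, ?_⟩
    rw [RingHom.comp_apply, Ideal.Quotient.eq, ← neg_mem_iff, neg_sub]
    refine Ideal.mem_span_singleton.2 ⟨g, ?_⟩
    conv_lhs => rw [hf]
    exact add_sub_cancel_left _ _
  exact isNoetherianRing_of_adic (algebraMap (ValRing k) (tate k m) ϖ)

end Tate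

/-! ### The base case of the induction: image of finite type over a field. -/

section FiniteFractionField

variable {D : Type*} [CommRing D] {L : Type*} [Field L] [Algebra D L]

theorem integralClosure_fg_of_finiteType [IsNoetherianRing D] {κ : Type*} [Field κ] {E : Subalgebra D L}
    (hE : E.toSubmodule.FG) (hfrac : ∀ l : L, ∃ a ∈ E, ∃ b ∈ E, b ≠ 0 ∧ l * b = a) [Algebra κ E]
    [Algebra.FiniteType κ E] : (integralClosure D L).toSubmodule.FG := by
  have hfr : IsFractionRing E L := IsFractionRing.of_field E L fun z => by
    obtain ⟨a, ha, b, hb, hb0, h⟩ := hfrac z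
    exact ⟨⟨a, ha⟩, ⟨b, hb⟩, (div_eq_iff hb0).2 h.symm |>.symm⟩
  have h1 := integralClosure_finite_of_finiteType κ E L
  have h2 : Module.Finite D E := Module.Finite.iff_fg.2 hE
  have h3 : Module.Finite D (integralClosure E L) := Module.Finite.trans E _
  have h4 : (integralClosure D L).toSubmodule = LinearMap.range
      (((integralClosure E L).val.toLinearMap).restrictScalars D) := by
    ext z
    constructor
    · intro hz
      exact ⟨⟨z, (isIntegral_subalgebra_iff hE).2 hz⟩, rfl⟩
    · rintro ⟨w, rfl⟩
      exact (isIntegral_subalgebra_iff hE).1 w.2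
  rw [h4, LinearMap.range_eq_map]
  exact Module.Finite.fg_top.map _

/-- If the image of `D` in `L` is of finite type over a field, then the integral closure of `D` in
`L` is finite. -/
theorem integralClosure_fg_of_forall_exists_aeval [IsNoetherianRing D] {R : Type*} [CommRing R]
    [Algebra R D] (P : Ideal R) [P.IsMaximal] {ι : Type*} [Finite ι] (T : ι → D)
    (hP : ∀ c ∈ P, algebraMap D L (algebraMap R D c) = 0)
    (hT : ∀ d, ∃ p : MvPolynomial ι R, algebraMap D L d = algebraMap D L (MvPolynomial.aeval T p))
    (hL : IsFiniteFractionField D L) : (integralClosure D L).toSubmodule.FG := by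
  obtain ⟨E, hE, hfrac⟩ := hL
  let κ := R ⧸ P
  let : Field κ := Ideal.Quotient.field _
  let : Algebra κ E := (Ideal.Quotient.lift P ((algebraMap D E).comp (algebraMap R D)) fun c hc =>
    Subtype.ext (hP c hc)).toAlgebra
  have hκ : ∀ c : R, algebraMap κ E (Ideal.Quotient.mk P c) = algebraMap D E (algebraMap R D c) :=
    fun c => rfl
  have hD : ∀ d, algebraMap D E d ∈ Algebra.adjoin κ (Set.range fun i => algebraMap D E (T i)) := by
    intro d
    obtain ⟨p, hp⟩ := hT d
    have hp' : algebraMap D E d = algebraMap D E (MvPolynomial.aeval T p) := Subtype.ext hp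
    rw [hp']
    clear hp hp'
    induction p using MvPolynomial.induction_on with
    | C a =>
      rw [MvPolynomial.aeval_C, ← hκ]
      exact Subalgebra.algebraMap_mem _ _
    | add p q hp hq =>
      rw [map_add, map_add]
      exact add_mem hp hq
    | mul_X p i hp =>
      rw [map_mul, map_mul, MvPolynomial.aeval_X]
      exact mul_mem hp (Algebra.subset_adjoin ⟨i, rfl⟩)
  have hE' : Module.Finite D E := Module.Finite.iff_fg.2 hE
  obtain ⟨G, hG⟩ := hE'.fg_top
  have hft : Algebra.FiniteType κ E := by
    refine ⟨Subalgebra.fg_def.2 ⟨(Set.range fun i => algebraMap D E (T i)) ∪ G,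
      (Set.finite_range _).union G.finite_toSet, ?_⟩⟩
    rw [eq_top_iff]
    intro e _
    have he : e ∈ Submodule.span D (G : Set E) := hG ▸ Submodule.mem_top
    induction he using Submodule.span_induction with
    | mem x hx => exact Algebra.subset_adjoin (Or.inr hx)
    | zero => exact zero_mem _
    | add x y _ _ hx hy => exact add_mem (hx trivial) (hy trivial)
    | smul d x _ hx =>
      rw [Algebra.smul_def]
      exact mul_mem (Algebra.adjoin_mono Set.subset_union_left (hD d)) (hx trivial)
  exact integralClosure_fg_of_finiteType (κ := κ) hE hfrac

end FiniteFractionField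

/-! ### Integral closures of `R⟨T⟩⟦S⟧` in finite extensions of residue fields. -/

section MixedSeries

variable {k : Type*} [NormedField k] [IsUltrametricDist k]

theorem ValRing.norm_lt_one_of_irreducible {ϖ : ValRing k} (hϖ : Irreducible ϖ) : ‖(ϖ : k)‖ < 1 :=
  lt_of_le_of_ne (ValRing.norm_le_one ϖ) fun h => hϖ.not_isUnit (ValRing.isUnit_iff.2 h)

theorem MixedSeries.algebraMap_eq {m n : ℕ} (c : ValRing k) :
    algebraMap (ValRing k) (MixedSeries k m n) c =
      MvPowerSeries.C (algebraMap (ValRing k) (tate k m) c) :=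
  MvPowerSeries.algebraMap_apply

theorem MixedSeries.isAdicComplete [CompleteSpace k] {m n : ℕ} {ϖ : ValRing k} (hϖ : Irreducible ϖ) :
    IsAdicComplete (Ideal.span {algebraMap (ValRing k) (MixedSeries k m n) ϖ})
      (MixedSeries k m n) := by
  have := tate.isAdicComplete m hϖ.ne_zero (ValRing.norm_lt_one_of_irreducible hϖ)
  rw [MixedSeries.algebraMap_eq]
  exact MvPowerSeries.isAdicComplete_C _

variable [IsDiscreteValuationRing (ValRing k)]

theorem MixedSeries.exists_map_eq_map_aeval {m n : ℕ} {ϖ : ValRing k} (hϖ : Irreducible ϖ)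
    {B : Type*} [CommRing B] (ψ : MixedSeries k m n →+* B) (hϖ0 : ψ (algebraMap (ValRing k) _ ϖ) = 0)
    (hX : ∀ j, ψ (MvPowerSeries.X j) = 0) (d : MixedSeries k m n) :
    ∃ p : MvPolynomial (Fin m) (ValRing k),
      ψ d = ψ (MvPolynomial.aeval (fun i => MvPowerSeries.C (tate.X i)) p) := by
  rw [MvPowerSeries.map_eq_of_map_X_eq_zero ψ hX]
  obtain ⟨p, g, hf⟩ := tate.exists_eq_aeval_add_mul hϖ (MvPowerSeries.constantCoeff d)
  refine ⟨p, ?_⟩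
  rw [hf, map_add, map_add, map_mul, map_mul, ← MixedSeries.algebraMap_eq, hϖ0, zero_mul, add_zero]
  congr 1
  have h := MvPolynomial.map_aeval (tate.X (k := k) (m := m))
    (MvPowerSeries.C : tate k m →+* MixedSeries k m n) p
  rw [h, MvPolynomial.aeval_def, MvPolynomial.coe_eval₂Hom]
  congr 1
  exact RingHom.ext fun c => (MixedSeries.algebraMap_eq c).symm

variable [CompleteSpace k]

instance MixedSeries.isNoetherianRing (m n : ℕ) : IsNoetherianRing (MixedSeries k m n) :=
  have := tate.isNoetherianRing (k := k) m
  inferInstance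

/-- The integral closure of `R⟨T⟩⟦S⟧` in a finite extension of the fraction field of one of its
quotient domains is finite. -/
theorem MixedSeries.integralClosure_fg (m n : ℕ) {L : Type*} [Field L]
    [Algebra (MixedSeries k m n) L] (hL : IsFiniteFractionField (MixedSeries k m n) L) :
    (integralClosure (MixedSeries k m n) L).toSubmodule.FG := by
  obtain ⟨ϖ, hϖ⟩ := IsDiscreteValuationRing.exists_irreducible (ValRing k)
  -- Noetherian induction on the kernel, with `L` varying: the residue fields of the valuation rings
  -- have the element `x` in addition in their kernel.
  generalize hI : RingHom.ker (algebraMap (MixedSeries k m n) L) = I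
  induction I using WellFoundedGT.induction generalizing L with
  | ind I ih =>
    subst hI
    have hstep : ∀ x : MixedSeries k m n, IsAdicComplete (Ideal.span {x}) (MixedSeries k m n) →
        algebraMap _ L x ≠ 0 → (integralClosure (MixedSeries k m n) L).toSubmodule.FG := by
      intro x _ hx
      refine integralClosure_fg_of_adic hx hL fun V _ hfin hker hx0 => ?_
      refine ih _ (lt_of_le_of_ne hker fun h => hx ?_) hfin rfl
      rw [← RingHom.mem_ker, h]
      exact hx0
    by_cases hϖ0 : algebraMap (MixedSeries k m n) L (algebraMap (ValRing k) _ ϖ) = 0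
    · by_cases hX : ∀ j, algebraMap (MixedSeries k m n) L (MvPowerSeries.X j) = 0
      · refine integralClosure_fg_of_forall_exists_aeval (R := ValRing k)
          (IsLocalRing.maximalIdeal (ValRing k)) (fun i => MvPowerSeries.C (tate.X i)) (fun c hc => ?_)
          (MixedSeries.exists_map_eq_map_aeval hϖ _ hϖ0 hX) hL
        rw [hϖ.maximalIdeal_eq, Ideal.mem_span_singleton] at hc
        obtain ⟨b, rfl⟩ := hc
        rw [map_mul, map_mul, hϖ0, zero_mul]
      · obtain ⟨j, hj⟩ := not_forall.1 hX
        exact hstep _ (MvPowerSeries.isAdicComplete_X j) hj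
    · exact hstep _ (MixedSeries.isAdicComplete hϖ) hϖ0

end MixedSeries

/-! ### Discrete valuations centred at a given prime of a Noetherian ring. -/

section Domination

open IsLocalRing in
-- If the maximal ideal were not minimal over `g`, prime avoidance would give `a` in it outside all
-- minimal primes of `g`. A minimal prime of `a` has height at most one by Krull, yet contains `g`
-- and strictly contains a minimal prime of `g`, which would be zero.
theorem eq_maximalIdeal_of_forall_mem {E : Type*} [CommRing E] [IsDomain E] [IsNoetherianRing E]
    [IsLocalRing E] {g : E} (hg0 : g ≠ 0) (hg : g ∈ maximalIdeal E)
    (h : ∀ Q : Ideal E, Q.IsPrime → Q ≠ ⊥ → g ∈ Q) {Q : Ideal E} (hQ : Q.IsPrime) (hQ0 : Q ≠ ⊥) :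
    Q = maximalIdeal E := by
  have hgm : Ideal.span {g} ≤ maximalIdeal E := (Ideal.span_singleton_le_iff_mem _).2 hg
  suffices hmin : maximalIdeal E ∈ (Ideal.span {g}).minimalPrimes by
    exact le_antisymm (le_maximalIdeal hQ.ne_top)
      (hmin.2 ⟨hQ, (Ideal.span_singleton_le_iff_mem _).2 (h Q hQ hQ0)⟩ (le_maximalIdeal hQ.ne_top))
  by_contra hcon
  have hfin := (Ideal.span {g}).finite_minimalPrimes_of_isNoetherianRing E
  obtain ⟨a, ham, ha⟩ : ∃ a ∈ maximalIdeal E, ∀ p ∈ (Ideal.span {g}).minimalPrimes, a ∉ p := by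
    by_contra! hall
    have h1 : (maximalIdeal E : Set E) ⊆ ⋃ p ∈ (hfin.toFinset : Set (Ideal E)), (p : Set E) := by
      intro a ha
      obtain ⟨p, hp, hap⟩ := hall a ha
      exact Set.mem_biUnion (by simpa using hp) hap
    obtain ⟨p, hp, hle⟩ := (Ideal.subset_union_prime (f := id) ⊥ ⊥ fun p hp _ _ =>
      (hfin.mem_toFinset.1 hp).1.1).1 h1
    have hp' := hfin.mem_toFinset.1 hp
    have h2 : maximalIdeal E = p := le_antisymm hle (le_maximalIdeal hp'.1.1.ne_top)
    exact hcon (h2 ▸ hp')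
  have hinst : (maximalIdeal E).IsPrime := (maximalIdeal.isMaximal E).isPrime
  have ha0 : a ≠ 0 := by
    rintro rfl
    obtain ⟨p, hp, -⟩ := Ideal.exists_minimalPrimes_le hgm
    exact ha p hp p.zero_mem
  obtain ⟨q, hq, -⟩ := Ideal.exists_minimalPrimes_le
    ((Ideal.span_singleton_le_iff_mem (maximalIdeal E)).2 ham)
  have hqp : q.IsPrime := hq.1.1
  have haq : a ∈ q := hq.1.2 (Ideal.mem_span_singleton_self a)
  have hgq : g ∈ q := h q hq.1.1 fun h0 => ha0 (by rw [h0] at haq; exact haq)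
  obtain ⟨p, hp, hpq⟩ := Ideal.exists_minimalPrimes_le
    ((Ideal.span_singleton_le_iff_mem q).2 hgq)
  have hpp : p.IsPrime := hp.1.1
  have hlt : p < q := lt_of_le_of_ne hpq fun h0 => ha p hp (h0 ▸ haq)
  have hq1 := Ideal.height_le_one_of_isPrincipal_of_mem_minimalPrimes _ q hq
  have hp1 : p.height < 1 := Ideal.height_le_iff.1 hq1 p hpp hlt
  rw [Order.lt_one_iff, Ideal.height_eq_zero_iff, IsDomain.minimalPrimes_eq_singleton_bot] at hp1
  have hp0 : p = ⊥ := hp1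
  have hgp : g ∈ p := hp.1.2 (Ideal.mem_span_singleton_self g)
  rw [hp0] at hgp
  exact hg0 hgp

open IsLocalRing in
/-- A one-dimensional Noetherian local domain is dominated by a discrete valuation ring. -/
theorem exists_dvr_dominating {E K : Type*} [CommRing E] [IsDomain E] [IsNoetherianRing E]
    [IsLocalRing E] [Field K] [Algebra E K] [IsFractionRing E K] {g : E} (hg0 : g ≠ 0)
    (hg : g ∈ maximalIdeal E) (h : ∀ Q : Ideal E, Q.IsPrime → Q ≠ ⊥ → g ∈ Q) :
    ∃ V : ValuationSubring K, IsDiscreteValuationRing V ∧ (∀ a : E, algebraMap E K a ∈ V) ∧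
      ∀ a ∈ maximalIdeal E, V.valuation (algebraMap E K a) < 1 := by
  have hgK : algebraMap E K g ≠ 0 := fun h0 => hg0 (IsFractionRing.injective E K (by rw [h0, map_zero]))
  have hni : ¬ IsIntegral E (algebraMap E K g)⁻¹ := not_isIntegral_inv_of_mem_jacobson (by
    rw [jacobson_eq_maximalIdeal _ bot_ne_top]; exact hg) hgK
  -- The prime conductor of a multiple of `g⁻¹` contains `g`, so it is the maximal ideal. The
  -- detection theorem then has an element to which it applies, and some valuation ring must exist.
  obtain ⟨b, P, hP, hb⟩ := exists_mul_mem_iff_mem_prime (integralConductor_ne_top hni)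
  have hgP : g ∈ P := by
    rw [← hb, mem_integralConductor, Algebra.smul_def, map_mul, mul_comm, inv_mul_cancel_left₀ hgK]
    exact isIntegral_algebraMap
  have hPm : P = maximalIdeal E := eq_maximalIdeal_of_forall_mem hg0 hg h hP fun h0 => hg0 (by
    rw [h0] at hgP; exact hgP)
  obtain ⟨𝒱, -, h𝒱, hf⟩ := exists_finite_isEssentialDVR_of_isLocalRing (K := K) hg hg0
  obtain ⟨V, hV, -⟩ := hf (b • (algebraMap E K g)⁻¹) fun a => by
    rw [← hPm, ← hb, mem_integralConductor, mul_smul]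
  exact ⟨V, (h𝒱 V hV).1.dvr, fun a => (h𝒱 V hV).1.integral_mem _ isIntegral_algebraMap,
    (h𝒱 V hV).2⟩

universe v in
open IsLocalRing in
/-- A prime `M` of a Noetherian ring is the centre of a discrete valuation of a residue field in which
`g ∈ M` does not vanish, as soon as `g` is not nilpotent in the localization at `M`. -/
theorem exists_dvr_of_not_isNilpotent {C : Type v} [CommRing C] [IsNoetherianRing C]
    {M : Ideal C} (hM : M.IsPrime) {g : C} (hgM : g ∈ M)
    (hg : ∀ s ∉ M, ∀ n : ℕ, g ^ n * s ≠ 0) :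
    ∃ (K : Type v) (_ : Field K) (V : ValuationSubring K) (ψ : C →+* K),
      IsDiscreteValuationRing V ∧ (∀ c, ψ c ∈ V) ∧ (∀ c ∈ M, V.valuation (ψ c) < 1) ∧ ψ g ≠ 0 := by
  let CM := Localization.AtPrime M
  let γ : CM := algebraMap C CM g
  have hγ : ∀ n : ℕ, γ ^ n ≠ 0 := fun n h0 => by
    rw [← map_pow, IsLocalization.map_eq_zero_iff M.primeCompl] at h0
    obtain ⟨s, hs⟩ := h0
    exact hg s s.2 n (by rw [mul_comm]; exact hs)
  have hγm : γ ∈ maximalIdeal CM := by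
    rw [IsLocalization.AtPrime.to_map_mem_maximal_iff CM M]
    exact hgM
  -- Maximality of `P` among ideals avoiding the powers of `γ` forces every nonzero prime of the
  -- quotient to contain `γ`.
  obtain ⟨(P : Ideal CM), hP, hPmax⟩ := set_has_maximal_iff_noetherian.2
    (inferInstance : IsNoetherian CM CM) {I : Ideal CM | Disjoint (I : Set CM) (Submonoid.powers γ)}
    ⟨⊥, Set.disjoint_left.2 (by rintro _ h0 ⟨n, rfl⟩; exact hγ n h0)⟩
  have hPprime : P.IsPrime := Ideal.isPrime_of_maximally_disjoint P _ hP fun J hJ hJ' =>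
    hPmax J hJ' hJ
  let E := CM ⧸ P
  have hloc : IsLocalRing E := IsLocalRing.of_surjective' (Ideal.Quotient.mk P)
    Ideal.Quotient.mk_surjective
  have hlochom : IsLocalHom (Ideal.Quotient.mk P) := IsLocalHom.of_surjective _
    Ideal.Quotient.mk_surjective
  have hmk : ∀ c, Ideal.Quotient.mk P c ∈ maximalIdeal E ↔ c ∈ maximalIdeal CM := fun c => by
    rw [mem_maximalIdeal, mem_maximalIdeal, mem_nonunits_iff, mem_nonunits_iff, isUnit_map_iff]
  have hγP : γ ∉ P := fun h0 => Set.disjoint_left.1 hP h0 ⟨1, pow_one γ⟩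
  obtain ⟨V, hV, hV1, hV2⟩ := exists_dvr_dominating (E := E) (K := FractionRing E)
    (g := Ideal.Quotient.mk P γ) (fun h0 => hγP (Ideal.Quotient.eq_zero_iff_mem.1 h0))
    ((hmk γ).2 hγm) fun Q hQ hQ0 => by
      have hlt : P < Q.comap (Ideal.Quotient.mk P) := by
        refine lt_of_le_of_ne (fun c hc => ?_) fun h0 => hQ0 ?_
        · rw [Ideal.mem_comap, Ideal.Quotient.eq_zero_iff_mem.2 hc]
          exact Q.zero_mem
        · rw [← Ideal.map_comap_of_surjective _ Ideal.Quotient.mk_surjective Q, ← h0,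
            Ideal.map_quotient_self]
      by_contra hgQ
      refine hPmax _ (Set.disjoint_left.2 ?_) hlt
      rintro _ h0 ⟨n, rfl⟩
      have h1 : Ideal.Quotient.mk P γ ^ n ∈ Q := by
        rw [← map_pow]
        exact h0
      exact hgQ (hQ.mem_of_pow_mem n h1)
  refine ⟨FractionRing E, inferInstance, V,
    (algebraMap E (FractionRing E)).comp ((Ideal.Quotient.mk P).comp (algebraMap C CM)), hV,
    fun c => hV1 _, fun c hc => hV2 _ ((hmk _).2 ?_), fun h0 => hγP ?_⟩
  · rw [IsLocalization.AtPrime.to_map_mem_maximal_iff CM M]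
    exact hc
  · rw [← Ideal.Quotient.eq_zero_iff_mem]
    exact IsFractionRing.injective E (FractionRing E) (by rw [map_zero]; exact h0)

end Domination

/-! ### Separating nonintegral elements by discrete valuations. -/

section Separation

/-- If `f = p(h)` with `p` of degree at most `d`, multiplying by `f ^ d` gives `f ^ (d + 1) =
(reflected p)(f)`, a monic equation. -/
theorem isIntegral_of_mem_adjoin_inv {R B : Type*} [CommRing R] [CommRing B] [Algebra R B] {f h : B}
    (hfh : f * h = 1) (hf : f ∈ Algebra.adjoin R {h}) : IsIntegral R f := by
  rw [Algebra.adjoin_singleton_eq_range_aeval] at hf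
  obtain ⟨p, hp⟩ := hf
  replace hp : Polynomial.aeval h p = f := hp
  by_cases hB : Nontrivial B
  swap
  · have := not_nontrivial_iff_subsingleton.1 hB
    rw [Subsingleton.elim f 0]
    exact isIntegral_zero
  have : Nontrivial R := (algebraMap R B).domain_nontrivial
  let : Invertible h := ⟨f, hfh, by rw [mul_comm, hfh]⟩
  have h1 := Polynomial.eval₂_reflect_mul_pow (algebraMap R B) h p.natDegree p le_rfl
  rw [← Polynomial.aeval_def h p, hp] at h1
  have h2 : Polynomial.eval₂ (algebraMap R B) f (Polynomial.reflect p.natDegree p) =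
      f ^ (p.natDegree + 1) := by
    calc _ = Polynomial.eval₂ (algebraMap R B) f (Polynomial.reflect p.natDegree p) *
          (f * h) ^ p.natDegree := by rw [hfh, one_pow, mul_one]
      _ = (Polynomial.eval₂ (algebraMap R B) f (Polynomial.reflect p.natDegree p) *
          h ^ p.natDegree) * f ^ p.natDegree := by ring
      _ = f ^ (p.natDegree + 1) := by
        rw [pow_succ']
        exact congrArg (· * f ^ p.natDegree) h1
  refine ⟨Polynomial.X ^ (p.natDegree + 1) - Polynomial.reflect p.natDegree p,
    Polynomial.monic_X_pow_sub (Order.lt_succ_of_le (Polynomial.degree_le_of_natDegree_le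
      ((Polynomial.natDegree_reflect_le).trans (max_self _).le))), ?_⟩
  rw [Polynomial.eval₂_sub, Polynomial.eval₂_X_pow, h2, sub_self]

universe v in
/-- An element of `A = A₁[1/π]` which is not integral over `A₁` is separated from `A₁` by a discrete
valuation. -/
theorem exists_dvr_notMem_of_not_isIntegral {A₁ : Type*} {A : Type v} [CommRing A₁] [IsNoetherianRing A₁]
    [CommRing A] [Algebra A₁ A] {π : A₁} (hπu : IsUnit (algebraMap A₁ A π))
    (hA : ∀ a : A, ∃ (n : ℕ) (b : A₁), algebraMap A₁ A b = algebraMap A₁ A π ^ n * a) {f : A}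
    (hf : ¬ IsIntegral A₁ f) :
    ∃ (K : Type v) (_ : Field K) (V : ValuationSubring K) (ψ : A →+* K),
      IsDiscreteValuationRing V ∧ (∀ a, ψ (algebraMap A₁ A a) ∈ V) ∧
      (∀ a ∈ Ideal.jacobson (⊥ : Ideal A₁), V.valuation (ψ (algebraMap A₁ A a)) < 1) ∧ ψ f ∉ V := by
  let B := Localization.Away f
  let h : B := IsLocalization.Away.invSelf f
  have hfh : algebraMap A B f * h = 1 := IsLocalization.Away.mul_invSelf f
  let C := Algebra.adjoin A₁ {h}
  let hC : C := ⟨h, Algebra.self_mem_adjoin_singleton _ _⟩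
  have hnoeth : IsNoetherianRing C := by
    have : Algebra.FiniteType A₁ C := (Subalgebra.fg_iff_finiteType C).1
      (Subalgebra.fg_def.2 ⟨_, Set.finite_singleton h, rfl⟩)
    exact Algebra.FiniteType.isNoetherianRing A₁ C
  have hunit : ¬ IsUnit hC := by
    intro hu
    obtain ⟨w, hw⟩ := hu.exists_left_inv
    have hw' : (w : B) * h = 1 := congrArg Subtype.val hw
    have h1 : algebraMap A B f = w := by
      rw [← mul_one (algebraMap A B f), ← hw', mul_left_comm, hfh, mul_one]
    have h2 : IsIntegral A₁ (algebraMap A B f) := isIntegral_of_mem_adjoin_inv hfh (by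
      rw [h1]; exact w.2)
    obtain ⟨p, hp, hpe⟩ := h2
    rw [IsScalarTower.algebraMap_eq A₁ A B, ← Polynomial.hom_eval₂,
      IsLocalization.map_eq_zero_iff (Submonoid.powers f)] at hpe
    obtain ⟨⟨_, n, rfl⟩, hn⟩ := hpe
    refine hf ⟨Polynomial.X ^ n * p, (Polynomial.monic_X_pow n).mul hp, ?_⟩
    rw [Polynomial.eval₂_mul, Polynomial.eval₂_X_pow]
    exact hn
  obtain ⟨M, hM, hhM⟩ := exists_max_ideal_of_mem_nonunits hunit
  -- Since `h` vanishes modulo `M`, the field `C ⧸ M` is a quotient of `A₁`, and `M` lies over a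
  -- maximal ideal of `A₁`.
  have hjac : ∀ a ∈ Ideal.jacobson (⊥ : Ideal A₁), algebraMap A₁ C a ∈ M := by
    have hsurj : Function.Surjective ((Ideal.Quotient.mk M).comp (algebraMap A₁ C)) := by
      intro z
      obtain ⟨⟨c, hc⟩, rfl⟩ := Ideal.Quotient.mk_surjective z
      induction hc using Algebra.adjoin_induction with
      | mem x hx =>
        obtain rfl : x = h := hx
        exact ⟨0, by rw [map_zero]; exact (Ideal.Quotient.eq_zero_iff_mem.2 hhM).symm⟩
      | algebraMap r => exact ⟨r, rfl⟩
      | add x y hx hy ihx ihy =>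
        obtain ⟨a, ha⟩ := ihx
        obtain ⟨b, hb⟩ := ihy
        exact ⟨a + b, by rw [map_add, ha, hb, ← map_add]; rfl⟩
      | mul x y hx hy ihx ihy =>
        obtain ⟨a, ha⟩ := ihx
        obtain ⟨b, hb⟩ := ihy
        exact ⟨a * b, by rw [map_mul, ha, hb, ← map_mul]; rfl⟩
    let : Field (C ⧸ M) := Ideal.Quotient.field M
    have hmax : (RingHom.ker ((Ideal.Quotient.mk M).comp (algebraMap A₁ C))).IsMaximal :=
      RingHom.ker_isMaximal_of_surjective _ hsurj
    intro a ha
    have h1 := (sInf_le ⟨bot_le, hmax⟩ : Ideal.jacobson (⊥ : Ideal A₁) ≤ _) ha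
    exact Ideal.Quotient.eq_zero_iff_mem.1 h1
  -- Inverting `g = π / f` in `C` gives all of `A_f`, because `A = A₁[1/π]`. A homomorphism on `C`
  -- that does not kill `g` therefore extends to `A_f`.
  let g : C := algebraMap A₁ C π * hC
  have hgunit : IsUnit (g : B) := by
    refine IsUnit.mul ?_ (IsUnit.of_mul_eq_one_right _ hfh)
    have := hπu.map (algebraMap A B)
    rwa [← IsScalarTower.algebraMap_apply] at this
  obtain ⟨K, _, V, ψ, hV, hV1, hV2, hg⟩ := exists_dvr_of_not_isNilpotent hM.isPrime
    (M.mul_mem_left _ hhM : g ∈ M) fun s hs n h0 => hs (by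
      have h1 : (g : B) ^ n * s = 0 := congrArg Subtype.val h0
      rw [(hgunit.pow n).mul_right_eq_zero] at h1
      rw [show s = 0 from Subtype.ext h1]
      exact M.zero_mem)
  have hloc : IsLocalization.Away g B := by
    refine ⟨?_, fun z => ?_, fun {x y} hxy => ⟨1, by rw [Subtype.ext hxy]⟩⟩
    · rintro ⟨_, n, rfl⟩
      rw [map_pow]
      exact hgunit.pow n
    · obtain ⟨⟨a, ⟨_, n, rfl⟩⟩, hz⟩ := IsLocalization.surj (Submonoid.powers f) z
      obtain ⟨N, b, hb⟩ := hA a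
      have hz' : z * algebraMap A B f ^ n = algebraMap A B a := by
        rw [← map_pow]
        exact hz
      refine ⟨⟨algebraMap A₁ C b * hC ^ (N + n), ⟨_, N, rfl⟩⟩, ?_⟩
      have hb' : algebraMap A₁ B b = algebraMap A₁ B π ^ N * algebraMap A B a := by
        rw [IsScalarTower.algebraMap_apply A₁ A B, hb, map_mul, map_pow,
          ← IsScalarTower.algebraMap_apply]
      change z * (algebraMap A₁ B π * h) ^ N = algebraMap A₁ B b * h ^ (N + n)
      rw [hb', ← hz']
      calc _ = algebraMap A₁ B π ^ N * z * h ^ N * (1 : B) ^ n := by ring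
        _ = algebraMap A₁ B π ^ N * z * h ^ N * (algebraMap A B f * h) ^ n := by rw [hfh]
        _ = _ := by ring
  let Ψ : B →+* K := IsLocalization.Away.lift (S := B) g (g := ψ) (IsUnit.mk0 _ hg)
  have hΨ : ∀ c : C, Ψ c = ψ c := fun c => IsLocalization.Away.lift_eq g _ c
  have hΨ1 : ∀ a, Ψ (algebraMap A B (algebraMap A₁ A a)) = ψ (algebraMap A₁ C a) := fun a => by
    rw [← hΨ, ← IsScalarTower.algebraMap_apply]
    rfl
  refine ⟨K, inferInstance, V, Ψ.comp (algebraMap A B), hV, fun a => ?_, fun a ha => ?_, fun hfV => ?_⟩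
  · rw [RingHom.comp_apply, hΨ1]
    exact hV1 _
  · rw [RingHom.comp_apply, hΨ1]
    exact hV2 _ (hjac a ha)
  · have h1 := hV2 hC hhM
    have h2 : Ψ (algebraMap A B f) * ψ hC = 1 := by
      rw [← hΨ, ← map_mul, hfh, map_one]
    have h3 := mul_lt_one_of_nonneg_of_lt_one_right ((V.valuation_le_one_iff _).2 hfV) zero_le h1
    rw [RingHom.comp_apply, ← map_mul, h2, map_one] at h3
    exact lt_irrefl _ h3

end Separation

/-! ### Roots in adic rings and automatic boundedness. -/

section Henselian

theorem exists_pow_eq_one_add {D : Type*} [CommRing D] {x : D} [IsAdicComplete (Ideal.span {x}) D]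
    {n : ℕ} (hn : IsUnit (n : D)) (c : D) : ∃ r : D, r ^ n = 1 + x * c := by
  by_cases hn0 : n = 0
  · subst hn0
    rw [Nat.cast_zero, isUnit_zero_iff] at hn
    have := subsingleton_of_zero_eq_one hn
    exact ⟨1, Subsingleton.elim _ _⟩
  obtain ⟨r, hr, -⟩ := HenselianRing.is_henselian (I := Ideal.span {x})
    (Polynomial.X ^ n - Polynomial.C (1 + x * c)) (Polynomial.monic_X_pow_sub_C _ hn0) 1 (by
      rw [Polynomial.eval_sub, Polynomial.eval_pow, Polynomial.eval_X, Polynomial.eval_C, one_pow,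
        Ideal.mem_span_singleton]
      exact ⟨-c, by ring⟩) (by
      rw [Polynomial.derivative_sub, Polynomial.derivative_X_pow, Polynomial.derivative_C, sub_zero,
        Polynomial.eval_mul, Polynomial.eval_pow, Polynomial.eval_X, one_pow, mul_one,
        Polynomial.eval_C]
      exact hn.map _)
  refine ⟨r, ?_⟩
  rw [Polynomial.IsRoot.def, Polynomial.eval_sub, Polynomial.eval_pow, Polynomial.eval_X,
    Polynomial.eval_C, sub_eq_zero] at hr
  exact hr

/-- A homomorphism from an adic ring to a discretely valued field is automatically bounded. -/
theorem mem_of_isAdicComplete {D K : Type*} [CommRing D] [Field K] (V : ValuationSubring K)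
    [IsDiscreteValuationRing V] {x : D} [IsAdicComplete (Ideal.span {x}) D] {q : ℕ} (hq : 1 < q)
    (hqD : IsUnit (q : D)) (ψ : D →+* K) (hx0 : ψ x ≠ 0) (hx : V.valuation (ψ x) < 1) (d : D) :
    ψ d ∈ V := by
  by_contra hd
  have hd1 : 1 < V.valuation (ψ d) := not_le.1 fun h => hd ((V.valuation_le_one_iff _).1 h)
  have hd0 : ψ d ≠ 0 := fun h => hd (h ▸ V.zero_mem)
  obtain ⟨u, hu0, hu1, humax, hupow⟩ := exists_uniformizer V
  obtain ⟨e, he⟩ := hupow (ψ x) hx0 ((V.valuation_le_one_iff _).1 hx.le)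
  have hdu : 1 ≤ V.valuation (ψ d) * V.valuation u := by
    have h1 : V.valuation (ψ d)⁻¹ < 1 := by
      rw [map_inv₀]
      exact inv_lt_one_of_one_lt₀ hd1
    have h2 := humax _ h1
    rw [map_inv₀] at h2
    calc (1 : V.ValueGroup) = V.valuation (ψ d) * (V.valuation (ψ d))⁻¹ :=
          (mul_inv_cancel₀ ((Valuation.ne_zero_iff _).2 hd0)).symm
      _ ≤ _ := mul_le_mul_right h2 _
  -- The exponent `e + 1` lets the pole of `d` outweigh the zero of order `e` of `x`.
  have hval : 1 < V.valuation (ψ (x * d ^ (e + 1))) := by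
    have h1 : V.valuation (ψ (x * d ^ (e + 1))) =
        V.valuation (ψ d) * (V.valuation (ψ d) * V.valuation u) ^ e := by
      rw [map_mul, map_mul, map_pow, map_pow, he, mul_pow, pow_succ]
      ac_rfl
    rw [h1]
    exact one_lt_mul_of_lt_of_le hd1 (one_le_pow₀ hdu)
  set y := ψ (1 + x * d ^ (e + 1)) with hy
  have hyval : 1 < V.valuation y := by
    rw [hy, map_add, map_one, Valuation.map_add_eq_of_lt_right _ (by rwa [map_one])]
    exact hval
  have hy0 : y ≠ 0 := fun h => by
    rw [h, map_zero] at hyval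
    exact absurd hyval (not_lt.2 zero_le)
  obtain ⟨E, hE⟩ := hupow y⁻¹ (inv_ne_zero hy0) ((V.valuation_le_one_iff _).1 (by
    rw [map_inv₀]
    exact (inv_lt_one_of_one_lt₀ hyval).le))
  -- The element `y` has a pole of order `E`, but being a `q ^ (E + 1)`-th power it would have one
  -- of order at least `q ^ (E + 1) > E`.
  obtain ⟨r, hr⟩ := exists_pow_eq_one_add (x := x) (n := q ^ (E + 1)) (by
    rw [Nat.cast_pow]
    exact hqD.pow _) (d ^ (e + 1))
  have hn : E < q ^ (E + 1) := (Nat.lt_succ_self E).trans (Nat.lt_pow_self hq)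
  have hry : ψ r ^ q ^ (E + 1) = y := by rw [← map_pow, hr]
  have hr1 : 1 < V.valuation (ψ r) := by
    by_contra hcon
    refine absurd hyval (not_lt.2 ?_)
    rw [← hry, map_pow]
    exact pow_le_one₀ zero_le (not_lt.1 hcon)
  have hru : V.valuation (ψ r)⁻¹ ≤ V.valuation u := humax _ (by
    rw [map_inv₀]
    exact inv_lt_one_of_one_lt₀ hr1)
  have h3 : V.valuation u ^ E ≤ V.valuation u ^ q ^ (E + 1) := by
    rw [← hE, ← hry, ← inv_pow, map_pow]
    exact pow_le_pow_left₀ zero_le hru _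
  exact absurd h3 (not_le.2 (pow_lt_pow_right_of_lt_one₀
    (zero_lt_iff.2 ((Valuation.ne_zero_iff _).2 hu0)) hu1 hn))

end Henselian

/-! ### Integral closure in a reduced finite algebra over `D[1/x]`. -/

section Generic

variable {D : Type*} [CommRing D] {A : Type*} [CommRing A] [Algebra D A]

theorem mem_jacobson_of_isIntegral {A₁ : Type*} [CommRing A₁] [Algebra D A₁] [Algebra.IsIntegral D A₁]
    {x : D} (hx : x ∈ Ideal.jacobson (⊥ : Ideal D)) :
    algebraMap D A₁ x ∈ Ideal.jacobson (⊥ : Ideal A₁) := by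
  rw [Ideal.jacobson, Ideal.mem_sInf]
  rintro N ⟨-, hN⟩
  have h1 := Ideal.isMaximal_comap_of_isIntegral_of_isMaximal (R := D) N
  exact (sInf_le ⟨bot_le, h1⟩ : Ideal.jacobson (⊥ : Ideal D) ≤ _) hx

/-- If `A` is `A₁[1/x]` with `A₁` finite over `D`, then the image in `A` of a ring which is complete
for the powers of `x` is integral over `D`. -/
theorem isIntegral_map_of_isAdicComplete [IsNoetherianRing D] {x : D}
    (hx : x ∈ Ideal.jacobson (⊥ : Ideal D)) (hxu : IsUnit (algebraMap D A x)) {A₁ : Subalgebra D A}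
    (hA₁ : A₁.toSubmodule.FG) (hA : ∀ a : A, ∃ n : ℕ, x ^ n • a ∈ A₁) {D' : Type*} [CommRing D']
    {x' : D'} [IsAdicComplete (Ideal.span {x'}) D'] {q : ℕ} (hq : 1 < q) (hqD : IsUnit (q : D'))
    (ρ : D' →+* A) (hρ : ρ x' = algebraMap D A x) (d : D') : IsIntegral D (ρ d) := by
  have hfin : Module.Finite D A₁ := Module.Finite.iff_fg.2 hA₁
  have hnoeth : IsNoetherianRing A₁ := IsNoetherianRing.of_finite D A₁
  suffices IsIntegral A₁ (ρ d) from isIntegral_trans _ this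
  by_contra hd
  obtain ⟨K, _, V, ψ, hV, hV1, hV2, hψ⟩ := exists_dvr_notMem_of_not_isIntegral
    (π := algebraMap D A₁ x) (by rwa [← IsScalarTower.algebraMap_apply]) (fun a => by
      obtain ⟨n, hn⟩ := hA a
      refine ⟨n, ⟨_, hn⟩, ?_⟩
      rw [← IsScalarTower.algebraMap_apply, ← map_pow, ← Algebra.smul_def]
      rfl) hd
  have hψx : ψ (ρ x') = ψ (algebraMap A₁ A (algebraMap D A₁ x)) := by
    rw [hρ, ← IsScalarTower.algebraMap_apply]
  refine hψ (mem_of_isAdicComplete V hq hqD (ψ.comp ρ) (x := x') ?_ ?_ d)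
  · rw [RingHom.comp_apply, hρ]
    exact (hxu.map ψ).ne_zero
  · rw [RingHom.comp_apply, hψx]
    exact hV2 _ (mem_jacobson_of_isIntegral hx)

theorem isLocalization_away_of_forall_exists_smul_mem {x : D} (hxu : IsUnit (algebraMap D A x))
    {A₁ : Subalgebra D A} (hA : ∀ a : A, ∃ n : ℕ, x ^ n • a ∈ A₁) :
    IsLocalization.Away (algebraMap D A₁ x) A := by
  refine ⟨?_, fun z => ?_, fun {x y} hxy => ⟨1, by rw [Subtype.ext hxy]⟩⟩
  · rintro ⟨_, n, rfl⟩
    rw [map_pow, ← IsScalarTower.algebraMap_apply]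
    exact hxu.pow n
  · obtain ⟨n, hn⟩ := hA z
    refine ⟨⟨⟨_, hn⟩, ⟨_, n, rfl⟩⟩, ?_⟩
    rw [map_pow, ← IsScalarTower.algebraMap_apply, ← map_pow, mul_comm, ← Algebra.smul_def]
    rfl

universe v in
/-- Finiteness of the integral closure in a reduced ring, from finiteness of integral closures in
fields. -/
theorem integralClosure_fg_of_isReduced {D : Type*} [CommRing D] [IsNoetherianRing D] {A : Type v}
    [CommRing A] [Algebra D A] [IsReduced A] {x : D} (hxu : IsUnit (algebraMap D A x))
    {A₁ : Subalgebra D A} (hA₁ : A₁.toSubmodule.FG) (hA : ∀ a : A, ∃ n : ℕ, x ^ n • a ∈ A₁)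
    (H : ∀ (L : Type v) [Field L] [Algebra D L], IsFiniteFractionField D L →
      (integralClosure D L).toSubmodule.FG) : (integralClosure D A).toSubmodule.FG := by
  have hfin : Module.Finite D A₁ := Module.Finite.iff_fg.2 hA₁
  have hnoeth1 : IsNoetherianRing A₁ := IsNoetherianRing.of_finite D A₁
  have hloc := isLocalization_away_of_forall_exists_smul_mem hxu hA
  have hnoeth : IsNoetherianRing A :=
    IsLocalization.isNoetherianRing (Submonoid.powers (algebraMap D A₁ x)) A hnoeth1
  have hmin : (minimalPrimes A).Finite := minimalPrimes.finite_of_isNoetherianRing A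
  have := hmin.to_subtype
  have hprime : ∀ p : minimalPrimes A, (p : Ideal A).IsPrime := fun p => p.2.1.1
  let L : minimalPrimes A → Type v := fun p => FractionRing (A ⧸ (p : Ideal A))
  have hFG : ∀ p, Module.Finite D (integralClosure D (L p)) := fun p => by
    refine Module.Finite.iff_fg.2 (H (L p) ?_)
    let μ : A →ₐ[D] L p := IsScalarTower.toAlgHom D A (L p)
    refine ⟨A₁.map μ, ?_, fun l => ?_⟩
    · rw [Subalgebra.map_toSubmodule]
      exact hA₁.map _
    · obtain ⟨a', b', hb', rfl⟩ := IsFractionRing.div_surjective (A ⧸ (p : Ideal A)) l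
      obtain ⟨a, rfl⟩ := Ideal.Quotient.mk_surjective a'
      obtain ⟨b, rfl⟩ := Ideal.Quotient.mk_surjective b'
      obtain ⟨i, hi⟩ := hA a
      obtain ⟨j, hj⟩ := hA b
      have hi' : x ^ (i + j) • a ∈ A₁ := by
        rw [add_comm, pow_add, mul_smul]
        exact A₁.smul_mem hi _
      have hj' : x ^ (i + j) • b ∈ A₁ := by
        rw [pow_add, mul_smul]
        exact A₁.smul_mem hj _
      have hxL : algebraMap D (L p) x ≠ 0 := by
        rw [IsScalarTower.algebraMap_apply D A (L p)]
        exact (hxu.map (algebraMap A (L p))).ne_zero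
      have hb0 : μ b ≠ 0 := by
        have h1 : algebraMap (A ⧸ (p : Ideal A)) (L p) (Ideal.Quotient.mk _ b) ≠ 0 :=
          IsFractionRing.to_map_ne_zero_of_mem_nonZeroDivisors hb'
        exact h1
      refine ⟨_, ⟨_, hi', rfl⟩, _, ⟨_, hj', rfl⟩, ?_, ?_⟩
      · change μ _ ≠ 0
        rw [map_smul, Algebra.smul_def, map_pow]
        exact mul_ne_zero (pow_ne_zero _ hxL) hb0
      · change μ a / μ b * μ _ = μ _
        rw [map_smul, map_smul, mul_smul_comm, div_mul_cancel₀ _ hb0]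
  -- The kernel of the map to the product over the minimal primes is contained in the nilradical,
  -- which is zero.
  let j : integralClosure D A →ₗ[D] ∀ p, integralClosure D (L p) :=
    LinearMap.pi fun p => ((IsScalarTower.toAlgHom D A (L p)).toLinearMap ∘ₗ
      (integralClosure D A).val.toLinearMap).codRestrict (integralClosure D (L p)).toSubmodule
      fun z => z.2.map (IsScalarTower.toAlgHom D A (L p))
  have hj : Function.Injective j := by
    rw [← LinearMap.ker_eq_bot, LinearMap.ker_eq_bot']
    intro z hz
    refine Subtype.ext ?_
    have h1 : (z : A) ∈ nilradical A := by
      rw [nilradical, Ideal.zero_eq_bot, ← Ideal.sInf_minimalPrimes, Ideal.mem_sInf]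
      intro p hp
      have h2 : algebraMap (A ⧸ p) (FractionRing (A ⧸ p)) (Ideal.Quotient.mk p z) = 0 :=
        congrArg Subtype.val (congrFun hz ⟨p, hp⟩)
      have := hprime ⟨p, hp⟩
      rw [← Ideal.Quotient.eq_zero_iff_mem]
      exact IsFractionRing.injective (A ⧸ p) (FractionRing (A ⧸ p)) (by rw [h2, map_zero])
    exact (mem_nilradical.1 h1).eq_zero
  have h2 : IsNoetherian D (∀ p, integralClosure D (L p)) :=
    isNoetherian_of_isNoetherianRing_of_finite D _
  exact Module.Finite.iff_fg.1 (Module.Finite.of_injective j hj)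

/-- A finite algebra over `B = D[1/x]` comes from a finite algebra over `D`. -/
theorem exists_subalgebra_fg_of_finite {B : Type*} [CommRing B] [Algebra D B] [Algebra B A]
    [IsScalarTower D B A] [Module.Finite B A] {x : D} (hxu : IsUnit (algebraMap D B x))
    (hB : ∀ b : B, ∃ (n : ℕ) (d : D), algebraMap D B d = x ^ n • b) :
    ∃ A₁ : Subalgebra D A, A₁.toSubmodule.FG ∧ ∀ a : A, ∃ n : ℕ, x ^ n • a ∈ A₁ := by
  have hB' : ∀ b : B, ∃ n : ℕ, x ^ n • b ∈ (⊥ : Subalgebra D B) := fun b => by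
    obtain ⟨n, d, h⟩ := hB b
    exact ⟨n, Algebra.mem_bot.2 ⟨d, h⟩⟩
  have hloc := isLocalization_away_of_forall_exists_smul_mem hxu hB'
  have hint : ∀ a : A, ∃ n : ℕ, IsIntegral D (x ^ n • a) := fun a => by
    have h1 : IsIntegral B a := Algebra.IsIntegral.isIntegral a
    obtain ⟨⟨_, n, rfl⟩, hm⟩ := h1.exists_multiple_integral_of_isLocalization
      (Submonoid.powers (algebraMap D (⊥ : Subalgebra D B) x)) a
    have hbot : Algebra.IsIntegral D (⊥ : Subalgebra D B) := ⟨fun ⟨b, hb⟩ => by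
      obtain ⟨d, rfl⟩ := Algebra.mem_bot.1 hb
      exact isIntegral_algebraMap (R := D) (A := (⊥ : Subalgebra D B)) (x := d)⟩
    refine ⟨n, isIntegral_trans (A := (⊥ : Subalgebra D B)) _ ?_⟩
    have h2 : x ^ n • a = algebraMap D (⊥ : Subalgebra D B) x ^ n • a := by
      rw [← map_pow, algebraMap_smul]
    rw [h2]
    exact hm
  obtain ⟨G, hG⟩ := Module.Finite.fg_top (R := B) (M := A)
  choose e he using hint
  let A₁ := Algebra.adjoin D ((fun g => x ^ e g • g) '' (G : Set A))
  refine ⟨A₁, fg_adjoin_of_finite (G.finite_toSet.image _) ?_, fun a => ?_⟩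
  · rintro _ ⟨g, -, rfl⟩
    exact he g
  · have ha : a ∈ Submodule.span B (G : Set A) := hG ▸ Submodule.mem_top
    induction ha using Submodule.span_induction with
    | mem g hg => exact ⟨e g, Algebra.subset_adjoin ⟨g, hg, rfl⟩⟩
    | zero => exact ⟨0, by rw [smul_zero]; exact zero_mem _⟩
    | add a b _ _ iha ihb =>
      obtain ⟨i, hi⟩ := iha
      obtain ⟨j, hj⟩ := ihb
      refine ⟨i + j, ?_⟩
      rw [smul_add]
      refine add_mem ?_ ?_
      · rw [add_comm, pow_add, mul_smul]
        exact A₁.smul_mem hi _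
      · rw [pow_add, mul_smul]
        exact A₁.smul_mem hj _
    | smul b a _ iha =>
      obtain ⟨i, hi⟩ := iha
      obtain ⟨n, d, hd⟩ := hB b
      refine ⟨n + i, ?_⟩
      have h1 : x ^ (n + i) • b • a = d • x ^ i • a := by
        rw [← algebraMap_smul B d, hd, pow_add, mul_smul, smul_comm (x ^ i) b a, smul_assoc]
      rw [h1]
      exact A₁.smul_mem hi _

end Generic

/-! ### Points of the analytic space from discrete valuations, and integral elements at points. -/

section Points

theorem exists_absoluteValue {K : Type*} [Field K] (V : ValuationSubring K)
    [IsDiscreteValuationRing V] : ∃ v : AbsoluteValue K ℝ, IsNonarchimedean v ∧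
      (∀ a ∈ V, v a ≤ 1) ∧ ∀ a, V.valuation a < 1 → v a < 1 := by
  let w := IsDiscreteValuationRing.maximalIdeal V
  have hb : (1 : NNReal) < 2 := one_lt_two
  refine ⟨w.adicAbv (K := K) hb, w.isNonarchimedean_adicAbv hb, fun a ha => ?_, fun a ha => ?_⟩
  · exact w.adicAbv_coe_le_one (K := K) hb (⟨a, ha⟩ : V)
  · have h1 : a ∈ V := (V.valuation_le_one_iff a).1 ha.le
    refine (w.adicAbv_coe_lt_one_iff (K := K) hb (⟨a, h1⟩ : V)).2 ?_
    exact (V.valuation_lt_one_iff ⟨a, h1⟩).2 ha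

variable {k : Type*} [NormedField k] [IsUltrametricDist k] {𝒜 : Type*} [CommRing 𝒜] [Algebra k 𝒜]

/-- The homomorphism from `R⟨T⟩⟦S⟧` given by a presentation. -/
noncomputable def Presentation.ofSeriesHom (P : Presentation k 𝒜) :
    MixedSeries k P.m P.n →ₐ[ValRing k] 𝒜 :=
  (P.proj.restrictScalars (ValRing k)).comp Algebra.TensorProduct.includeRight

theorem exists_absoluteValue_norm_eq {K : Type*} [Field K] [IsDiscreteValuationRing (ValRing k)]
    {ϖ : ValRing k} (hϖ : Irreducible ϖ) (v : AbsoluteValue K ℝ)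
    (ι : k →+* K) (hι : ∀ c : ValRing k, v (ι c) ≤ 1) (hιϖ : v (ι ϖ) < 1) :
    ∃ t : ℝ, 0 < t ∧ ∀ c : k, v (ι c) ^ t = ‖c‖ := by
  have hϖ0 : (ϖ : k) ≠ 0 := fun h => hϖ.ne_zero (Subtype.ext h)
  have hv0 : 0 < v (ι ϖ) := v.pos ((map_ne_zero ι).2 hϖ0)
  have hn0 : 0 < ‖(ϖ : k)‖ := norm_pos_iff.2 hϖ0
  have hn1 := ValRing.norm_lt_one_of_irreducible hϖ
  -- The exponent is forced by agreement at `ϖ`; every nonzero element of `R` is a unit times a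
  -- power of `ϖ`.
  refine ⟨Real.log ‖(ϖ : k)‖ / Real.log (v (ι ϖ)),
    div_pos_of_neg_of_neg (Real.log_neg hn0 hn1) (Real.log_neg hv0 hιϖ), ?_⟩
  set t := Real.log ‖(ϖ : k)‖ / Real.log (v (ι ϖ)) with ht
  have h1 : v (ι ϖ) ^ t = ‖(ϖ : k)‖ := by
    rw [Real.rpow_def_of_pos hv0, ht, mul_div_cancel₀ _ (Real.log_neg hv0 hιϖ).ne, Real.exp_log hn0]
  have h2 : ∀ c : ValRing k, c ≠ 0 → v (ι c) ^ t = ‖(c : k)‖ := by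
    intro c hc
    obtain ⟨n, u, rfl⟩ := IsDiscreteValuationRing.eq_unit_mul_pow_irreducible hc hϖ
    have hu : v (ι ((u : ValRing k) : k)) = 1 := by
      refine le_antisymm (hι _) ?_
      have h3 : ((u : ValRing k) : k) * (((u⁻¹ : (ValRing k)ˣ) : ValRing k) : k) = 1 :=
        congrArg Subtype.val u.mul_inv
      have h4 : v (ι ((u : ValRing k) : k)) * v (ι (((u⁻¹ : (ValRing k)ˣ) : ValRing k) : k)) = 1 := by
        rw [← map_mul, ← map_mul, h3, map_one, map_one]
      rw [← h4]
      exact mul_le_of_le_one_right (v.nonneg _) (hι _)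
    rw [Subring.coe_mul, Subring.coe_pow, map_mul, map_mul, hu, one_mul, map_pow, map_pow, norm_mul,
      ValRing.isUnit_iff.1 u.isUnit, one_mul, norm_pow, ← h1, ← Real.rpow_natCast,
      ← Real.rpow_natCast, ← Real.rpow_mul hv0.le, ← Real.rpow_mul hv0.le, mul_comm]
  intro c
  by_cases hc0 : c = 0
  · rw [hc0, map_zero, map_zero, norm_zero, Real.zero_rpow]
    exact (div_pos_of_neg_of_neg (Real.log_neg hn0 hn1) (Real.log_neg hv0 hιϖ)).ne'
  by_cases hc : ‖c‖ ≤ 1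
  · exact h2 ⟨c, hc⟩ fun h => hc0 (congrArg Subtype.val h)
  · have hc' : ‖c⁻¹‖ ≤ 1 := by
      rw [norm_inv]
      exact inv_le_one_of_one_le₀ (not_le.1 hc).le
    have h3 := h2 ⟨c⁻¹, hc'⟩ fun h => inv_ne_zero hc0 (congrArg Subtype.val h)
    change v (ι c⁻¹) ^ t = ‖c⁻¹‖ at h3
    rw [map_inv₀, map_inv₀, norm_inv, Real.inv_rpow (v.nonneg _)] at h3
    exact inv_injective h3

/-- Points of the analytic space from discrete valuations. -/
theorem Presentation.exists_point [IsDiscreteValuationRing (ValRing k)] (P : Presentation k 𝒜)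
    {ϖ : ValRing k} (hϖ : Irreducible ϖ) {K : Type*} [Field K] (V : ValuationSubring K)
    [IsDiscreteValuationRing V] (ψ : 𝒜 →+* K) (hP : ∀ f, ψ (P.ofSeries f) ∈ V)
    (hϖ1 : V.valuation (ψ (algebraMap k 𝒜 ϖ)) < 1)
    (hX : ∀ j, V.valuation (ψ (P.ofSeries (MvPowerSeries.X j))) < 1) :
    ∃ x : P.Point, ∀ a, ψ a ∉ V → 1 < x.toMulRingSeminorm a := by
  obtain ⟨v, hv, hv1, hv2⟩ := exists_absoluteValue V
  obtain ⟨t, ht, hvt⟩ := exists_absoluteValue_norm_eq hϖ v (ψ.comp (algebraMap k 𝒜)) (fun c => by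
      have h1 : P.ofSeries (algebraMap (ValRing k) _ c) = algebraMap k 𝒜 c :=
        P.ofSeriesHom.commutes c
      rw [RingHom.comp_apply, ← h1]
      exact hv1 _ (hP _)) (hv2 _ hϖ1)
  refine ⟨{ toFun := fun a => v (ψ a) ^ t
            map_zero' := by rw [map_zero, map_zero, Real.zero_rpow ht.ne']
            add_le' := fun a b => ?_
            neg' := fun a => by rw [map_neg, map_neg_eq_map]
            map_one' := by rw [map_one, map_one, Real.one_rpow]
            map_mul' := fun a b => by rw [map_mul, map_mul, Real.mul_rpow (v.nonneg _) (v.nonneg _)]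
            apply_algebraMap' := fun c => hvt c
            apply_ofSeries_le' := fun f => Real.rpow_le_one (v.nonneg _) (hv1 _ (hP f)) ht.le
            apply_ofSeries_X_lt' := fun j => Real.rpow_lt_one (v.nonneg _) (hv2 _ (hX j)) ht },
          fun a ha => ?_⟩
  · rw [map_add]
    -- The exponent `t` may exceed `1`, so the triangle inequality for the power relies on the
    -- ultrametric inequality for `v`.
    refine (Real.rpow_le_rpow (v.nonneg _) (hv _ _) ht.le).trans ?_
    rcases le_total (v (ψ a)) (v (ψ b)) with h | h
    · rw [max_eq_right h]
      exact le_add_of_nonneg_left (Real.rpow_nonneg (v.nonneg _) _)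
    · rw [max_eq_left h]
      exact le_add_of_nonneg_right (Real.rpow_nonneg (v.nonneg _) _)
  · change 1 < v (ψ a) ^ t
    refine Real.one_lt_rpow ?_ ht
    have h0 : ψ a ≠ 0 := fun h => ha (h ▸ V.zero_mem)
    have h1 : V.valuation (ψ a)⁻¹ < 1 := by
      rw [map_inv₀]
      exact inv_lt_one_of_one_lt₀ (not_le.1 fun h => ha ((V.valuation_le_one_iff _).1 h))
    have h2 := hv2 _ h1
    rw [map_inv₀] at h2
    exact (inv_lt_one₀ (v.pos h0)).1 h2

/-- All powers of `f` lie in one finite `D`-module, on which the seminorm is bounded, so its value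
at `f` cannot exceed `1`. -/
theorem Presentation.Point.le_one_of_isIntegral {P : Presentation k 𝒜} (x : P.Point) {D : Type*}
    [CommRing D] [Algebra D 𝒜] (hD : ∀ d, x.toMulRingSeminorm (algebraMap D 𝒜 d) ≤ 1) {f : 𝒜}
    (hf : IsIntegral D f) : x.toMulRingSeminorm f ≤ 1 := by
  obtain ⟨G, hG⟩ := hf.fg_adjoin_singleton
  have hbound : ∀ z ∈ Submodule.span D (G : Set 𝒜),
      x.toMulRingSeminorm z ≤ ∑ g ∈ G, x.toMulRingSeminorm g := by
    intro z hz
    obtain ⟨c, hc⟩ := Submodule.mem_span_finset'.1 hz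
    rw [← hc]
    refine (Finset.le_sum_of_subadditive _ (map_zero _).le (map_add_le_add _) _ _).trans ?_
    rw [← Finset.sum_coe_sort G]
    refine Finset.sum_le_sum fun g _ => ?_
    rw [Algebra.smul_def, map_mul]
    exact mul_le_of_le_one_left (apply_nonneg _ _) (hD _)
  by_contra! h
  obtain ⟨n, hn⟩ := pow_unbounded_of_one_lt (∑ g ∈ G, x.toMulRingSeminorm g) h
  refine absurd hn (not_lt.2 ?_)
  rw [← map_pow]
  refine hbound _ ?_
  rw [hG]
  exact pow_mem (Algebra.self_mem_adjoin_singleton D f) n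

/-- In a local ring `3 - 2 = 1` makes `3` or `2` a unit, whatever the residue characteristic. -/
theorem ValRing.exists_isUnit_natCast [IsDiscreteValuationRing (ValRing k)] :
    ∃ q : ℕ, 1 < q ∧ IsUnit (q : ValRing k) := by
  have h : ((3 : ℕ) : ValRing k) + -((2 : ℕ) : ValRing k) = 1 := by push_cast; ring
  rcases IsLocalRing.isUnit_or_isUnit_of_add_one h with h | h
  · exact ⟨3, by norm_num, h⟩
  · exact ⟨2, by norm_num, by simpa using h⟩

theorem Presentation.exists_ofSeries_eq_smul [IsDiscreteValuationRing (ValRing k)]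
    (P : Presentation k 𝒜) {ϖ : ValRing k} (hϖ : Irreducible ϖ) (a : 𝒜) :
    ∃ (N : ℕ) (d : MixedSeries k P.m P.n), P.ofSeriesHom d = ϖ ^ N • a := by
  obtain ⟨z, rfl⟩ := P.surjective a
  induction z using TensorProduct.induction_on with
  | zero => exact ⟨0, 0, by simp⟩
  | tmul c d =>
    obtain ⟨N, r, hr⟩ : ∃ (N : ℕ) (r : ValRing k), (r : k) = (ϖ : k) ^ N * c := by
      obtain ⟨N, hN⟩ := ((tendsto_pow_atTop_nhds_zero_of_lt_one (norm_nonneg _)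
        (ValRing.norm_lt_one_of_irreducible hϖ)).mul_const ‖c‖).eventually_lt_const
          (u := 1) (by simp) |>.exists
      refine ⟨N, ⟨(ϖ : k) ^ N * c, ?_⟩, rfl⟩
      rw [ValRing.mem_iff, norm_mul, norm_pow]
      exact hN.le
    refine ⟨N, r • d, ?_⟩
    have h1 : ϖ ^ N • (c ⊗ₜ[ValRing k] d) = (1 : k) ⊗ₜ[ValRing k] (r • d) := by
      rw [TensorProduct.smul_tmul', ← TensorProduct.smul_tmul]
      congr 1
      rw [Algebra.smul_def, Algebra.smul_def, mul_one]
      exact hr.symm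
    have h2 : P.proj (ϖ ^ N • (c ⊗ₜ[ValRing k] d)) = ϖ ^ N • P.proj (c ⊗ₜ[ValRing k] d) :=
      map_smul (P.proj.restrictScalars (ValRing k)) _ _
    rw [← h2, h1]
    rfl
  | add y z hy hz =>
    obtain ⟨M, d, hd⟩ := hy
    obtain ⟨N, e, he⟩ := hz
    refine ⟨M + N, ϖ ^ N • d + ϖ ^ M • e, ?_⟩
    rw [map_add, map_add, map_smul, map_smul, hd, he, smul_add, smul_smul, smul_smul, ← pow_add,
      ← pow_add, add_comm N M]

end Points

/-! ### Assembly of the finiteness argument for ring homomorphisms. -/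

section RingHom

theorem isIntegralElem_of_isAdicComplete {D D' A : Type*} [CommRing D] [CommRing D'] [CommRing A]
    [IsNoetherianRing D] (σ : D →+* A) {x : D} (hx : x ∈ Ideal.jacobson (⊥ : Ideal D))
    (hxu : IsUnit (σ x)) (hA : ∀ a : A, ∃ (n : ℕ) (d : D), σ d = σ x ^ n * a) (ρ : D' →+* A) {x' : D'}
    [IsAdicComplete (Ideal.span {x'}) D'] {q : ℕ} (hq : 1 < q) (hqD : IsUnit (q : D'))
    (hρ : ρ x' = σ x) (d : D') : σ.IsIntegralElem (ρ d) := by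
  let := σ.toAlgebra
  refine isIntegral_map_of_isAdicComplete (A₁ := ⊥) hx hxu Subalgebra.fg_bot_toSubmodule (fun a => ?_)
    hq hqD ρ hρ d
  obtain ⟨N, e, he⟩ := hA a
  refine ⟨N, Algebra.mem_bot.2 ⟨e, ?_⟩⟩
  rw [Algebra.smul_def, map_pow]
  exact he

theorem isIntegralElem_map {D B A : Type*} [CommRing D] [CommRing B] [CommRing A] {σ : D →+* B}
    (φ : B →+* A) {b : B} (hb : σ.IsIntegralElem b) : (φ.comp σ).IsIntegralElem (φ b) := by
  obtain ⟨p, hp, hpe⟩ := hb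
  refine ⟨p, hp, ?_⟩
  rw [← Polynomial.hom_eval₂, hpe, map_zero]

universe v in
/-- Let `B = D[1/x]`, and let `A` be a reduced finite `B`-algebra. A subring of `A` whose elements are
integral over an adic ring mapping to `A` is finite over each subring of `B` containing the image of
`D`. -/
theorem finite_restrict_of_isIntegralElem {D D' B : Type*} {A : Type v} [CommRing D]
    [CommRing D'] [CommRing B] [CommRing A] [IsNoetherianRing D] [IsReduced A] (β : D →+* B)
    (α : D' →+* A) (φ : B →+* A) (hφ : φ.Finite) {x : D} (hx : x ∈ Ideal.jacobson (⊥ : Ideal D))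
    (hxu : IsUnit (β x)) (hB : ∀ b : B, ∃ (n : ℕ) (d : D), β d = β x ^ n * b)
    (H : ∀ (L : Type v) [Field L] [Algebra D L], IsFiniteFractionField D L →
      (integralClosure D L).toSubmodule.FG) {x' : D'} [IsAdicComplete (Ideal.span {x'}) D']
    {q : ℕ} (hq : 1 < q) (hqD : IsUnit (q : D')) (hxx' : α x' = φ (β x)) (T : Subring B)
    (S : Subring A) (h : ∀ b ∈ T, φ b ∈ S) (hT : ∀ d, β d ∈ T) (hS : ∀ f ∈ S, α.IsIntegralElem f) :
    (φ.restrict T S h).Finite := by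
  let := β.toAlgebra
  let := φ.toAlgebra
  let := (φ.comp β).toAlgebra
  have htower : IsScalarTower D B A := IsScalarTower.of_algebraMap_eq fun _ => rfl
  have hfin : Module.Finite B A := hφ
  have hxA : IsUnit (algebraMap D A x) := hxu.map φ
  obtain ⟨A₁, hA₁, hA⟩ := exists_subalgebra_fg_of_finite (A := A) hxu fun b => by
    obtain ⟨N, d, hd⟩ := hB b
    refine ⟨N, d, ?_⟩
    rw [Algebra.smul_def, map_pow]
    exact hd
  have hC := integralClosure_fg_of_isReduced hxA hA₁ hA H
  -- Transitivity: `f` is integral over the image of `D'`, and that image is integral over `D`.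
  have hle : ∀ f ∈ S, IsIntegral D f := by
    have h1 : ∀ d, IsIntegral D (α d) := isIntegral_map_of_isAdicComplete hx hxA hA₁ hA hq hqD α hxx'
    intro f hf
    obtain ⟨p, hp, hpe⟩ := hS f hf
    refine isIntegral_trans (A := integralClosure D A) _ ?_
    let τ : D' →+* integralClosure D A := α.codRestrict (integralClosure D A) h1
    refine ⟨p.map τ, hp.map τ, ?_⟩
    rw [Polynomial.eval₂_map]
    exact hpe
  let μ : D →+* T := β.codRestrict T hT
  refine RingHom.Finite.of_comp_finite (f := μ) ?_
  let := ((φ.restrict T S h).comp μ).toAlgebra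
  have hCfin : Module.Finite D (integralClosure D A) := Module.Finite.iff_fg.2 hC
  have hCnoeth : IsNoetherian D (integralClosure D A) := isNoetherian_of_isNoetherianRing_of_finite _ _
  let j : S →ₗ[D] integralClosure D A :=
    { toFun := fun f => ⟨f, hle f f.2⟩
      map_add' := fun _ _ => rfl
      map_smul' := fun d f => by
        refine Subtype.ext ?_
        rw [RingHom.id_apply, Algebra.smul_def]
        exact (Algebra.smul_def d (f : A)).symm }
  exact Module.Finite.of_injective j fun f g h => Subtype.ext (congrArg Subtype.val h :)

end RingHom

section MixedSeries

variable {k : Type*} [NormedField k] [IsUltrametricDist k]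

theorem MixedSeries.X_mem_jacobson (m n : ℕ) (j : Fin n) :
    (MvPowerSeries.X j : MixedSeries k m n) ∈ Ideal.jacobson (⊥ : Ideal (MixedSeries k m n)) :=
  have := MvPowerSeries.isAdicComplete_X (A := tate k m) j
  IsAdicComplete.le_jacobson_bot (Ideal.span {(MvPowerSeries.X j : MixedSeries k m n)})
    (Ideal.mem_span_singleton_self _)

theorem MixedSeries.mem_jacobson_of_irreducible [CompleteSpace k] (m n : ℕ) {ϖ : ValRing k}
    (hϖ : Irreducible ϖ) :
    algebraMap (ValRing k) (MixedSeries k m n) ϖ ∈ Ideal.jacobson (⊥ : Ideal (MixedSeries k m n)) :=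
  have := MixedSeries.isAdicComplete (m := m) (n := n) hϖ
  IsAdicComplete.le_jacobson_bot (Ideal.span {algebraMap (ValRing k) (MixedSeries k m n) ϖ})
    (Ideal.mem_span_singleton_self _)

theorem MixedSeries.isUnit_natCast (m n : ℕ) {q : ℕ} (hq : IsUnit (q : ValRing k)) :
    IsUnit (q : MixedSeries k m n) := by
  have := hq.map (algebraMap (ValRing k) (MixedSeries k m n))
  rwa [map_natCast] at this

end MixedSeries

/-! ### Power-bounded functions as an integral closure. -/

section Presentation

variable {k : Type*} [NormedField k] [IsUltrametricDist k] {𝒜 : Type*} [CommRing 𝒜] [Algebra k 𝒜]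

theorem Presentation.isUnit_ofSeriesHom (P : Presentation k 𝒜) {ϖ : ValRing k} (hϖ : Irreducible ϖ) :
    IsUnit (P.ofSeriesHom (algebraMap (ValRing k) _ ϖ)) := by
  rw [P.ofSeriesHom.commutes]
  exact (IsUnit.mk0 (ϖ : k) fun h => hϖ.ne_zero (Subtype.ext h)).map (algebraMap k 𝒜)

theorem Presentation.ofSeries_mem_powerBounded (P : Presentation k 𝒜) (f : MixedSeries k P.m P.n) :
    P.ofSeries f ∈ P.powerBounded :=
  (P.supNorm_le_one_iff _).2 fun x => x.apply_ofSeries_le' f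

theorem Presentation.map_ofSeriesHom_algebraMap (P𝒜 : Presentation k 𝒜) {ℬ : Type*} [CommRing ℬ] [Algebra k ℬ]
    (Pℬ : Presentation k ℬ) (φ : ℬ →ₐ[k] 𝒜) (c : ValRing k) : P𝒜.ofSeriesHom (algebraMap (ValRing k) _ c) =
      φ (Pℬ.ofSeriesHom (algebraMap (ValRing k) _ c)) := by
  rw [P𝒜.ofSeriesHom.commutes, Pℬ.ofSeriesHom.commutes]
  exact (φ.commutes (c : k)).symm

variable [IsDiscreteValuationRing (ValRing k)]

theorem Presentation.exists_ofSeriesHom_eq (P : Presentation k 𝒜) {ϖ : ValRing k}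
    (hϖ : Irreducible ϖ) (a : 𝒜) : ∃ (N : ℕ) (d : MixedSeries k P.m P.n),
      P.ofSeriesHom d = P.ofSeriesHom (algebraMap (ValRing k) _ ϖ) ^ N * a := by
  obtain ⟨N, d, h⟩ := P.exists_ofSeries_eq_smul hϖ a
  exact ⟨N, d, by rw [h, P.ofSeriesHom.commutes, ← map_pow, Algebra.smul_def]⟩

variable [CompleteSpace k]

/-- The ring of power-bounded functions is the integral closure of the special model. -/
theorem Presentation.mem_powerBounded_iff (P : Presentation k 𝒜) (f : 𝒜) :
    f ∈ P.powerBounded ↔ (P.ofSeriesHom : MixedSeries k P.m P.n →+* 𝒜).IsIntegralElem f := by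
  let : Algebra (MixedSeries k P.m P.n) 𝒜 :=
    (P.ofSeriesHom : MixedSeries k P.m P.n →+* 𝒜).toAlgebra
  obtain ⟨ϖ, hϖ⟩ := IsDiscreteValuationRing.exists_irreducible (ValRing k)
  refine (P.supNorm_le_one_iff f).trans ⟨fun h => ?_, fun h x => ?_⟩
  · by_contra hf
    -- The valuation is less than `1` on the Jacobson radical, which contains `ϖ` and every `Sⱼ`.
    -- These are exactly the strict inequalities that a point requires.
    obtain ⟨K, _, V, ψ, hV, hV1, hV2, hψ⟩ := exists_dvr_notMem_of_not_isIntegral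
      (A₁ := MixedSeries k P.m P.n) (P.isUnit_ofSeriesHom hϖ) (P.exists_ofSeriesHom_eq hϖ) hf
    obtain ⟨x, hx⟩ := P.exists_point hϖ V ψ hV1 (by
      have h1 := hV2 _ (MixedSeries.mem_jacobson_of_irreducible P.m P.n hϖ)
      have h2 : algebraMap (MixedSeries k P.m P.n) 𝒜 (algebraMap (ValRing k) _ ϖ) =
        algebraMap k 𝒜 ϖ := P.ofSeriesHom.commutes ϖ
      rwa [h2] at h1) fun j => hV2 _ (MixedSeries.X_mem_jacobson P.m P.n j)
    exact absurd (h x) (not_le.2 (hx f hψ))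
  · exact x.le_one_of_isIntegral (D := MixedSeries k P.m P.n) x.apply_ofSeries_le' h

variable {ℬ : Type*} [CommRing ℬ] [Algebra k ℬ]

/-- Homomorphisms of semi-affinoid algebras are contractive for the supremum seminorms. -/
theorem Presentation.map_mem_powerBounded (P𝒜 : Presentation k 𝒜) (Pℬ : Presentation k ℬ)
    (φ : ℬ →ₐ[k] 𝒜) {b : ℬ} (hb : b ∈ Pℬ.powerBounded) : φ b ∈ P𝒜.powerBounded := by
  obtain ⟨ϖ, hϖ⟩ := IsDiscreteValuationRing.exists_irreducible (ValRing k)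
  obtain ⟨q, hq, hqu⟩ := ValRing.exists_isUnit_natCast (k := k)
  let ρ : MixedSeries k Pℬ.m Pℬ.n →+* 𝒜 :=
    (φ : ℬ →+* 𝒜).comp (Pℬ.ofSeriesHom : MixedSeries k Pℬ.m Pℬ.n →+* ℬ)
  -- Finiteness of `φ` plays no role here: completeness of the series ring of `ℬ` makes its image
  -- integral over the series ring of `𝒜`.
  have hρ : ∀ d, ρ d ∈ P𝒜.powerBounded := fun d => by
    rw [P𝒜.mem_powerBounded_iff]
    have := MixedSeries.isAdicComplete (m := Pℬ.m) (n := Pℬ.n) hϖ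
    exact isIntegralElem_of_isAdicComplete
      (P𝒜.ofSeriesHom : MixedSeries k P𝒜.m P𝒜.n →+* 𝒜)
      (MixedSeries.mem_jacobson_of_irreducible _ _ hϖ) (P𝒜.isUnit_ofSeriesHom hϖ)
      (P𝒜.exists_ofSeriesHom_eq hϖ) ρ hq (MixedSeries.isUnit_natCast _ _ hqu)
      (P𝒜.map_ofSeriesHom_algebraMap Pℬ φ ϖ).symm d
  have hφb : ρ.IsIntegralElem (φ b) := isIntegralElem_map (φ : ℬ →+* 𝒜) ((Pℬ.mem_powerBounded_iff b).1 hb)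
  let := ρ.toAlgebra
  refine (P𝒜.supNorm_le_one_iff _).2 fun x =>
    x.le_one_of_isIntegral (D := MixedSeries k Pℬ.m Pℬ.n) (fun d => ?_) hφb
  exact (P𝒜.supNorm_le_one_iff _).1 (hρ d) x

end Presentation

end SemiAffinoid

/-- Let `k` be a complete, discretely valued, non-archimedean field, and let `φ : ℬ → 𝒜` be a
finite homomorphism of semi-affinoid `k`-algebras with `𝒜` reduced. Then `φ` maps `ℬ°` into `𝒜°`,
and the induced homomorphism `φ° : ℬ° → 𝒜°` is finite. The presentations through which the
analytic spaces, and hence `ℬ°` and `𝒜°`, are formed are arbitrary. -/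
theorem proposition6p1
    (k : Type*) [NontriviallyNormedField k] [IsUltrametricDist k] [CompleteSpace k]
    [IsDiscreteValuationRing (SemiAffinoid.ValRing k)]
    (𝒜 ℬ : Type*) [CommRing 𝒜] [Algebra k 𝒜] [CommRing ℬ] [Algebra k ℬ]
    (P𝒜 : SemiAffinoid.Presentation k 𝒜) (Pℬ : SemiAffinoid.Presentation k ℬ)
    [IsReduced 𝒜] (φ : ℬ →ₐ[k] 𝒜) (hφ : φ.Finite) :
    ∃ h : ∀ b ∈ Pℬ.powerBounded, φ b ∈ P𝒜.powerBounded,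
      ((φ : ℬ →+* 𝒜).restrict Pℬ.powerBounded P𝒜.powerBounded h).Finite := by
  refine ⟨fun b hb => P𝒜.map_mem_powerBounded Pℬ φ hb, ?_⟩
  obtain ⟨ϖ, hϖ⟩ := IsDiscreteValuationRing.exists_irreducible (SemiAffinoid.ValRing k)
  obtain ⟨q, hq, hqu⟩ := SemiAffinoid.ValRing.exists_isUnit_natCast (k := k)
  have := SemiAffinoid.MixedSeries.isAdicComplete (m := P𝒜.m) (n := P𝒜.n) hϖ
  exact SemiAffinoid.finite_restrict_of_isIntegralElem
    (Pℬ.ofSeriesHom : SemiAffinoid.MixedSeries k Pℬ.m Pℬ.n →+* ℬ)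
    (P𝒜.ofSeriesHom : SemiAffinoid.MixedSeries k P𝒜.m P𝒜.n →+* 𝒜) (φ : ℬ →+* 𝒜) hφ
    (SemiAffinoid.MixedSeries.mem_jacobson_of_irreducible _ _ hϖ) (Pℬ.isUnit_ofSeriesHom hϖ)
    (Pℬ.exists_ofSeriesHom_eq hϖ)
    (fun L _ _ hL => SemiAffinoid.MixedSeries.integralClosure_fg Pℬ.m Pℬ.n hL) hq
    (SemiAffinoid.MixedSeries.isUnit_natCast _ _ hqu)
    (P𝒜.map_ofSeriesHom_algebraMap Pℬ φ ϖ) Pℬ.powerBounded P𝒜.powerBounded _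
    Pℬ.ofSeries_mem_powerBounded fun f hf => (P𝒜.mem_powerBounded_iff f).1 hf
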